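/- Conventions. Let $X$ be a smooth vector field on a closed smooth manifold $M$, with flow $\varphi_t$. A critical element of $X$ is a rest point or a closed orbit (the orbit of a non-constant periodic point). $X$ is Morse–Smale if it has finitely many critical elements, all hyperbolic, every nonwandering point of its flow lies on a critical element, and the stable and unstable manifolds $W^s(\beta)$, $W^u(\beta)$ of the critical elements intersect transversally. The index of a rest point is $\dim W^u$ (the number of eigenvalues of the linearization with positive real part); the index of a closed orbit is $\dim W^u-1$ (the number of eigenvalues of modulus greater than $1$ of the derivative of the period map). For critical elements $\beta_1,\beta_2$ let $\alpha(\beta_1,\beta_2)\in\mathbb F:=\mathbb Z/2$ be the number mod $2$ of connected components of $W^u(\beta_1)\cap W^s(\beta_2)$. The Eidi–Jost complex of $X$ has as $C_k$ the free $\mathbb F$-vector space on the set $\mathcal B_k$ consisting of all rest points of index $k$, one element $\gamma^-$ for each closed orbit $\gamma$ of index $k$, and one element $\gamma^+$ for each closed orbit $\gamma$ of index $k-1$. Its differential is the linear map $\partial_k\colon C_k\to C_{k-1}$ with $\partial_k(\beta)=\sum_{\beta'}\alpha(\beta,\beta')\,\beta'$ for $\beta\in\mathcal B_k$, where $\beta'$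 runs over the elements of $\mathcal B_{k-1}$ whose critical element is different from that of $\beta$ (so $\gamma^-$ does not occur in $\partial(\gamma^+)$). Statement. There is a Morse–Smale vector field $X$ on $S^2$ whose critical elements are exactly one repelling closed orbit $\gamma$ (index $1$), two saddles $s_1,s_2$ (index $1$) and four sinks $q_1,q_2,q_3,q_4$ (index $0$), such that $W^u(\beta_1)\cap W^s(\beta_2)$ has finitely many connected components for all critical elements $\beta_1,\beta_2$, and whose Eidi–Jost complex is $$\mathbb F=\langle\gamma^+\rangle\xrightarrow{\ \partial_2\ }\mathbb F^3=\langle s_1,s_2,\gamma^-\rangle\xrightarrow{\ \partial_1\ }\mathbb F^4=\langle q_1,q_2,q_3,q_4\rangle,\qquad \partial_2=\begin{bmatrix}0\\0\\0\end{bmatrix},\quad \partial_1=\begin{bmatrix}1&0&1\\1&0&1\\0&1&1\\0&1&1\end{bmatrix}.$$ In particular $\partial_k\circ\partial_{k+1}=0$ for all $k\ge 1$, $\partial_2=0$ and $\partial_1$ has rank $2$. The homology of this complex is therefore $1$-dimensional in degree $1$ and $2$-dimensional in degree $0$, and it is not isomorphic, as a graded vector space, to the singular homology $H_*(S^2;\mathbb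 F)$. -/

import Mathlib

open scoped Manifold Topology ContDiff
open Filter

noncomputable section EidiJost

namespace EidiJost

section Dynamics

variable {n : ℕ} {M : Type*} [TopologicalSpace M] [ChartedSpace (EuclideanSpace ℝ (Fin n)) M]

/-- The (global) flow of a vector field `X`: `flow X t x` is the position at time `t` of the
integral curve of `X` that starts at `x`. For a smooth vector field on a closed manifold this
integral curve exists for all times and is unique. -/
def flow (X : (x : M) → TangentSpace (𝓡 n) x) (t : ℝ) (x : M) : M :=
  open Classical in
  if h : ∃ c : ℝ → M, c 0 = x ∧ IsMIntegralCurve c X then h.choose t else x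

/-- `p` is a rest point of `X`. -/
def IsRestPoint (X : (x : M) → TangentSpace (𝓡 n) x) (p : M) : Prop :=
  X p = 0

/-- `γ` is (the image of) a closed orbit of `X`, i.e. the orbit of a periodic point which is not a
rest point. -/
def IsClosedOrbit (X : (x : M) → TangentSpace (𝓡 n) x) (γ : Set M) : Prop :=
  ∃ x : M, X x ≠ 0 ∧ (∃ T : ℝ, 0 < T ∧ flow X T x = x) ∧ γ = Set.range (fun t : ℝ => flow X t x)

/-- A critical element of `X` is a rest point (as a one-point set) or a closed orbit. -/
def IsCriticalElement (X : (x : M) → TangentSpace (𝓡 n) x) (β : Set M) : Prop :=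
  (∃ p : M, IsRestPoint X p ∧ β = {p}) ∨ IsClosedOrbit X β

/-- The linearization `T_pM → T_pM` of the vector field `X` at a rest point `p`: the derivative
at `p` of `X`, read in the coordinates given by the chart at `p`. -/
def linearization [IsManifold (𝓡 n) 1 M] (X : (x : M) → TangentSpace (𝓡 n) x) (p : M) :
    EuclideanSpace ℝ (Fin n) →ₗ[ℝ] EuclideanSpace ℝ (Fin n) :=
  let A : EuclideanSpace ℝ (Fin n) →L[ℝ] EuclideanSpace ℝ (Fin n) :=
    mfderiv (𝓡 n) 𝓘(ℝ, EuclideanSpace ℝ (Fin n))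
      (fun x : M => (trivializationAt (EuclideanSpace ℝ (Fin n)) (TangentSpace (𝓡 n)) p
        (⟨x, X x⟩ : TangentBundle (𝓡 n) M)).2) p
  A.toLinearMap

/-- The least period of a point on a closed orbit. -/
def period (X : (x : M) → TangentSpace (𝓡 n) x) (x : M) : ℝ :=
  sInf {T : ℝ | 0 < T ∧ flow X T x = x}

/-- The monodromy `T_xM → T_xM` at a point `x` of a closed orbit: the derivative at `x` of the flow
map whose time is the period `T`. Source and target are the same space since the flow map fixes
`x`. -/
def monodromy (X : (x : M) → TangentSpace (𝓡 n) x) (x : M) :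
    EuclideanSpace ℝ (Fin n) →ₗ[ℝ] EuclideanSpace ℝ (Fin n) :=
  let A : EuclideanSpace ℝ (Fin n) →L[ℝ] EuclideanSpace ℝ (Fin n) :=
    mfderiv (𝓡 n) (𝓡 n) (flow X (period X x)) x
  A.toLinearMap

/-- The complex eigenvalues of a real endomorphism, with algebraic multiplicity. -/
def eigenvalues (A : EuclideanSpace ℝ (Fin n) →ₗ[ℝ] EuclideanSpace ℝ (Fin n)) : Multiset ℂ :=
  (A.charpoly.map (algebraMap ℝ ℂ)).roots

/-- A rest point is hyperbolic if no eigenvalue of its linearization is purely imaginary. -/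
def IsHyperbolicRestPoint [IsManifold (𝓡 n) 1 M] (X : (x : M) → TangentSpace (𝓡 n) x)
    (p : M) : Prop :=
  IsRestPoint X p ∧ ∀ z ∈ eigenvalues (linearization X p), z.re ≠ 0

/-- The index of a rest point, the dimension of its unstable manifold: the number of eigenvalues of
the linearization with positive real part. -/
def restIndex [IsManifold (𝓡 n) 1 M] (X : (x : M) → TangentSpace (𝓡 n) x) (p : M) : ℕ :=
  open Classical in
  ((eigenvalues (linearization X p)).filter (fun z => 0 < z.re)).card

/-- A closed orbit is hyperbolic if `1` (the eigenvalue in the direction of the flow) is a simple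
eigenvalue of the monodromy and the only one of modulus one. -/
def IsHyperbolicClosedOrbit (X : (x : M) → TangentSpace (𝓡 n) x) (γ : Set M) : Prop :=
  open Classical in
  IsClosedOrbit X γ ∧ ∀ x ∈ γ, (eigenvalues (monodromy X x)).filter (fun z => ‖z‖ = 1) = {1}

/-- The closed orbit `γ` has index `k`: `k` eigenvalues of the monodromy have modulus greater than
one, so that the unstable manifold has dimension `k + 1`. (The eigenvalues do not depend on the
point of `γ`.) -/
def HasOrbitIndex (X : (x : M) → TangentSpace (𝓡 n) x) (γ : Set M) (k : ℕ) : Prop :=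
  open Classical in
  ∀ x ∈ γ, ((eigenvalues (monodromy X x)).filter (fun z => 1 < ‖z‖)).card = k

/-- The set of points whose orbit converges to `β` along `l`; for `l = atTop` this is the stable
manifold of `β` and for `l = atBot` the unstable manifold. -/
def limitManifold (X : (x : M) → TangentSpace (𝓡 n) x) (l : Filter ℝ) (β : Set M) : Set M :=
  {x | Tendsto (fun t : ℝ => flow X t x) l (𝓝ˢ β)}

/-- The stable manifold `W^s(β)`. -/
abbrev Ws (X : (x : M) → TangentSpace (𝓡 n) x) (β : Set M) : Set M := limitManifold X atTop β

/-- The unstable manifold `W^u(β)`. -/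
abbrev Wu (X : (x : M) → TangentSpace (𝓡 n) x) (β : Set M) : Set M := limitManifold X atBot β

/-- The tangent space at `x` of the immersed submanifold `limitManifold X l β`, spanned by the
velocities of the curves through `x` in this submanifold. Since the submanifold is in general only
immersed, the curves have to be continuous in its own topology; this is what the locally uniform
convergence to `β` expresses (the curve is pushed by the flow into the local stable or unstable
manifold, which is embedded). Here `v` is a vector in `T_xM`. -/
def limitTangent (X : (x : M) → TangentSpace (𝓡 n) x) (l : Filter ℝ) (β : Set M) (x : M) :
    Submodule ℝ (TangentSpace (𝓡 n) x) :=
  Submodule.span ℝ {v : EuclideanSpace ℝ (Fin n) | ∃ c : ℝ → M, c 0 = x ∧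
    HasMFDerivAt 𝓘(ℝ, ℝ) (𝓡 n) c 0 ((1 : ℝ →L[ℝ] ℝ).smulRight v) ∧
    (∀ᶠ s in 𝓝 (0 : ℝ), c s ∈ limitManifold X l β) ∧
    Tendsto (fun p : ℝ × ℝ => flow X p.1 (c p.2)) (l ×ˢ 𝓝 (0 : ℝ)) (𝓝ˢ β)}

/-- `W^u(β₁)` and `W^s(β₂)` intersect transversally. -/
def TransverseManifolds (X : (x : M) → TangentSpace (𝓡 n) x) (β₁ β₂ : Set M) : Prop :=
  ∀ x ∈ Wu X β₁ ∩ Ws X β₂, limitTangent X atBot β₁ x ⊔ limitTangent X atTop β₂ x = ⊤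

/-- `x` is a nonwandering point of the flow of `X`. -/
def IsNonwandering (X : (x : M) → TangentSpace (𝓡 n) x) (x : M) : Prop :=
  ∀ U ∈ 𝓝 x, ∀ T : ℝ, ∃ t : ℝ, T < t ∧ ∃ y ∈ U, flow X t y ∈ U

/-- Morse–Smale vector fields (on a closed smooth manifold): smooth vector fields with finitely many
rest points and closed orbits, all of them hyperbolic, whose nonwandering points all lie on these
critical elements, and such that all stable and unstable manifolds of critical elements intersect
transversally. -/
structure IsMorseSmale [IsManifold (𝓡 n) 1 M] (X : (x : M) → TangentSpace (𝓡 n) x) : Prop where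
  smooth : ContMDiff (𝓡 n) (𝓡 n).tangent ∞ (fun x : M => (⟨x, X x⟩ : TangentBundle (𝓡 n) M))
  finite_rest : {p : M | IsRestPoint X p}.Finite
  finite_orbits : {γ : Set M | IsClosedOrbit X γ}.Finite
  hyperbolic_rest : ∀ p, IsRestPoint X p → IsHyperbolicRestPoint X p
  hyperbolic_orbits : ∀ γ, IsClosedOrbit X γ → IsHyperbolicClosedOrbit X γ
  nonwandering : ∀ x, IsNonwandering X x → ∃ β, IsCriticalElement X β ∧ x ∈ β
  transverse : ∀ β₁ β₂, IsCriticalElement X β₁ → IsCriticalElement X β₂ →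
    TransverseManifolds X β₁ β₂

end Dynamics

section Complex

variable {n : ℕ} {M : Type*} [TopologicalSpace M] [ChartedSpace (EuclideanSpace ℝ (Fin n)) M]

/-- The number mod 2 of connected components of `W^u(β₁) ∩ W^s(β₂)`. -/
def alpha (X : (x : M) → TangentSpace (𝓡 n) x) (β₁ β₂ : Set M) : ZMod 2 :=
  (Nat.card (ConnectedComponents ↥(Wu X β₁ ∩ Ws X β₂)) : ZMod 2)

variable [IsManifold (𝓡 n) 1 M]

/-- The canonical generators in degree `k`: the rest points of index `k`, a copy `γ⁻` of each
closed orbit `γ` of index `k`, and a copy `γ⁺` of each closed orbit `γ` of index `k - 1`. -/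
inductive Generator (X : (x : M) → TangentSpace (𝓡 n) x) (k : ℕ) : Type _ where
  | rest (p : M) (hp : IsRestPoint X p) (hk : restIndex X p = k) : Generator X k
  | minus (γ : Set M) (hγ : IsClosedOrbit X γ) (hk : HasOrbitIndex X γ k) : Generator X k
  | plus (γ : Set M) (hγ : IsClosedOrbit X γ) (j : ℕ) (hj : HasOrbitIndex X γ j)
      (hk : j + 1 = k) : Generator X k

/-- The critical element underlying a generator. -/
def Generator.carrier {X : (x : M) → TangentSpace (𝓡 n) x} {k : ℕ} : Generator X k → Set M
  | .rest p _ _ => {p}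
  | .minus γ _ _ => γ
  | .plus γ _ _ _ _ => γ

/-- The space `C_k` of the Eidi–Jost complex over the field with two elements. -/
abbrev Chain (X : (x : M) → TangentSpace (𝓡 n) x) (k : ℕ) : Type _ := Generator X k →₀ ZMod 2

/-- The coefficient of `β'` in the boundary of `β`. The two copies `γ⁺`, `γ⁻` of one closed orbit
are not counted as connected to each other. -/
def incidence (X : (x : M) → TangentSpace (𝓡 n) x) {i j : ℕ} (β : Generator X i)
    (β' : Generator X j) : ZMod 2 :=
  open Classical in
  if β.carrier = β'.carrier then 0 else alpha X β.carrier β'.carrier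

/-- The Eidi–Jost differential: `boundary X i j : C_i → C_j` is `∂_i` if `i = j + 1`, and is zero
otherwise. -/
def boundary (X : (x : M) → TangentSpace (𝓡 n) x) (i j : ℕ) :
    Chain X i →ₗ[ZMod 2] Chain X j :=
  if i = j + 1 then
    Finsupp.linearCombination (ZMod 2) (fun β : Generator X i =>
      ∑ᶠ β' : Generator X j, Finsupp.single β' (incidence X β β'))
  else 0

/-- The cycles `ker ∂_k` in degree `k` (with `∂_0 = 0`). -/
def cycles (X : (x : M) → TangentSpace (𝓡 n) x) (k : ℕ) : Submodule (ZMod 2) (Chain X k) :=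
  LinearMap.ker (boundary X k (k - 1))

/-- The boundaries `im ∂_{k+1}`, as a subspace of the cycles. -/
def boundaries (X : (x : M) → TangentSpace (𝓡 n) x) (k : ℕ) : Submodule (ZMod 2) (cycles X k) :=
  (LinearMap.range (boundary X (k + 1) k)).submoduleOf (cycles X k)

/-- The homology `ker ∂_k / im ∂_{k+1}`, meaningful if `∂_k ∘ ∂_{k+1} = 0`. -/
abbrev Homology (X : (x : M) → TangentSpace (𝓡 n) x) (k : ℕ) : Type _ :=
  ↥(cycles X k) ⧸ boundaries X k

/-- The basis of `C_k` obtained from an enumeration of its canonical generators. -/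
abbrev chainBasis {X : (x : M) → TangentSpace (𝓡 n) x} {k m : ℕ} (e : Fin m ≃ Generator X k) :
    Module.Basis (Fin m) (ZMod 2) (Chain X k) :=
  Finsupp.basisSingleOne.reindex e.symm

end Complex

/-- The two-dimensional sphere. -/
abbrev S2 : Type := ↥(Metric.sphere (0 : EuclideanSpace ℝ (Fin 3)) 1)

/-- Singular homology of the 2-sphere with coefficients in the field with two elements. -/
abbrev singularHomologyS2 (k : ℕ) : ModuleCat.{0} (ZMod 2) :=
  ((AlgebraicTopology.singularHomologyFunctor (ModuleCat.{0} (ZMod 2)) k).obj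
    (ModuleCat.of (ZMod 2) (ZMod 2))).obj (TopCat.of S2)

end EidiJost

end EidiJost

/-!
# A Morse–Smale field on the sphere for which the Eidi–Jost homology is not singular homology

The vector field is symmetric under the reflection at the equator. The equator is the closed orbit;
it rotates with unit speed and repels. On each open hemisphere the flow is, in suitable coordinates
`(u, v)` of the plane, the flow of the field `(planeField u v, -v)`. This field is `(u - u ^ 3, -v)`
for `u ^ 2 + v ^ 2 ≤ 4` and `(-u, -v)` for `10 ≤ u ^ 2 + v ^ 2`, so it has a saddle at the origin
and sinks at `(1, 0)` and `(-1, 0)`, and all other orbits come from infinity or from the saddle.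
The coordinates are obtained from the central projection of the hemisphere to the plane by turning
the point at height `z` by the angle `-log |z|`. Along the linear flow near infinity `-log |z|` is
`-t` up to a term that converges backwards in time, so that the linear flow, which alone would have
every point of the equator at rest in the limit, extends to the rotation of the equator.
The field is defined by an explicit formula in space (`spaceField`), which is smooth since the cutoff
removes the terms with `log |z|` near the equator, and `spaceField_spiral` identifies it in the
coordinates.

No general theory of the flow is needed. The second coordinate is `v = v₀ exp (-t)`, the function
`u ^ 2 + v ^ 2 - 1` decays at least as `exp (-2 t)`, and `1 / u ^ 2` satisfies an affine equation.
These estimates are locally uniform in the initial point and give the limits of all flow lines: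
`tendsto_flow_atTop` for the convergence to the sinks and `tendsto_flow_atBot`,
`tendsto_flow_atBot_equator` for the convergence to the equator backwards in time. Stable and
unstable manifolds (`mem_Ws_node`, `mem_Wu_equator`, `mem_Wu_saddle`) are therefore explicit sets in
the coordinates. By the local uniformity, points that are not critical wander
(`exists_critical_of_nonwandering`), and the tangent spaces of the unstable manifold of the equator
and of the stable manifolds of the sinks are the whole tangent plane (`limitTangent_eq_top`), so
that transversality has to be checked only at the saddles, where the manifolds are the coordinate
axes.

Eigenvalues are read off from curves. An invariant curve through a rest point gives an eigenvector
of the linearization (`linearization_of_invariant_curve`); the axes through the rest points are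
invariant. The eigenvectors of the monodromy of the equator are the directions of the equator and
of the meridian, with eigenvalues `1` and `exp (2 π)`, since the flow near the equator has a closed
formula (`flow_eventuallyEq_nearFlow`).

The stable manifold of a saddle, without the saddle, consists of two flow lines from the equator,
which cancel mod `2` (`natCard_equator_inter_saddle`). The stable manifold of a sink, without the
segment between the saddle and the sink, is connected (`isConnected_equator_inter_sink`).
This gives the matrices of the differential, hence the homology, which has dimension `2` in
degree `0`,
whereas the singular homology of a path-connected space has dimension `1` there.
-/

noncomputable section

namespace EidiJost

/-! ### Vector fields on the sphere given by tangential fields in space -/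

/-- The ambient space of the sphere. -/
abbrev E3 : Type := EuclideanSpace ℝ (Fin 3)

/-- The form in which the results on spheres of dimension `2` ask for the dimension. -/
instance : Fact (Module.finrank ℝ E3 = 2 + 1) := ⟨finrank_euclideanSpace_fin⟩

lemma contMDiff_coe_S2 {m : ℕ∞ω} : ContMDiff (𝓡 2) 𝓘(ℝ, E3) m ((↑) : S2 → E3) :=
  contMDiff_coe_sphere

/-- The differential of the inclusion of the sphere, at the point `x`. -/
def inclDeriv (x : S2) : TangentSpace (𝓡 2) x →L[ℝ] E3 := mvfderiv (𝓡 2) ((↑) : S2 → E3) x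

lemma inclDeriv_injective (x : S2) : Function.Injective (inclDeriv x) :=
  injective_mvfderiv_subtypeVal_sphere (n := 2) x

lemma hasMFDerivAt_coe (x : S2) :
    HasMFDerivAt (𝓡 2) 𝓘(ℝ, E3) ((↑) : S2 → E3) x (inclDeriv x) :=
  ((contMDiff_coe_S2 (m := 1) x).mdifferentiableAt one_ne_zero).hasMFDerivAt

lemma contMDiff_codRestrict {H E M : Type*} [NormedAddCommGroup E] [NormedSpace ℝ E]
    [TopologicalSpace H] {I : ModelWithCorners ℝ E H} [TopologicalSpace M] [ChartedSpace H M]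
    {m : ℕ∞ω} [IsManifold I m M] {f : M → S2} (hf : ContMDiff I 𝓘(ℝ, E3) m (fun x => (f x : E3))) :
    ContMDiff I (𝓡 2) m f :=
  ContMDiff.codRestrict_sphere (n := 2) hf (fun x => (f x).2)

/-- If the curve `c` has velocity `v` in the sphere, it has velocity `inclDeriv _ v` in space. -/
lemma hasDerivAt_coe_of_hasMFDerivAt {c : ℝ → S2} {t : ℝ} {v : TangentSpace (𝓡 2) (c t)}
    (h : HasMFDerivAt 𝓘(ℝ, ℝ) (𝓡 2) c t ((1 : ℝ →L[ℝ] ℝ).smulRight v)) :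
    HasDerivAt (fun s => (c s : E3)) (inclDeriv (c t) v) t := by
  have h1 := (hasMFDerivAt_coe (c t)).comp t h
  have h2 : HasFDerivAt (fun s => (c s : E3))
      ((inclDeriv (c t) : EuclideanSpace ℝ (Fin 2) →L[ℝ] E3).comp
        ((1 : ℝ →L[ℝ] ℝ).smulRight (v : EuclideanSpace ℝ (Fin 2)))) t := h1.hasFDerivAt
  have h3 := h2.hasDerivAt
  simpa using h3

/-- The velocity of a differentiable curve in the sphere can be read off in space. -/
lemma hasVelocity_of_coe {c : ℝ → S2} {t : ℝ} {w : E3}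
    (hc : MDifferentiableAt 𝓘(ℝ, ℝ) (𝓡 2) c t)
    (h : HasDerivAt (fun s => (c s : E3)) w t) :
    ∃ v : TangentSpace (𝓡 2) (c t), inclDeriv (c t) v = w ∧
      HasMFDerivAt 𝓘(ℝ, ℝ) (𝓡 2) c t ((1 : ℝ →L[ℝ] ℝ).smulRight v) := by
  set D := mfderiv 𝓘(ℝ, ℝ) (𝓡 2) c t with hD
  have h0 : HasMFDerivAt 𝓘(ℝ, ℝ) (𝓡 2) c t D := hc.hasMFDerivAt
  let v : TangentSpace (𝓡 2) (c t) := D (1 : ℝ)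
  have hv : D = ((1 : ℝ →L[ℝ] ℝ).smulRight v) := by
    exact ContinuousLinearMap.ext_ring (R₁ := ℝ) (by simp [v]; rfl)
  have h1 : HasMFDerivAt 𝓘(ℝ, ℝ) (𝓡 2) c t ((1 : ℝ →L[ℝ] ℝ).smulRight v) := hv ▸ h0
  exact ⟨v, (hasDerivAt_coe_of_hasMFDerivAt h1).unique h, h1⟩

lemma hasVelocity_of_coe_of_eq {c : ℝ → S2} {t : ℝ} {v : TangentSpace (𝓡 2) (c t)}
    (hc : MDifferentiableAt 𝓘(ℝ, ℝ) (𝓡 2) c t)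
    (h : HasDerivAt (fun s => (c s : E3)) (inclDeriv (c t) v) t) :
    HasMFDerivAt 𝓘(ℝ, ℝ) (𝓡 2) c t ((1 : ℝ →L[ℝ] ℝ).smulRight v) := by
  obtain ⟨w, hw, hw'⟩ := hasVelocity_of_coe hc h
  rwa [← inclDeriv_injective _ hw]

/-- A vector field in space which is tangential to the sphere along the sphere. -/
def IsTangential (V : E3 → E3) : Prop := ∀ p : S2, inner ℝ (p : E3) (V p) = 0

/-- The point of the sphere that is reached from `p` by a straight step `t • V p`, followed by the
central projection. -/
def eulerStep (V : E3 → E3) (hV : IsTangential V) (t : ℝ) (p : S2) : S2 :=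
  ⟨(√(1 + t ^ 2 * ‖V p‖ ^ 2))⁻¹ • ((p : E3) + t • V p), by
    have hp : ‖(p : E3)‖ = 1 := by simp
    have h1 : ‖(p : E3) + t • V p‖ ^ 2 = 1 + t ^ 2 * ‖V p‖ ^ 2 := by
      rw [norm_add_sq_real, inner_smul_right, hV p, hp, norm_smul, Real.norm_eq_abs, mul_pow,
        sq_abs]
      ring
    have h2 : ‖(p : E3) + t • V p‖ = √(1 + t ^ 2 * ‖V p‖ ^ 2) := by
      rw [← h1, Real.sqrt_sq (norm_nonneg _)]
    have h3 : 0 < √(1 + t ^ 2 * ‖V p‖ ^ 2) := by positivity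
    rw [mem_sphere_zero_iff_norm, norm_smul, norm_inv, Real.norm_of_nonneg h3.le, h2,
      inv_mul_cancel₀ h3.ne']⟩

lemma eulerStep_zero {V : E3 → E3} (hV : IsTangential V) (p : S2) : eulerStep V hV 0 p = p := by
  apply Subtype.ext
  simp [eulerStep]

lemma contMDiff_eulerStep {V : E3 → E3} (hV : IsTangential V) (hs : ContDiff ℝ ∞ V) :
    ContMDiff (𝓘(ℝ, ℝ).prod (𝓡 2)) (𝓡 2) ∞ (fun q : ℝ × S2 => eulerStep V hV q.1 q.2) := by
  apply contMDiff_codRestrict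
  have h1 : ContDiff ℝ ∞ (fun q : ℝ × E3 =>
      (√(1 + q.1 ^ 2 * ‖V q.2‖ ^ 2))⁻¹ • (q.2 + q.1 • V q.2)) := by
    have h0 : ContDiff ℝ ∞ (fun q : ℝ × E3 => V q.2) := hs.comp contDiff_snd
    have h2 : ContDiff ℝ ∞ (fun q : ℝ × E3 => √(1 + q.1 ^ 2 * ‖V q.2‖ ^ 2)) := by
      apply ContDiff.sqrt
      · exact contDiff_const.add ((contDiff_fst.pow 2).mul (h0.norm_sq ℝ))
      · intro q; positivity
    refine (h2.inv fun q => ?_).smul (contDiff_snd.add (contDiff_fst.smul h0))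
    positivity
  have h3 : ContMDiff (𝓘(ℝ, ℝ).prod (𝓡 2)) 𝓘(ℝ, ℝ × E3) ∞
      (fun q : ℝ × S2 => (q.1, (q.2 : E3))) :=
    contMDiff_fst.prodMk_space (contMDiff_coe_S2.comp contMDiff_snd)
  exact h1.contMDiff.comp h3

/-- The vector field on the sphere which is the restriction of the field `V` in space, provided `V`
is tangential to the sphere: the velocity at time `0` of `eulerStep V`. -/
def sphereField (V : E3 → E3) (hV : IsTangential V) (x : S2) : TangentSpace (𝓡 2) x :=
  let A : ℝ →L[ℝ] EuclideanSpace ℝ (Fin 2) :=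
    mfderiv 𝓘(ℝ, ℝ) (𝓡 2) (fun t => eulerStep V hV t x) 0
  (A 1 : EuclideanSpace ℝ (Fin 2))

lemma contMDiff_eulerStep_left {V : E3 → E3} (hV : IsTangential V) (hs : ContDiff ℝ ∞ V) (x : S2) :
    ContMDiff 𝓘(ℝ, ℝ) (𝓡 2) ∞ (fun t => eulerStep V hV t x) :=
  (contMDiff_eulerStep hV hs).comp (contMDiff_id.prodMk contMDiff_const)

lemma mk_tangentBundle_congr {x y : S2} (h : x = y) (v : EuclideanSpace ℝ (Fin 2)) :
    (⟨x, v⟩ : TangentBundle (𝓡 2) S2) = ⟨y, v⟩ := by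
  subst h; rfl

/-- All tangent spaces are the same type, so a vector can be moved along an equality of points. -/
lemma inclDeriv_congr {x y : S2} (h : x = y) (v : EuclideanSpace ℝ (Fin 2)) :
    inclDeriv x v = inclDeriv y v := by
  subst h; rfl

/-- In space, `sphereField V` is `V`. -/
lemma inclDeriv_sphereField {V : E3 → E3} (hV : IsTangential V) (hs : ContDiff ℝ ∞ V) (x : S2) :
    inclDeriv x (sphereField V hV x) = V x := by
  have hd : MDifferentiableAt 𝓘(ℝ, ℝ) (𝓡 2) (fun t => eulerStep V hV t x) 0 :=
    (contMDiff_eulerStep_left hV hs x 0).mdifferentiableAt (by simp)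
  have h1 : HasDerivAt (fun t => (eulerStep V hV t x : E3)) (V x) 0 := by
    have h2 : HasDerivAt (fun t : ℝ => (√(1 + t ^ 2 * ‖V x‖ ^ 2))⁻¹) 0 0 := by
      have h3 : HasDerivAt (fun t : ℝ => 1 + t ^ 2 * ‖V x‖ ^ 2) 0 0 := by
        have := (((hasDerivAt_id (0 : ℝ)).pow 2).mul_const (‖V x‖ ^ 2)).const_add 1
        simpa using this
      have h4 := (h3.sqrt (by simp)).inv (by simp)
      simpa [Function.comp_def] using! h4
    have h5 : HasDerivAt (fun t : ℝ => (x : E3) + t • V x) (V x) 0 := by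
      have := ((hasDerivAt_id (0 : ℝ)).smul_const (V x)).const_add (x : E3)
      simpa using this
    have := h2.smul h5
    simpa using! this
  have h6 := hd.hasMFDerivAt
  have h7 := (hasMFDerivAt_coe (eulerStep V hV 0 x)).comp 0 h6
  have h8 : HasFDerivAt (fun t => (eulerStep V hV t x : E3))
      ((inclDeriv (eulerStep V hV 0 x) : EuclideanSpace ℝ (Fin 2) →L[ℝ] E3).comp
        (mfderiv 𝓘(ℝ, ℝ) (𝓡 2) (fun t => eulerStep V hV t x) 0 :
          ℝ →L[ℝ] EuclideanSpace ℝ (Fin 2))) 0 := h7.hasFDerivAt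
  have h9 := h8.hasDerivAt.unique h1
  rw [← h9]
  exact inclDeriv_congr (eulerStep_zero hV x).symm _

/-- The field is the partial derivative of the smooth map `eulerStep V` with respect to time, that
is, its tangent map applied to the vectors `(1, 0)` at the points `(0, x)`. -/
lemma contMDiff_sphereField {V : E3 → E3} (hV : IsTangential V) (hs : ContDiff ℝ ∞ V) :
    ContMDiff (𝓡 2) (𝓡 2).tangent ∞
      (fun x : S2 => (⟨x, sphereField V hV x⟩ : TangentBundle (𝓡 2) S2)) := by
  have h1 := (contMDiff_eulerStep hV hs).contMDiff_tangentMap (m := ∞) le_rfl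
  have h2 : ContMDiff (𝓡 2) (𝓘(ℝ, ℝ).tangent.prod (𝓡 2).tangent) ∞
      (fun x : S2 => ((⟨0, (1 : ℝ)⟩ : TangentBundle 𝓘(ℝ, ℝ) ℝ),
        (⟨x, 0⟩ : TangentBundle (𝓡 2) S2))) :=
    contMDiff_const.prodMk (Bundle.contMDiff_zeroSection ℝ (TangentSpace (𝓡 2) : S2 → Type _))
  have h3 := h1.comp ((contMDiff_equivTangentBundleProd_symm (n := ∞) (I := 𝓘(ℝ, ℝ))
    (I' := 𝓡 2) (M := ℝ) (M' := S2)).comp h2)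
  refine h3.congr fun x => ?_
  have hd : MDifferentiableAt (𝓘(ℝ, ℝ).prod (𝓡 2)) (𝓡 2)
      (fun q : ℝ × S2 => eulerStep V hV q.1 q.2) (0, x) :=
    (contMDiff_eulerStep hV hs (0, x)).mdifferentiableAt (by simp)
  have h4 := hd.hasMFDerivAt
  have h5 : HasMFDerivAt 𝓘(ℝ, ℝ) (𝓘(ℝ, ℝ).prod (𝓡 2)) (fun t : ℝ => (t, x)) 0
      ((ContinuousLinearMap.id ℝ (TangentSpace 𝓘(ℝ, ℝ) (0 : ℝ))).prod 0) :=
    (hasMFDerivAt_id (0 : ℝ)).prodMk (hasMFDerivAt_const x (0 : ℝ))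
  have h6 := (h4.comp (0 : ℝ) h5).mfderiv
  have h7 : sphereField V hV x =
      (mfderiv (𝓘(ℝ, ℝ).prod (𝓡 2)) (𝓡 2)
      (fun q : ℝ × S2 => eulerStep V hV q.1 q.2) (0, x) ((1 : ℝ), 0) :
        EuclideanSpace ℝ (Fin 2)) := by
    unfold sphereField
    change (mfderiv 𝓘(ℝ, ℝ) (𝓡 2) ((fun q : ℝ × S2 => eulerStep V hV q.1 q.2) ∘
      (fun t : ℝ => (t, x))) 0) (1 : ℝ) = _
    rw [h6]
    rfl
  rw [h7]
  exact mk_tangentBundle_congr (eulerStep_zero hV x).symm _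

/-- A `C¹` curve on the sphere which solves the ODE of `V` in space is an integral curve. -/
lemma isMIntegralCurve_sphereField {V : E3 → E3} (hV : IsTangential V) (hs : ContDiff ℝ ∞ V)
    {c : ℝ → S2} (hc : ∀ t, HasDerivAt (fun s => (c s : E3)) (V (c t)) t) :
    IsMIntegralCurve c (sphereField V hV) := by
  have hcont : Continuous (fun s => (c s : E3)) :=
    continuous_iff_continuousAt.2 fun t => (hc t).continuousAt
  have h1 : ContDiff ℝ 1 (fun s => (c s : E3)) := by
    rw [contDiff_one_iff_deriv]
    refine ⟨fun t => (hc t).differentiableAt, ?_⟩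
    have : deriv (fun s => (c s : E3)) = fun t => V (c t) := funext fun t => (hc t).deriv
    rw [this]
    exact hs.continuous.comp hcont
  have h2 : ContMDiff 𝓘(ℝ, ℝ) (𝓡 2) 1 c := contMDiff_codRestrict h1.contMDiff
  intro t
  apply hasVelocity_of_coe_of_eq ((h2 t).mdifferentiableAt one_ne_zero)
  rw [inclDeriv_sphereField hV hs]
  exact hc t

/-- Any global integral curve is a flow line. -/
lemma flow_eq_of_isMIntegralCurve {X : (x : S2) → TangentSpace (𝓡 2) x}
    (hX : ContMDiff (𝓡 2) (𝓡 2).tangent 1 (fun x : S2 => (⟨x, X x⟩ : TangentBundle (𝓡 2) S2)))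
    {c : ℝ → S2} (hc : IsMIntegralCurve c X) (t : ℝ) : flow X t (c 0) = c t := by
  have h : ∃ c' : ℝ → S2, c' 0 = c 0 ∧ IsMIntegralCurve c' X := ⟨c, rfl, hc⟩
  unfold flow
  rw [dif_pos h]
  exact congrFun (isMIntegralCurve_Ioo_eq_of_contMDiff_boundaryless (t₀ := 0) hX
    h.choose_spec.2 hc h.choose_spec.1) t

/-! ### Eigenvalues of linearizations and monodromies -/

/-- The model of the tangent planes of the sphere. -/
abbrev E2 : Type := EuclideanSpace ℝ (Fin 2)

/-- Two independent eigenvectors determine the eigenvalues. -/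
lemma eigenvalues_eq_pair (A : E2 →ₗ[ℝ] E2) {v₁ v₂ : E2} {a b : ℝ}
    (hv : LinearIndependent ℝ ![v₁, v₂]) (h₁ : A v₁ = a • v₁) (h₂ : A v₂ = b • v₂) :
    eigenvalues A = {(a : ℂ), (b : ℂ)} := by
  let B : Module.Basis (Fin 2) ℝ E2 := basisOfLinearIndependentOfCardEqFinrank hv (by simp)
  have hB : ∀ i, B i = ![v₁, v₂] i := fun i => by simp [B]
  have hM : LinearMap.toMatrix B B A = Matrix.diagonal ![a, b] := by
    ext i j
    rw [LinearMap.toMatrix_apply]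
    fin_cases j
    · have : A (B 0) = a • B 0 := by rw [hB]; exact h₁
      simp only [Fin.zero_eta, this]
      fin_cases i <;> simp [Matrix.diagonal]
    · have : A (B 1) = b • B 1 := by rw [hB]; exact h₂
      simp only [Fin.mk_one, this]
      fin_cases i <;> simp [Matrix.diagonal]
  unfold eigenvalues
  rw [← LinearMap.charpoly_toMatrix A B, hM, Matrix.charpoly_diagonal]
  simp only [Fin.prod_univ_two, Matrix.cons_val_zero, Matrix.cons_val_one, Polynomial.map_mul,
    Polynomial.map_sub, Polynomial.map_X, Polynomial.map_C]
  rw [Polynomial.roots_mul (mul_ne_zero (Polynomial.X_sub_C_ne_zero _)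
    (Polynomial.X_sub_C_ne_zero _)), Polynomial.roots_X_sub_C, Polynomial.roots_X_sub_C]
  rfl

/-- A product whose scalar factor vanishes is differentiable as soon as the other factor is
continuous. -/
lemma hasDerivAt_smul_of_eq_zero {E : Type*} [NormedAddCommGroup E] [NormedSpace ℝ E]
    {a : ℝ → ℝ} {g : ℝ → E} {a' t : ℝ} (ha : HasDerivAt a a' t) (h0 : a t = 0)
    (hg : ContinuousAt g t) : HasDerivAt (fun s => a s • g s) (a' • g t) t := by
  rw [hasDerivAt_iff_tendsto_slope] at ha ⊢
  have h1 := ha.smul (hg.tendsto.mono_left nhdsWithin_le_nhds)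
  refine h1.congr fun s => ?_
  simp [slope, h0, smul_smul]

lemma mfderiv_extChartAt_self (p : S2) (v : E2) :
    (mfderiv (𝓡 2) 𝓘(ℝ, E2) (extChartAt (𝓡 2) p) p : E2 →L[ℝ] E2) v = v := by
  rw [← TangentBundle.continuousLinearMapAt_trivializationAt (mem_chart_source _ p),
    TangentBundle.continuousLinearMapAt_trivializationAt_eq_core (mem_chart_source _ p)]
  exact (tangentBundleCore (𝓡 2) S2).coordChange_self _ _ (mem_chart_source _ p) _

/-- If `c` is a `C¹` curve along which the vector field is tangent to `c`, namely equal to `a s`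
times the velocity, and if `c 0` is a rest point because `a 0 = 0`, then the velocity of `c` at `0`
is an eigenvector of the linearization with eigenvalue `a' 0`. -/
lemma linearization_of_invariant_curve {X : (x : S2) → TangentSpace (𝓡 2) x}
    (hX : ContMDiff (𝓡 2) (𝓡 2).tangent ∞ (fun x : S2 => (⟨x, X x⟩ : TangentBundle (𝓡 2) S2)))
    {c : ℝ → S2} {c' : ℝ → E3} {a : ℝ → ℝ} {l : ℝ}
    (hc : ContDiff ℝ 1 (fun s => (c s : E3))) (hc' : ∀ s, HasDerivAt (fun s => (c s : E3)) (c' s) s)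
    (ha : HasDerivAt a l 0) (ha0 : a 0 = 0)
    (hXc : ∀ᶠ s in 𝓝 0, inclDeriv (c s) (X (c s)) = a s • c' s) :
    ∃ w : E2, inclDeriv (c 0) w = c' 0 ∧ linearization X (c 0) w = l • w := by
  have hcm : ContMDiff 𝓘(ℝ, ℝ) (𝓡 2) 1 c := contMDiff_codRestrict hc.contMDiff
  choose v hv hv' using fun s => hasVelocity_of_coe ((hcm s).mdifferentiableAt one_ne_zero) (hc' s)
  set p := c 0 with hp
  let Y : S2 → E2 := fun x => (trivializationAt E2 (TangentSpace (𝓡 2)) p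
        (⟨x, X x⟩ : TangentBundle (𝓡 2) S2)).2
  have hY : MDifferentiableAt (𝓡 2) 𝓘(ℝ, E2) Y p :=
    ((Bundle.contMDiffAt_section p).1 (hX p)).mdifferentiableAt (by simp)
  let u : ℝ → E2 := fun s => extChartAt (𝓡 2) p (c s)
  have hu : ContDiffAt ℝ 1 u 0 := by
    have h1 : ContMDiffAt 𝓘(ℝ, ℝ) 𝓘(ℝ, E2) 1 u 0 :=
      (contMDiffAt_extChartAt (I := 𝓡 2) (n := 1) (x := p)).comp (0 : ℝ) (hcm 0)
    exact h1.contDiffAt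
  have hu' : ContinuousAt (deriv u) 0 := by
    have h2 := (hu.fderiv_right (m := 0) (by simp)).continuousAt
    have h3 : deriv u = fun s => fderiv ℝ u s 1 := by ext1 s; simp
    rw [h3]
    exact h2.clm_apply continuousAt_const
  have hsrc : ∀ᶠ s in 𝓝 (0 : ℝ), c s ∈ (chartAt E2 p).source :=
    (hcm.continuous.continuousAt (x := 0)).eventually
      ((chartAt E2 p).open_source.mem_nhds (mem_chart_source _ p))
  have hderiv : ∀ s, c s ∈ (chartAt E2 p).source →
      HasDerivAt u ((mfderiv (𝓡 2) 𝓘(ℝ, E2) (extChartAt (𝓡 2) p) (c s) : E2 →L[ℝ] E2) (v s)) s := by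
    intro s hs
    have h1 := (mdifferentiableAt_extChartAt (I := 𝓡 2) hs).hasMFDerivAt.comp s (hv' s)
    let D : E2 →L[ℝ] E2 := mfderiv (𝓡 2) 𝓘(ℝ, E2) (extChartAt (𝓡 2) p) (c s)
    let w : E2 := v s
    have h2 : HasFDerivAt u (D.comp ((1 : ℝ →L[ℝ] ℝ).smulRight w)) s := h1.hasFDerivAt
    have h3 : HasDerivAt u (D w) s := by simpa using h2.hasDerivAt
    exact h3
  have hYc : (fun s => Y (c s)) =ᶠ[𝓝 0] fun s => a s • deriv u s := by
    filter_upwards [hsrc, hXc] with s hs hXs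
    have h1 : X (c s) = a s • v s := by
      apply inclDeriv_injective
      rw [hXs, map_smul, hv]
    rw [(hderiv s hs).deriv]
    have h2 : Y (c s) = (trivializationAt E2 (TangentSpace (𝓡 2)) p).continuousLinearMapAt ℝ (c s)
        (X (c s)) := by
      rw [Bundle.Trivialization.continuousLinearMapAt_apply,
        Bundle.Trivialization.linearMapAt_apply, if_pos (by simpa using hs)]
    rw [h2, TangentBundle.continuousLinearMapAt_trivializationAt hs, h1]
    let D : E2 →L[ℝ] E2 := mfderiv (𝓡 2) 𝓘(ℝ, E2) (extChartAt (𝓡 2) p) (c s)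
    let w : E2 := v s
    exact D.map_smul (a s) w
  have h3 : HasDerivAt (fun s => Y (c s)) (l • deriv u 0) 0 :=
    (hasDerivAt_smul_of_eq_zero ha ha0 hu').congr_of_eventuallyEq hYc
  let A : E2 →L[ℝ] E2 := mfderiv (𝓡 2) 𝓘(ℝ, E2) Y p
  let w : E2 := v 0
  have h4 : HasFDerivAt (fun s => Y (c s)) (A.comp ((1 : ℝ →L[ℝ] ℝ).smulRight w)) 0 :=
    (hY.hasMFDerivAt.comp (0 : ℝ) (hv' 0)).hasFDerivAt
  have h5 := h4.hasDerivAt.unique h3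
  have h6 : deriv u 0 = w := by
    rw [(hderiv 0 (mem_chart_source _ p)).deriv]
    exact mfderiv_extChartAt_self p _
  rw [h6] at h5
  refine ⟨w, hv 0, ?_⟩
  rw [← h5]
  simp only [ContinuousLinearMap.comp_apply, ContinuousLinearMap.smulRight_apply,
    one_apply_eq_self, one_smul]
  rfl

/-- An eigenvector of the differential of a map at a fixed point, detected by a curve. -/
lemma mfderiv_of_curve {f : S2 → S2} {x : S2} (hf : MDifferentiableAt (𝓡 2) (𝓡 2) f x)
    (hfx : f x = x) {c : ℝ → S2} (hc0 : c 0 = x) {w : E3} {l : ℝ}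
    (hc : MDifferentiableAt 𝓘(ℝ, ℝ) (𝓡 2) c 0)
    (hc' : HasDerivAt (fun s => (c s : E3)) w 0)
    (hfc : HasDerivAt (fun s => (f (c s) : E3)) (l • w) 0) :
    ∃ v : E2, inclDeriv x v = w ∧
      (mfderiv (𝓡 2) (𝓡 2) f x : E2 →L[ℝ] E2) v = l • v := by
  subst hc0
  obtain ⟨v, hv, hv'⟩ := hasVelocity_of_coe hc hc'
  refine ⟨v, hv, ?_⟩
  have h1 := (hasMFDerivAt_coe (f (c 0))).comp (0 : ℝ) (hf.hasMFDerivAt.comp (0 : ℝ) hv')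
  have h2 : HasFDerivAt (fun s => (f (c s) : E3))
      ((inclDeriv (f (c 0)) : E2 →L[ℝ] E3).comp ((mfderiv (𝓡 2) (𝓡 2) f (c 0) : E2 →L[ℝ] E2).comp
        ((1 : ℝ →L[ℝ] ℝ).smulRight (v : E2)))) 0 := h1.hasFDerivAt
  have h3 := h2.hasDerivAt.unique hfc
  simp only [ContinuousLinearMap.comp_apply, ContinuousLinearMap.smulRight_apply,
    one_apply_eq_self, one_smul] at h3
  have h4 : (inclDeriv (f (c 0)) : E2 →L[ℝ] E3) = (inclDeriv (c 0) : E2 →L[ℝ] E3) :=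
    ContinuousLinearMap.ext fun v => inclDeriv_congr hfx v
  apply inclDeriv_injective (c 0)
  rw [h4] at h3
  refine h3.trans ?_
  rw [← hv]
  exact ((inclDeriv (c 0) : E2 →L[ℝ] E3).map_smul l v).symm

lemma linearIndependent_of_inclDeriv {x : S2} {v₁ v₂ : E2}
    (h : LinearIndependent ℝ ![inclDeriv x v₁, inclDeriv x v₂]) :
    LinearIndependent ℝ ![v₁, v₂] := by
  apply LinearIndependent.of_comp (inclDeriv x : E2 →L[ℝ] E3).toLinearMap
  convert h using 1
  ext i
  fin_cases i <;> rfl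

/-! ### Limit manifolds and their tangent spaces -/

/-- The straight line with direction `v` in the chart at `x`. -/
def chartLine (x : S2) (v : E2) (s : ℝ) : S2 :=
  (extChartAt (𝓡 2) x).symm (extChartAt (𝓡 2) x x + s • v)

lemma chartLine_zero (x : S2) (v : E2) : chartLine x v 0 = x := by
  simp [chartLine]

lemma tendsto_chartLine (x : S2) (v : E2) : Tendsto (chartLine x v) (𝓝 0) (𝓝 x) := by
  have h1 : ContinuousAt (extChartAt (𝓡 2) x).symm (extChartAt (𝓡 2) x x) :=
    continuousAt_extChartAt_symm x
  have h2 : Tendsto (fun s : ℝ => extChartAt (𝓡 2) x x + s • v) (𝓝 0)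
      (𝓝 (extChartAt (𝓡 2) x x)) := by
    have : Continuous (fun s : ℝ => extChartAt (𝓡 2) x x + s • v) := by fun_prop
    simpa using this.tendsto 0
  have h3 := h1.tendsto.comp h2
  rw [extChartAt_to_inv] at h3
  exact h3

lemma hasMFDerivAt_chartLine (x : S2) (v : E2) :
    HasMFDerivAt 𝓘(ℝ, ℝ) (𝓡 2) (chartLine x v) 0 ((1 : ℝ →L[ℝ] ℝ).smulRight v) := by
  have hc : ContinuousAt (chartLine x v) 0 := by
    rw [ContinuousAt, chartLine_zero]
    exact tendsto_chartLine x v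
  refine ⟨hc, ?_⟩
  have h1 : HasFDerivAt (fun s : ℝ => extChartAt (𝓡 2) x x + s • v)
      ((1 : ℝ →L[ℝ] ℝ).smulRight v) 0 := by
    exact (((1 : ℝ →L[ℝ] ℝ).smulRight v).hasFDerivAt (x := (0 : ℝ))).const_add _
  have h2 : Tendsto (fun s : ℝ => extChartAt (𝓡 2) x x + s • v) (𝓝 0)
      (𝓝 (extChartAt (𝓡 2) x x)) := by
    have : Continuous (fun s : ℝ => extChartAt (𝓡 2) x x + s • v) := by fun_prop
    simpa using this.tendsto 0
  have h3 : (writtenInExtChartAt 𝓘(ℝ, ℝ) (𝓡 2) 0 (chartLine x v)) =ᶠ[𝓝 0]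
      fun s : ℝ => extChartAt (𝓡 2) x x + s • v := by
    filter_upwards [h2.eventually (extChartAt_target_mem_nhds x)] with s hs
    have h4 : writtenInExtChartAt 𝓘(ℝ, ℝ) (𝓡 2) 0 (chartLine x v) s =
        extChartAt (𝓡 2) (chartLine x v 0) (chartLine x v s) := rfl
    rw [h4, chartLine_zero]
    exact (extChartAt (𝓡 2) x).right_inv hs
  have h4 := h1.congr_of_eventuallyEq h3
  exact h4.hasFDerivWithinAt

/-- Where the convergence to `β` is locally uniform and the limit manifold is open, its tangent
space is everything. -/
lemma limitTangent_eq_top {X : (x : S2) → TangentSpace (𝓡 2) x} {l : Filter ℝ} {β : Set S2} {x : S2}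
    (h₁ : ∀ᶠ y in 𝓝 x, y ∈ limitManifold X l β)
    (h₂ : Tendsto (fun p : ℝ × S2 => flow X p.1 p.2) (l ×ˢ 𝓝 x) (𝓝ˢ β)) :
    limitTangent X l β x = ⊤ := by
  rw [eq_top_iff]
  intro v _
  refine Submodule.subset_span ⟨chartLine x v, chartLine_zero x v, hasMFDerivAt_chartLine x v,
    (tendsto_chartLine x v).eventually h₁, ?_⟩
  exact h₂.comp (tendsto_id.prodMap (tendsto_chartLine x v))

/-- The limit manifolds of disjoint closed sets are disjoint. -/
lemma disjoint_limitManifold {X : (x : S2) → TangentSpace (𝓡 2) x} {l : Filter ℝ} [l.NeBot]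
    {β₁ β₂ : Set S2} (h₁ : IsClosed β₁) (h₂ : IsClosed β₂) (hd : Disjoint β₁ β₂) :
    Disjoint (limitManifold X l β₁) (limitManifold X l β₂) := by
  rw [Set.disjoint_left]
  intro x hx₁ hx₂
  exact hx₁.not_tendsto (disjoint_nhdsSet_nhdsSet h₁ h₂ hd) hx₂

/-- Two independent velocities span the tangent plane. -/
lemma eq_top_of_linearIndependent {x : S2} {K : Submodule ℝ (TangentSpace (𝓡 2) x)}
    {v₁ v₂ : TangentSpace (𝓡 2) x}
    (hv : LinearIndependent ℝ (M := E2) ![v₁, v₂]) (h₁ : v₁ ∈ K) (h₂ : v₂ ∈ K) :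
    K = ⊤ := by
  have h : Submodule.span ℝ (M := E2) (Set.range ![v₁, v₂]) = ⊤ :=
    hv.span_eq_top_of_card_eq_finrank' (by simp)
  let K' : Submodule ℝ E2 := K
  have h2 : Submodule.span ℝ (M := E2) (Set.range ![v₁, v₂]) ≤ K' := by
    rw [Submodule.span_le]
    rintro _ ⟨i, rfl⟩
    fin_cases i
    · exact h₁
    · exact h₂
  rw [h] at h2
  exact top_le_iff.1 h2

/-! ### The vector field -/

/-- The cutoff, as a function of the squared height of a point of the sphere: it vanishes near the
equator and equals `1` near the poles. The squared height is `1 / (1 + u ^ 2 + v ^ 2)` in spiral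
coordinates, so the bounds `1 / 10` and `1 / 5` are the radii `3` and `2` in the plane. -/
def cutoff (r : ℝ) : ℝ := Real.smoothTransition (10 * r - 1)

lemma contDiff_cutoff : ContDiff ℝ ∞ cutoff :=
  Real.smoothTransition.contDiff.comp ((contDiff_const.mul contDiff_id).sub contDiff_const)

lemma cutoff_nonneg (r : ℝ) : 0 ≤ cutoff r := Real.smoothTransition.nonneg _

lemma cutoff_le_one (r : ℝ) : cutoff r ≤ 1 := Real.smoothTransition.le_one _

lemma cutoff_eq_zero {r : ℝ} (h : r ≤ 1 / 10) : cutoff r = 0 :=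
  Real.smoothTransition.zero_of_nonpos (by linarith)

lemma cutoff_eq_one {r : ℝ} (h : 1 / 5 ≤ r) : cutoff r = 1 :=
  Real.smoothTransition.one_of_one_le (by linarith)

/-- The angle by which the spiral coordinates are turned at the point `p`, see `uCoord`. It is even
in the height `p 2` because `Real.log` is. -/
def twist (p : E3) : ℝ := -Real.log (p 2)

/-- The first spiral coordinate: the point `(p 0, p 1) / |p 2|` of the plane is turned by the angle
`twist p`. -/
def uCoord (p : E3) : ℝ :=
  (p 0 * Real.cos (twist p) - p 1 * Real.sin (twist p)) / |p 2|

/-- The second spiral coordinate. -/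
def vCoord (p : E3) : ℝ :=
  (p 0 * Real.sin (twist p) + p 1 * Real.cos (twist p)) / |p 2|

/-- The first component of the difference of the field and the linear radial field in spiral
coordinates, times the height. -/
def bump (p : E3) : ℝ := cutoff (p 2 ^ 2) * (|p 2| * (uCoord p * (2 - uCoord p ^ 2)))

/-- The vector field in space. The terms without `bump` describe the flow from the equator, which
rotates, to the poles. The terms with `bump` change this sink at each pole into a saddle and two
sinks. -/
def spaceField (p : E3) : E3 :=
  !₂[-(p 2 ^ 2 * p 0) - (1 - p 2 ^ 2) * p 1 +
      bump p * (Real.cos (twist p) + |p 2| * uCoord p * (p 1 - p 0)),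
    -(p 2 ^ 2 * p 1) + (1 - p 2 ^ 2) * p 0 +
      bump p * (-Real.sin (twist p) + |p 2| * uCoord p * (-p 0 - p 1)),
    (1 - p 2 ^ 2) * p 2 - bump p * (|p 2| * uCoord p * p 2)]

lemma contDiff_cutoff_mul {f : E3 → ℝ} (hf : ∀ p : E3, p 2 ≠ 0 → ContDiffAt ℝ ∞ f p) :
    ContDiff ℝ ∞ (fun p : E3 => cutoff (p 2 ^ 2) * f p) := by
  have hp2 : ContDiff ℝ ∞ (fun p : E3 => p 2) := by fun_prop
  rw [contDiff_iff_contDiffAt]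
  intro p
  by_cases hp : p 2 = 0
  · have h1 : ∀ᶠ q : E3 in 𝓝 p, q 2 ^ 2 < 1 / 10 := by
      have : Continuous (fun q : E3 => q 2 ^ 2) := by fun_prop
      exact this.continuousAt.eventually (gt_mem_nhds (by simp [hp]))
    have h2 : (fun p : E3 => cutoff (p 2 ^ 2) * f p) =ᶠ[𝓝 p] fun _ => 0 := by
      filter_upwards [h1] with q hq
      rw [cutoff_eq_zero hq.le, zero_mul]
    exact contDiffAt_const.congr_of_eventuallyEq h2
  · exact ((contDiff_cutoff.comp (hp2.pow 2)).contDiffAt).mul (hf p hp)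

lemma contDiffAt_spiral {p : E3} (hp : p 2 ≠ 0) :
    ContDiffAt ℝ ∞ (fun p : E3 => |p 2|) p ∧ ContDiffAt ℝ ∞ twist p ∧
      ContDiffAt ℝ ∞ uCoord p ∧ ContDiffAt ℝ ∞ vCoord p := by
  have hc : ∀ i : Fin 3, ContDiffAt ℝ ∞ (fun p : E3 => p i) p := fun i => by fun_prop
  have h1 : ContDiffAt ℝ ∞ (fun p : E3 => |p 2|) p := by
    simpa only [Function.comp_def] using (contDiffAt_abs hp).comp p (hc 2)
  have h2 : ContDiffAt ℝ ∞ twist p := ((hc 2).log hp).neg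
  refine ⟨h1, h2, ?_, ?_⟩
  · exact (((hc 0).mul h2.cos).sub ((hc 1).mul h2.sin)).div h1 (abs_ne_zero.2 hp)
  · exact (((hc 0).mul h2.sin).add ((hc 1).mul h2.cos)).div h1 (abs_ne_zero.2 hp)

/-- The factors `bump` vanish near the equator, where the spiral coordinates are singular. -/
lemma contDiff_spaceField : ContDiff ℝ ∞ spaceField := by
  have hc : ∀ i : Fin 3, ContDiff ℝ ∞ (fun p : E3 => p i) := fun i => by fun_prop
  have hb : ∀ g : E3 → ℝ, (∀ p : E3, p 2 ≠ 0 → ContDiffAt ℝ ∞ g p) →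
      ContDiff ℝ ∞ (fun p => bump p * g p) := by
    intro g hg
    have := contDiff_cutoff_mul (f := fun p => (|p 2| * (uCoord p * (2 - uCoord p ^ 2))) * g p)
      fun p hp => by
        obtain ⟨h1, h2, h3, -⟩ := contDiffAt_spiral hp
        exact (h1.mul (h3.mul (contDiffAt_const.sub (h3.pow 2)))).mul (hg p hp)
    simpa only [bump, mul_assoc] using this
  rw [contDiff_euclidean]
  intro i
  fin_cases i
  · refine (((((hc 2).pow 2).mul (hc 0)).neg.sub
      ((contDiff_const.sub ((hc 2).pow 2)).mul (hc 1))).add (hb _ fun p hp => ?_))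
    obtain ⟨h1, h2, h3, -⟩ := contDiffAt_spiral hp
    exact h2.cos.add ((h1.mul h3).mul ((hc 1).sub (hc 0)).contDiffAt)
  · refine (((((hc 2).pow 2).mul (hc 1)).neg.add
      ((contDiff_const.sub ((hc 2).pow 2)).mul (hc 0))).add (hb _ fun p hp => ?_))
    obtain ⟨h1, h2, h3, -⟩ := contDiffAt_spiral hp
    exact h2.sin.neg.add ((h1.mul h3).mul ((hc 0).neg.sub (hc 1)).contDiffAt)
  · refine ((contDiff_const.sub ((hc 2).pow 2)).mul (hc 2)).sub (hb _ fun p hp => ?_)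
    obtain ⟨h1, h2, h3, -⟩ := contDiffAt_spiral hp
    exact (h1.mul h3).mul (hc 2).contDiffAt

lemma sum_sq_S2 (p : S2) : (p : E3) 0 ^ 2 + (p : E3) 1 ^ 2 + (p : E3) 2 ^ 2 = 1 := by
  have h : ‖(p : E3)‖ ^ 2 = 1 := by simp
  rw [EuclideanSpace.norm_sq_eq] at h
  simpa [Fin.sum_univ_three] using h

lemma abs_mul_uCoord {p : E3} (hp : p 2 ≠ 0) :
    |p 2| * uCoord p = p 0 * Real.cos (twist p) - p 1 * Real.sin (twist p) :=
  mul_div_cancel₀ _ (abs_ne_zero.2 hp)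

lemma abs_mul_vCoord {p : E3} (hp : p 2 ≠ 0) :
    |p 2| * vCoord p = p 0 * Real.sin (twist p) + p 1 * Real.cos (twist p) :=
  mul_div_cancel₀ _ (abs_ne_zero.2 hp)

lemma bump_of_eq_zero {p : E3} (hp : p 2 = 0) : bump p = 0 := by simp [bump, hp]

lemma isTangential_spaceField : IsTangential spaceField := by
  intro p
  have h := sum_sq_S2 p
  simp only [spaceField, PiLp.inner_apply, Fin.sum_univ_three, RCLike.inner_apply, conj_trivial,
    Matrix.cons_val_zero, Matrix.cons_val_one, Matrix.cons_val]
  set x := (p : E3) 0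
  set y := (p : E3) 1
  set z := (p : E3) 2 with hz
  by_cases hp : z = 0
  · rw [bump_of_eq_zero hp, hp]; ring
  · rw [abs_mul_uCoord hp]
    change (-(z ^ 2 * x) - (1 - z ^ 2) * y + bump p * (Real.cos (twist p) +
      (x * Real.cos (twist p) - y * Real.sin (twist p)) * (y - x))) * x +
      (-(z ^ 2 * y) + (1 - z ^ 2) * x + bump p * (-Real.sin (twist p) +
      (x * Real.cos (twist p) - y * Real.sin (twist p)) * (-x - y))) * y +
      ((1 - z ^ 2) * z - bump p *
      ((x * Real.cos (twist p) - y * Real.sin (twist p)) * z)) * z = 0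
    generalize bump (p : E3) = b
    generalize Real.cos (twist (p : E3)) = c
    generalize Real.sin (twist (p : E3)) = s
    linear_combination (-z ^ 2 - b * (x * c - y * s)) * h

/-- The vector field on the sphere. -/
def X (x : S2) : TangentSpace (𝓡 2) x := sphereField spaceField isTangential_spaceField x

lemma contMDiff_X :
    ContMDiff (𝓡 2) (𝓡 2).tangent ∞ (fun x : S2 => (⟨x, X x⟩ : TangentBundle (𝓡 2) S2)) :=
  contMDiff_sphereField _ contDiff_spaceField

lemma inclDeriv_X (x : S2) : inclDeriv x (X x) = spaceField x :=
  inclDeriv_sphereField _ contDiff_spaceField x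

lemma X_eq_zero_iff (x : S2) : X x = 0 ↔ spaceField x = 0 := by
  rw [← inclDeriv_X, map_eq_zero_iff _ (inclDeriv_injective x)]

/-- Solutions of the ODE in space are flow lines. -/
lemma flow_X_eq {c : ℝ → S2} (hc : ∀ t, HasDerivAt (fun s => (c s : E3)) (spaceField (c t)) t)
    (t : ℝ) : flow X t (c 0) = c t :=
  flow_eq_of_isMIntegralCurve (contMDiff_X.of_le (by simp))
    (isMIntegralCurve_sphereField _ contDiff_spaceField hc) t

/-! ### Spiral coordinates on the open hemispheres -/

/-- The sign of the upper and of the lower hemisphere. -/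
def sgn (i : Fin 2) : ℝ := if i = 0 then 1 else -1

lemma sgn_sq (i : Fin 2) : sgn i ^ 2 = 1 := by fin_cases i <;> simp [sgn]

lemma abs_sgn (i : Fin 2) : |sgn i| = 1 := by fin_cases i <;> simp [sgn]

lemma sgn_ne_zero (i : Fin 2) : sgn i ≠ 0 := by fin_cases i <;> simp [sgn]

/-- The distance from the equatorial plane of the point with spiral coordinates `(u, v)`. -/
def height (u v : ℝ) : ℝ := (√(1 + u ^ 2 + v ^ 2))⁻¹

lemma height_pos (u v : ℝ) : 0 < height u v := by unfold height; positivity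

lemma height_sq (u v : ℝ) : height u v ^ 2 = (1 + u ^ 2 + v ^ 2)⁻¹ := by
  rw [height, inv_pow, Real.sq_sqrt (by positivity)]

lemma height_sq_mul (u v : ℝ) : height u v ^ 2 * (u ^ 2 + v ^ 2) = 1 - height u v ^ 2 := by
  rw [height_sq]; field_simp; ring

/-- The inverse of the spiral coordinates on one of the two open hemispheres, as a map to space: the
plane point `(u, v)` is turned by the angle `log (height u v)` and then projected centrally to the
sphere from the plane at height `sgn i`. -/
def spiralVec (i : Fin 2) (u v : ℝ) : E3 :=
  let z := height u v
  let c := Real.cos (-Real.log z)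
  let s := Real.sin (-Real.log z)
  !₂[z * (u * c + v * s), z * (v * c - u * s), sgn i * z]

@[simp] lemma spiralVec_zero (i : Fin 2) (u v : ℝ) : spiralVec i u v 0 = height u v *
    (u * Real.cos (-Real.log (height u v)) + v * Real.sin (-Real.log (height u v))) := rfl

@[simp] lemma spiralVec_one (i : Fin 2) (u v : ℝ) : spiralVec i u v 1 = height u v *
    (v * Real.cos (-Real.log (height u v)) - u * Real.sin (-Real.log (height u v))) := rfl

@[simp] lemma spiralVec_two (i : Fin 2) (u v : ℝ) : spiralVec i u v 2 = sgn i * height u v := rfl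

/-- The point of the sphere with spiral coordinates `(u, v)` on the hemisphere `i`. -/
def spiral (i : Fin 2) (u v : ℝ) : S2 :=
  ⟨spiralVec i u v, by
    rw [mem_sphere_zero_iff_norm, ← sq_eq_sq₀ (norm_nonneg _) zero_le_one,
      EuclideanSpace.norm_sq_eq]
    simp only [Fin.sum_univ_three, Real.norm_eq_abs, sq_abs, spiralVec_zero, spiralVec_one,
      spiralVec_two]
    have h1 := height_sq_mul u v
    have h2 := Real.sin_sq_add_cos_sq (-Real.log (height u v))
    have h3 := sgn_sq i
    generalize Real.cos (-Real.log (height u v)) = c at *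
    generalize Real.sin (-Real.log (height u v)) = s at *
    linear_combination h1 + height u v ^ 2 * (u ^ 2 + v ^ 2) * h2 + height u v ^ 2 * h3⟩

@[simp] lemma coe_spiral (i : Fin 2) (u v : ℝ) : (spiral i u v : E3) = spiralVec i u v := rfl

lemma twist_spiralVec (i : Fin 2) (u v : ℝ) :
    twist (spiralVec i u v) = -Real.log (height u v) := by
  rw [twist, spiralVec_two, ← Real.log_abs, abs_mul, abs_sgn, one_mul,
    abs_of_pos (height_pos u v)]

lemma abs_spiralVec_two (i : Fin 2) (u v : ℝ) : |spiralVec i u v 2| = height u v := by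
  rw [spiralVec_two, abs_mul, abs_sgn, one_mul, abs_of_pos (height_pos u v)]

lemma spiralVec_two_ne_zero (i : Fin 2) (u v : ℝ) : spiralVec i u v 2 ≠ 0 :=
  mul_ne_zero (sgn_ne_zero i) (height_pos u v).ne'

lemma uCoord_spiralVec (i : Fin 2) (u v : ℝ) : uCoord (spiralVec i u v) = u := by
  have h := abs_mul_uCoord (spiralVec_two_ne_zero i u v)
  rw [abs_spiralVec_two, twist_spiralVec, spiralVec_zero, spiralVec_one] at h
  have h2 := Real.sin_sq_add_cos_sq (-Real.log (height u v))
  apply mul_left_cancel₀ (height_pos u v).ne'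
  rw [h]
  linear_combination height u v * u * h2

lemma vCoord_spiralVec (i : Fin 2) (u v : ℝ) : vCoord (spiralVec i u v) = v := by
  have h := abs_mul_vCoord (spiralVec_two_ne_zero i u v)
  rw [abs_spiralVec_two, twist_spiralVec, spiralVec_zero, spiralVec_one] at h
  have h2 := Real.sin_sq_add_cos_sq (-Real.log (height u v))
  apply mul_left_cancel₀ (height_pos u v).ne'
  rw [h]
  linear_combination height u v * v * h2

/-- The squared height in terms of the spiral coordinates. -/
lemma height_coord (p : S2) (hp : (p : E3) 2 ≠ 0) :
    height (uCoord p) (vCoord p) = |(p : E3) 2| := by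
  have hz : 0 < |(p : E3) 2| := abs_pos.2 hp
  have h1 := abs_mul_uCoord hp
  have h2 := abs_mul_vCoord hp
  have h3 := Real.sin_sq_add_cos_sq (twist p)
  have h4 := sum_sq_S2 p
  have h5 : |(p : E3) 2| ^ 2 * (1 + uCoord p ^ 2 + vCoord p ^ 2) = 1 := by
    have h6 : |(p : E3) 2| ^ 2 * (1 + uCoord p ^ 2 + vCoord p ^ 2) =
      |(p : E3) 2| ^ 2 + (|(p : E3) 2| * uCoord p) ^ 2 + (|(p : E3) 2| * vCoord p) ^ 2 := by ring
    rw [h6, h1, h2, sq_abs]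
    linear_combination h4 + ((p : E3) 0 ^ 2 + (p : E3) 1 ^ 2) * h3
  have h6 : height (uCoord p) (vCoord p) ^ 2 = |(p : E3) 2| ^ 2 := by
    rw [height_sq]
    exact (eq_inv_of_mul_eq_one_left h5).symm
  exact (sq_eq_sq₀ (height_pos _ _).le hz.le).1 h6

/-- Every point on the open hemisphere is given by its spiral coordinates. -/
lemma spiral_coord (i : Fin 2) (p : S2) (hp : 0 < sgn i * (p : E3) 2) :
    spiral i (uCoord p) (vCoord p) = p := by
  have hp0 : (p : E3) 2 ≠ 0 := fun h => by simp [h] at hp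
  have hh := height_coord p hp0
  have hl : Real.log |(p : E3) 2| = Real.log ((p : E3) 2) := Real.log_abs _
  have h1 := abs_mul_uCoord hp0
  have h2 := abs_mul_vCoord hp0
  have h3 := Real.sin_sq_add_cos_sq (twist p)
  have h4 : sgn i * |(p : E3) 2| = (p : E3) 2 := by
    have : |(p : E3) 2| = sgn i * (p : E3) 2 := by
      rw [← abs_of_pos hp, abs_mul, abs_sgn, one_mul]
    rw [this, ← mul_assoc, ← sq, sgn_sq, one_mul]
  apply Subtype.ext
  ext k
  fin_cases k
  · change spiralVec i (uCoord p) (vCoord p) 0 = (p : E3) 0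
    rw [spiralVec_zero, hh, hl]
    change |(p : E3) 2| * (uCoord p * Real.cos (twist p) + vCoord p * Real.sin (twist p)) = _
    linear_combination Real.cos (twist p) * h1 + Real.sin (twist p) * h2 + (p : E3) 0 * h3
  · change spiralVec i (uCoord p) (vCoord p) 1 = (p : E3) 1
    rw [spiralVec_one, hh, hl]
    change |(p : E3) 2| * (vCoord p * Real.cos (twist p) - uCoord p * Real.sin (twist p)) = _
    linear_combination Real.cos (twist p) * h2 - Real.sin (twist p) * h1 + (p : E3) 1 * h3
  · change spiralVec i (uCoord p) (vCoord p) 2 = (p : E3) 2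
    rw [spiralVec_two, hh, h4]

lemma exists_spiral_of_ne_zero (p : S2) (hp : (p : E3) 2 ≠ 0) :
    ∃ i u v, spiral i u v = p := by
  rcases lt_or_gt_of_ne hp with h | h
  · exact ⟨1, _, _, spiral_coord 1 p (by simpa [sgn] using h)⟩
  · exact ⟨0, _, _, spiral_coord 0 p (by simpa [sgn] using h)⟩

lemma spiral_inj {i j : Fin 2} {u v u' v' : ℝ} :
    spiral i u v = spiral j u' v' ↔ i = j ∧ u = u' ∧ v = v' := by
  constructor
  · intro h
    have h0 : spiralVec i u v = spiralVec j u' v' := congrArg Subtype.val h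
    have hu : u = u' := by rw [← uCoord_spiralVec i u v, h0, uCoord_spiralVec]
    have hv : v = v' := by rw [← vCoord_spiralVec i u v, h0, vCoord_spiralVec]
    refine ⟨?_, hu, hv⟩
    subst hu hv
    have h2 : sgn i * height u v = sgn j * height u v := congrFun (congrArg WithLp.ofLp h0) 2
    have h3 := mul_right_cancel₀ (height_pos u v).ne' h2
    fin_cases i <;> fin_cases j <;> first | rfl | (norm_num [sgn] at h3)
  · rintro ⟨rfl, rfl, rfl⟩; rfl

/-- The differential of `spiralVec` at `(u, v)`, applied to the vector `(u', v')`. -/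
def spiralDeriv (i : Fin 2) (u v u' v' : ℝ) : E3 :=
  let z := height u v
  let c := Real.cos (-Real.log z)
  let s := Real.sin (-Real.log z)
  let k := z ^ 3 * (u * u' + v * v')
  !₂[-k * (u * c + v * s) + z * (u' * c + v' * s) + k * (v * c - u * s),
    -k * (v * c - u * s) + z * (v' * c - u' * s) - k * (u * c + v * s), -(sgn i * k)]

lemma hasDerivAt_height {u v : ℝ → ℝ} {u' v' t : ℝ} (hu : HasDerivAt u u' t)
    (hv : HasDerivAt v v' t) :
    HasDerivAt (fun s => height (u s) (v s))
      (-(height (u t) (v t) ^ 3 * (u t * u' + v t * v'))) t := by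
  have h1 : HasDerivAt (fun s => 1 + u s ^ 2 + v s ^ 2) (2 * u t * u' + 2 * v t * v') t := by
    have := ((hu.pow 2).const_add 1).add (hv.pow 2)
    simpa using! this
  have h0 : 0 < 1 + u t ^ 2 + v t ^ 2 := by positivity
  have h2 := (h1.sqrt h0.ne').inv (Real.sqrt_pos.2 h0).ne'
  refine h2.congr_deriv ?_
  have h3 : 0 < √(1 + u t ^ 2 + v t ^ 2) := Real.sqrt_pos.2 h0
  unfold height
  field_simp

lemma hasDerivAt_E3 {f : ℝ → E3} {f' : E3} {t : ℝ}
    (h : ∀ k, HasDerivAt (fun s => f s k) (f' k) t) : HasDerivAt f f' t := by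
  have h1 : HasDerivAt (fun s => (f s).ofLp) f'.ofLp t := hasDerivAt_pi.2 h
  exact ((PiLp.continuousLinearEquiv 2 ℝ (fun _ : Fin 3 => ℝ)).symm.hasFDerivAt.comp_hasDerivAt
    t h1)

lemma hasDerivAt_spiral (i : Fin 2) {u v : ℝ → ℝ} {u' v' t : ℝ} (hu : HasDerivAt u u' t)
    (hv : HasDerivAt v v' t) :
    HasDerivAt (fun s => (spiral i (u s) (v s) : E3)) (spiralDeriv i (u t) (v t) u' v') t := by
  have hz := hasDerivAt_height hu hv
  have hz0 := height_pos (u t) (v t)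
  have hl := (hz.log hz0.ne').neg
  have hc := hl.cos
  have hs := hl.sin
  refine hasDerivAt_E3 fun k => ?_
  fin_cases k
  · refine (hz.mul ((hu.mul hc).add (hv.mul hs))).congr_deriv ?_
    simp [spiralDeriv]
    field_simp
    ring
  · refine (hz.mul ((hv.mul hc).sub (hu.mul hs))).congr_deriv ?_
    simp [spiralDeriv]
    field_simp
    ring
  · refine (hz.const_mul (sgn i)).congr_deriv ?_
    simp [spiralDeriv]

lemma spiralDeriv_smul (i : Fin 2) (u v a u' v' : ℝ) :
    spiralDeriv i u v (a * u') (a * v') = a • spiralDeriv i u v u' v' := by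
  ext k
  fin_cases k <;> simp [spiralDeriv] <;> ring

/-- The first component of the vector field in spiral coordinates. -/
def planeField (u v : ℝ) : ℝ := -u + cutoff (height u v ^ 2) * (u * (2 - u ^ 2))

/-- In spiral coordinates the vector field is `(planeField u v, -v)`. -/
lemma spaceField_spiral (i : Fin 2) (u v : ℝ) :
    spaceField (spiral i u v) = spiralDeriv i u v (planeField u v) (-v) := by
  have hb : bump (spiralVec i u v) =
      height u v * (cutoff (height u v ^ 2) * (u * (2 - u ^ 2))) := by
    rw [bump, abs_spiralVec_two, uCoord_spiralVec, spiralVec_two, mul_pow, sgn_sq, one_mul]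
    ring
  have h1 := height_sq_mul u v
  have h2 : spiralVec i u v 2 ^ 2 = height u v ^ 2 := by
    rw [spiralVec_two, mul_pow, sgn_sq, one_mul]
  rw [coe_spiral]
  unfold spaceField
  rw [hb, twist_spiralVec, abs_spiralVec_two, uCoord_spiralVec, h2, planeField]
  ext k
  fin_cases k
  · simp only [spiralVec_zero, spiralVec_one, spiralVec_two, spiralDeriv, PiLp.toLp_apply,
      Matrix.cons_val_zero, Fin.zero_eta]
    generalize Real.cos (-Real.log (height u v)) = c at *
    generalize Real.sin (-Real.log (height u v)) = s at *
    generalize cutoff (height u v ^ 2) = m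
    linear_combination (height u v * (u * c + v * s - (v * c - u * s))) * (-h1)
  · simp only [spiralVec_zero, spiralVec_one, spiralVec_two, spiralDeriv, PiLp.toLp_apply,
      Matrix.cons_val_zero, Matrix.cons_val_one, Fin.mk_one]
    generalize Real.cos (-Real.log (height u v)) = c at *
    generalize Real.sin (-Real.log (height u v)) = s at *
    generalize cutoff (height u v ^ 2) = m
    linear_combination (height u v * (u * c + v * s + (v * c - u * s))) * (-h1)
  · simp only [spiralVec_zero, spiralVec_one, spiralVec_two, spiralDeriv, PiLp.toLp_apply,
      Matrix.cons_val, Fin.reduceFinMk]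
    generalize cutoff (height u v ^ 2) = m
    linear_combination (sgn i * height u v) * (-h1)

/-- The spiral coordinates are immersive. -/
lemma spiralDeriv_eq_zero {i : Fin 2} {u v u' v' : ℝ} (h : spiralDeriv i u v u' v' = 0) :
    u' = 0 ∧ v' = 0 := by
  have hz := height_pos u v
  have h0 : spiralDeriv i u v u' v' 0 = 0 := by rw [h]; rfl
  have h1 : spiralDeriv i u v u' v' 1 = 0 := by rw [h]; rfl
  have h2 : spiralDeriv i u v u' v' 2 = 0 := by rw [h]; rfl
  simp only [spiralDeriv, PiLp.toLp_apply, Matrix.cons_val_zero, Matrix.cons_val_one,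
    Matrix.cons_val, neg_eq_zero, mul_eq_zero, sgn_ne_zero, false_or] at h0 h1 h2
  have hk : height u v ^ 3 * (u * u' + v * v') = 0 := by
    rcases h2 with h2 | h2
    · rw [h2, zero_mul]
    · rw [h2, mul_zero]
  rw [hk] at h0 h1
  have h3 := Real.sin_sq_add_cos_sq (-Real.log (height u v))
  generalize Real.cos (-Real.log (height u v)) = c at *
  generalize Real.sin (-Real.log (height u v)) = s at *
  have h4 : u' * c + v' * s = 0 := by
    have : height u v * (u' * c + v' * s) = 0 := by linarith
    exact (mul_eq_zero.1 this).resolve_left hz.ne'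
  have h5 : v' * c - u' * s = 0 := by
    have : height u v * (v' * c - u' * s) = 0 := by linarith
    exact (mul_eq_zero.1 this).resolve_left hz.ne'
  constructor
  · linear_combination (-u') * h3 + c * h4 - s * h5
  · linear_combination (-v') * h3 + s * h4 + c * h5

lemma linearIndependent_spiralDeriv (i : Fin 2) (u v : ℝ) :
    LinearIndependent ℝ ![spiralDeriv i u v 1 0, spiralDeriv i u v 0 1] := by
  rw [LinearIndependent.pair_iff]
  intro a b hab
  have h : spiralDeriv i u v a b = 0 := by
    rw [← hab]
    ext k
    fin_cases k <;> simp [spiralDeriv] <;> ring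
  exact spiralDeriv_eq_zero h

/-- Solutions of the plane ODE are flow lines on the sphere. -/
lemma flow_spiral (i : Fin 2) {u v : ℝ → ℝ}
    (hu : ∀ t, HasDerivAt u (planeField (u t) (v t)) t) (hv : ∀ t, HasDerivAt v (-v t) t) (t : ℝ) :
    flow X t (spiral i (u 0) (v 0)) = spiral i (u t) (v t) :=
  flow_X_eq (c := fun t => spiral i (u t) (v t)) (fun t => by
    rw [spaceField_spiral]
    exact hasDerivAt_spiral i (hu t) (hv t)) t

/-! ### The flow in the plane -/

/-- A `C¹` vector field with a global Lipschitz constant has global solutions. -/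
lemma exists_forall_hasDerivAt_of_lipschitz {E : Type*} [NormedAddCommGroup E] [NormedSpace ℝ E]
    [CompleteSpace E] {f : E → E} {K : NNReal} (hf : LipschitzWith K f) (hf' : ContDiff ℝ 1 f)
    (x : E) : ∃ c : ℝ → E, c 0 = x ∧ ∀ t, HasDerivAt c (f (c t)) t := by
  have hε : (0 : ℝ) < (1 + (K : ℝ))⁻¹ := by positivity
  have key := exists_isMIntegralCurve_of_isMIntegralCurveOn (I := 𝓘(ℝ, E)) (M := E) (v := f)
    (contMDiff_vectorSpace_iff_contDiff.2 hf') hε ?_ x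
  · obtain ⟨c, hc0, hc⟩ := key
    refine ⟨c, hc0, fun t => ?_⟩
    have h2 : HasFDerivAt c ((1 : ℝ →L[ℝ] ℝ).smulRight (f (c t))) t := (hc t).hasFDerivAt
    simpa using h2.hasDerivAt
  · intro x₀
    set ε : ℝ := (1 + K : ℝ)⁻¹ with hεdef
    let a : NNReal := ‖f x₀‖₊ + 1
    let L : NNReal := ‖f x₀‖₊ + K * a
    have h0 : (0 : ℝ) ∈ Set.Icc (-ε) ε := Set.mem_Icc.2 ⟨by linarith, hε.le⟩
    have hpl : IsPicardLindelof (fun _ : ℝ => f) (tmin := -ε) (tmax := ε)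
        ⟨0, h0⟩ x₀ a 0 L K := by
      refine ⟨fun _ _ => hf.lipschitzOnWith, fun _ _ => continuousOn_const, ?_, ?_⟩
      · intro _ _ y hy
        have h1 : ‖f y - f x₀‖ ≤ K * a := by
          refine (hf.norm_sub_le y x₀).trans ?_
          rw [mem_closedBall_iff_norm] at hy
          gcongr
        have h2 := norm_le_norm_add_norm_sub' (f y) (f x₀)
        have h3 : (L : ℝ) = ‖f x₀‖ + K * a := by simp [L]
        rw [h3]; linarith
      · have h1 : (L : ℝ) = ‖f x₀‖ + K * (‖f x₀‖ + 1) := by simp [L, a]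
        have h2 : (a : ℝ) = ‖f x₀‖ + 1 := by simp [a]
        have h3 : max (ε - 0) (0 - -ε) = ε := by simp
        change (L : ℝ) * max (ε - 0) (0 - -ε) ≤ (a : ℝ) - 0
        rw [h3, sub_zero, h1, h2, hεdef, ← div_eq_mul_inv, div_le_iff₀ (by positivity)]
        have := norm_nonneg (f x₀)
        nlinarith
    obtain ⟨c, hc0, hc⟩ := hpl.exists_eq_forall_mem_Icc_hasDerivWithinAt₀
    refine ⟨c, hc0, fun t ht => ?_⟩
    have h1 : HasDerivAt c (f (c t)) t :=
      (hc t (Set.Ioo_subset_Icc_self ht)).hasDerivAt (Icc_mem_nhds ht.1 ht.2)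
    have h2 : HasFDerivAt c ((1 : ℝ →L[ℝ] ℝ).smulRight (f (c t))) t := by
      convert! h1.hasFDerivAt using 1
    exact h2.hasMFDerivAt.hasMFDerivWithinAt

/-- The global solutions of the plane ODE. -/
structure IsPlaneSol (u v : ℝ → ℝ) : Prop where
  left : ∀ t, HasDerivAt u (planeField (u t) (v t)) t
  right : ∀ t, HasDerivAt v (-v t) t

/-- The field differs from a linear field by a field with compact support, so it is Lipschitz. -/
lemma exists_isPlaneSol (a b : ℝ) : ∃ u v, IsPlaneSol u v ∧ u 0 = a ∧ v 0 = b := by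
  let B : ℝ × ℝ → ℝ × ℝ := fun p =>
    (cutoff (height p.1 p.2 ^ 2) * (p.1 * (2 - p.1 ^ 2)), 0)
  have hB : ContDiff ℝ 1 B := by
    refine ContDiff.prodMk (ContDiff.mul ?_ (by fun_prop)) contDiff_const
    have h1 : ContDiff ℝ 1 (fun p : ℝ × ℝ => height p.1 p.2 ^ 2) := by
      simp only [height_sq]
      exact ContDiff.inv (by fun_prop) fun p => by positivity
    exact (contDiff_cutoff.of_le (by simp)).comp h1
  have hs : HasCompactSupport B := by
    refine HasCompactSupport.intro (isCompact_closedBall (0 : ℝ × ℝ) 3) fun p hp => ?_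
    rw [mem_closedBall_zero_iff, Prod.norm_def, max_le_iff, not_and_or, Real.norm_eq_abs,
      Real.norm_eq_abs, not_le, not_le] at hp
    have h1 : 9 < p.1 ^ 2 + p.2 ^ 2 := by
      rcases hp with hp | hp
      · have := sq_lt_sq' (by linarith) hp
        rw [sq_abs] at this
        nlinarith [sq_nonneg p.2]
      · have := sq_lt_sq' (by linarith) hp
        rw [sq_abs] at this
        nlinarith [sq_nonneg p.1]
    have h2 : height p.1 p.2 ^ 2 ≤ 1 / 10 := by
      rw [height_sq, one_div]
      exact inv_anti₀ (by norm_num) (by linarith)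
    simp [B, cutoff_eq_zero h2]
  obtain ⟨K, hK⟩ := hB.lipschitzWith_of_hasCompactSupport hs one_ne_zero
  have hf : LipschitzWith (1 + K) (fun p : ℝ × ℝ => -p + B p) :=
    (LipschitzWith.id.neg).add hK
  obtain ⟨c, hc0, hc⟩ := exists_forall_hasDerivAt_of_lipschitz hf (contDiff_neg.add hB) (a, b)
  refine ⟨fun t => (c t).1, fun t => (c t).2, ⟨fun t => ?_, fun t => ?_⟩, by simp [hc0],
    by simp [hc0]⟩
  · have h1 : HasDerivAt (fun t => (c t).1) (-c t + B (c t)).1 t :=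
      (ContinuousLinearMap.fst ℝ ℝ ℝ).hasFDerivAt.comp_hasDerivAt t (hc t)
    exact h1
  · have h1 : HasDerivAt (fun t => (c t).2) (-c t + B (c t)).2 t :=
      (ContinuousLinearMap.snd ℝ ℝ ℝ).hasFDerivAt.comp_hasDerivAt t (hc t)
    simpa [B] using h1

lemma hasDerivAt_exp_mul (k t : ℝ) :
    HasDerivAt (fun s => Real.exp (k * s)) (k * Real.exp (k * t)) t := by
  have := ((hasDerivAt_id t).const_mul k).exp
  simpa [mul_comm] using! this

lemma cutoff_height_eq_one {u v : ℝ} (h : u ^ 2 + v ^ 2 ≤ 4) : cutoff (height u v ^ 2) = 1 := by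
  apply cutoff_eq_one
  rw [height_sq, one_div]
  exact inv_anti₀ (by positivity) (by linarith)

lemma planeField_of_le {u v : ℝ} (h : u ^ 2 + v ^ 2 ≤ 4) : planeField u v = u - u ^ 3 := by
  rw [planeField, cutoff_height_eq_one h]; ring

namespace IsPlaneSol

variable {u v : ℝ → ℝ} (h : IsPlaneSol u v)
include h

lemma snd_eq (t : ℝ) : v t = v 0 * Real.exp (-t) := by
  have h1 : ∀ t, HasDerivAt (fun s => v s * Real.exp (1 * s)) 0 t := fun t => by
    refine ((h.right t).mul (hasDerivAt_exp_mul 1 t)).congr_deriv ?_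
    ring
  have h2 := is_const_of_deriv_eq_zero (fun t => (h1 t).differentiableAt)
    (fun t => (h1 t).deriv) t 0
  simp only [one_mul, Real.exp_zero, mul_zero, mul_one] at h2
  rw [← h2, mul_assoc, ← Real.exp_add]
  simp

lemma continuous_fst : Continuous u :=
  continuous_iff_continuousAt.2 fun t => (h.left t).continuousAt

lemma continuous_snd : Continuous v :=
  continuous_iff_continuousAt.2 fun t => (h.right t).continuousAt

/-- The distance from the origin decays to at most `1`. -/
lemma antitone_sq : Antitone fun t => (u t ^ 2 + v t ^ 2 - 1) * Real.exp (2 * t) := by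
  have h1 : ∀ t, HasDerivAt (fun t => (u t ^ 2 + v t ^ 2 - 1) * Real.exp (2 * t))
      ((2 * (cutoff (height (u t) (v t) ^ 2) * (u t ^ 2 * (2 - u t ^ 2))) - 2) *
        Real.exp (2 * t)) t := by
    intro t
    refine (((((h.left t).pow 2).add ((h.right t).pow 2)).sub_const 1).mul
      (hasDerivAt_exp_mul 2 t)).congr_deriv ?_
    simp [planeField]
    ring
  refine antitone_of_deriv_nonpos (fun t => (h1 t).differentiableAt) fun t => ?_
  rw [(h1 t).deriv]
  refine mul_nonpos_of_nonpos_of_nonneg ?_ (Real.exp_pos _).le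
  have h2 := cutoff_nonneg (height (u t) (v t) ^ 2)
  have h3 := cutoff_le_one (height (u t) (v t) ^ 2)
  have h4 : u t ^ 2 * (2 - u t ^ 2) ≤ 1 := by nlinarith [sq_nonneg (u t ^ 2 - 1)]
  nlinarith

lemma sq_add_sq_le {t : ℝ} (ht : 0 ≤ t) :
    (u t ^ 2 + v t ^ 2 - 1) * Real.exp (2 * t) ≤ u 0 ^ 2 + v 0 ^ 2 - 1 := by
  simpa using h.antitone_sq ht

lemma le_sq_add_sq {t : ℝ} (ht : t ≤ 0) :
    u 0 ^ 2 + v 0 ^ 2 - 1 ≤ (u t ^ 2 + v t ^ 2 - 1) * Real.exp (2 * t) := by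
  simpa using h.antitone_sq ht

/-- The first component keeps its sign. -/
lemma exists_pos_mul (t : ℝ) : ∃ r : ℝ, 0 < r ∧ u t = u 0 * r := by
  let a : ℝ → ℝ := fun t => -1 + cutoff (height (u t) (v t) ^ 2) * (2 - u t ^ 2)
  have ha : Continuous a := by
    have h1 := h.continuous_fst
    have h2 := h.continuous_snd
    have h3 : Continuous fun t => height (u t) (v t) ^ 2 := by
      simp only [height_sq]
      exact Continuous.inv₀ (by fun_prop) fun t => by positivity
    exact continuous_const.add ((contDiff_cutoff.continuous.comp h3).mul (by fun_prop))
  let A : ℝ → ℝ := fun t => ∫ s in (0 : ℝ)..t, a s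
  have hA : ∀ t, HasDerivAt A (a t) t := fun t => ha.integral_hasStrictDerivAt 0 t |>.hasDerivAt
  have h1 : ∀ t, HasDerivAt (fun s => u s * Real.exp (-A s)) 0 t := fun t => by
    refine ((h.left t).mul (hA t).neg.exp).congr_deriv ?_
    simp only [planeField, a, Pi.neg_apply]
    ring
  have h2 := is_const_of_deriv_eq_zero (fun t => (h1 t).differentiableAt)
    (fun t => (h1 t).deriv) t 0
  have hA0 : A 0 = 0 := by simp [A]
  simp only [hA0, neg_zero, Real.exp_zero, mul_one] at h2
  refine ⟨Real.exp (A t), Real.exp_pos _, ?_⟩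
  rw [← h2, mul_assoc, ← Real.exp_add]
  simp

lemma fst_ne_zero (h0 : u 0 ≠ 0) (t : ℝ) : u t ≠ 0 := by
  obtain ⟨r, hr, h1⟩ := h.exists_pos_mul t
  rw [h1]
  exact mul_ne_zero h0 hr.ne'

/-- The Bernoulli substitution `q = 1 / u²` makes the equation of the first component affine. -/
lemma hasDerivAt_inv_sq (h0 : u 0 ≠ 0) (t : ℝ) : HasDerivAt (fun t => (u t ^ 2)⁻¹)
    (2 * (u t ^ 2)⁻¹ + cutoff (height (u t) (v t) ^ 2) * (2 - 4 * (u t ^ 2)⁻¹)) t := by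
  have hu := h.fst_ne_zero h0 t
  refine (((h.left t).pow 2).inv (pow_ne_zero 2 hu)).congr_deriv ?_
  simp [planeField]
  field_simp
  ring

/-- The first component does not come too close to `0` while the cutoff is not yet `1`. -/
lemma inv_sq_le (h0 : u 0 ≠ 0) {t : ℝ} (ht : 0 ≤ t) :
    (u t ^ 2)⁻¹ + 1 ≤ ((u 0 ^ 2)⁻¹ + 1) * Real.exp (2 * t) := by
  have h1 : ∀ t, HasDerivAt (fun t => ((u t ^ 2)⁻¹ + 1) * Real.exp (-2 * t))
      ((cutoff (height (u t) (v t) ^ 2) * (2 - 4 * (u t ^ 2)⁻¹) - 2) * Real.exp (-2 * t)) t := by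
    intro t
    refine (((h.hasDerivAt_inv_sq h0 t).add_const 1).mul
      (hasDerivAt_exp_mul (-2) t)).congr_deriv ?_
    ring
  have h2 : Antitone fun t => ((u t ^ 2)⁻¹ + 1) * Real.exp (-2 * t) := by
    refine antitone_of_deriv_nonpos (fun t => (h1 t).differentiableAt) fun t => ?_
    rw [(h1 t).deriv]
    refine mul_nonpos_of_nonpos_of_nonneg ?_ (Real.exp_pos _).le
    have h2 := cutoff_nonneg (height (u t) (v t) ^ 2)
    have h3 := cutoff_le_one (height (u t) (v t) ^ 2)
    have h4 : 0 ≤ (u t ^ 2)⁻¹ := by positivity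
    nlinarith [mul_nonneg h2 h4]
  have h3 : ((u t ^ 2)⁻¹ + 1) * Real.exp (-2 * t) ≤ (u 0 ^ 2)⁻¹ + 1 := by simpa using h2 ht
  have h4 : Real.exp (-2 * t) * Real.exp (2 * t) = 1 := by rw [← Real.exp_add]; simp
  calc (u t ^ 2)⁻¹ + 1 = ((u t ^ 2)⁻¹ + 1) * Real.exp (-2 * t) * Real.exp (2 * t) := by
        rw [mul_assoc, h4, mul_one]
    _ ≤ _ := by gcongr

/-- The convergence of the first component to `±1`, with a bound that is locally uniform in the
initial point. After the time `T` with `exp (2 T) = 1 + u₀² + v₀²` the cutoff is `1` along the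
solution, and the affine equation for `1 / u²` is explicitly solvable. -/
lemma abs_inv_sq_sub_one_le (h0 : u 0 ≠ 0) {t : ℝ}
    (ht : 1 + u 0 ^ 2 + v 0 ^ 2 ≤ Real.exp (2 * t)) :
    |(u t ^ 2)⁻¹ - 1| ≤
      ((u 0 ^ 2)⁻¹ + 1) * (1 + u 0 ^ 2 + v 0 ^ 2) ^ 2 * Real.exp (-2 * t) := by
  set R := 1 + u 0 ^ 2 + v 0 ^ 2 with hR
  have hR1 : 1 ≤ R := by nlinarith [sq_nonneg (u 0), sq_nonneg (v 0)]
  obtain ⟨T, hT⟩ : ∃ T, Real.exp (2 * T) = R :=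
    ⟨Real.log R / 2, by rw [mul_div_cancel₀ _ two_ne_zero, Real.exp_log (by linarith)]⟩
  have hT0 : 0 ≤ T := by
    have : 0 ≤ 2 * T := Real.one_le_exp_iff.1 (by rw [hT]; exact hR1)
    linarith
  have hTt : T ≤ t := by
    rw [← hT, Real.exp_le_exp] at ht
    linarith
  have hm : ∀ s, T ≤ s → cutoff (height (u s) (v s) ^ 2) = 1 := by
    intro s hs
    apply cutoff_height_eq_one
    have h1 := h.sq_add_sq_le (hT0.trans hs)
    have h2 : R ≤ Real.exp (2 * s) := by rw [← hT]; exact Real.exp_le_exp.2 (by linarith)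
    by_contra hcon
    push Not at hcon
    nlinarith
  have h1 : ∀ s, HasDerivAt (fun t => ((u t ^ 2)⁻¹ - 1) * Real.exp (2 * t))
      ((2 * (u s ^ 2)⁻¹ + cutoff (height (u s) (v s) ^ 2) * (2 - 4 * (u s ^ 2)⁻¹) +
        ((u s ^ 2)⁻¹ - 1) * 2) * Real.exp (2 * s)) s := by
    intro s
    refine (((h.hasDerivAt_inv_sq h0 s).sub_const 1).mul
      (hasDerivAt_exp_mul 2 s)).congr_deriv ?_
    ring
  have h2 : ((u t ^ 2)⁻¹ - 1) * Real.exp (2 * t) = ((u T ^ 2)⁻¹ - 1) * Real.exp (2 * T) := by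
    refine constant_of_derivWithin_zero (a := T) (b := t)
      (f := fun t => ((u t ^ 2)⁻¹ - 1) * Real.exp (2 * t))
      (fun s _ => (h1 s).differentiableAt.differentiableWithinAt) (fun s hs => ?_) t
      (Set.right_mem_Icc.2 hTt)
    rw [(h1 s).hasDerivWithinAt.derivWithin
      (uniqueDiffOn_Icc (hs.1.trans_lt hs.2) s (Set.Ico_subset_Icc_self hs)), hm s hs.1]
    ring
  have h3 : ((u t ^ 2)⁻¹ - 1) = ((u T ^ 2)⁻¹ - 1) * R * Real.exp (-2 * t) := by
    rw [← hT, ← h2, mul_assoc, ← Real.exp_add]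
    simp
  have h4 := h.inv_sq_le h0 hT0
  rw [hT] at h4
  have h5 : |(u T ^ 2)⁻¹ - 1| ≤ ((u 0 ^ 2)⁻¹ + 1) * R := by
    have : 0 ≤ (u T ^ 2)⁻¹ := by positivity
    rw [abs_le]
    constructor <;> linarith
  rw [h3, abs_mul, abs_mul, abs_of_pos (Real.exp_pos _), abs_of_pos (by linarith : 0 < R)]
  have : |(u T ^ 2)⁻¹ - 1| * R ≤ ((u 0 ^ 2)⁻¹ + 1) * R ^ 2 := by
    rw [sq R, ← mul_assoc]
    gcongr
  gcongr

end IsPlaneSol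

/-- The solutions on the invariant line `u = 0`. -/
lemma isPlaneSol_vertical (b : ℝ) : IsPlaneSol (fun _ => 0) (fun t => b * Real.exp (-t)) where
  left t := by
    have : planeField 0 (b * Real.exp (-t)) = 0 := by simp [planeField]
    rw [this]
    exact hasDerivAt_const t 0
  right t := by
    refine (((hasDerivAt_id t).neg.exp).const_mul b).congr_deriv ?_
    simp

lemma one_add_sq_mul_pos {a : ℝ} (ha : a ^ 2 ≤ 1) (t : ℝ) :
    0 < 1 + a ^ 2 * (Real.exp t ^ 2 - 1) := by
  have h1 : 0 < Real.exp t := Real.exp_pos t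
  by_cases h : a = 0
  · simp [h]
  · have : 0 < a ^ 2 * Real.exp t ^ 2 := by positivity
    nlinarith

/-- The solutions on the invariant segment `v = 0`, `|u| ≤ 1`. -/
lemma isPlaneSol_horizontal {a : ℝ} (ha : a ^ 2 ≤ 1) :
    IsPlaneSol (fun t => a * Real.exp t / √(1 + a ^ 2 * (Real.exp t ^ 2 - 1))) (fun _ => 0) where
  left t := by
    have hd := one_add_sq_mul_pos ha t
    have hs : 0 < √(1 + a ^ 2 * (Real.exp t ^ 2 - 1)) := Real.sqrt_pos.2 hd
    have hsq := Real.sq_sqrt hd.le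
    have h1 : planeField (a * Real.exp t / √(1 + a ^ 2 * (Real.exp t ^ 2 - 1))) 0 =
        a * Real.exp t / √(1 + a ^ 2 * (Real.exp t ^ 2 - 1)) -
          (a * Real.exp t / √(1 + a ^ 2 * (Real.exp t ^ 2 - 1))) ^ 3 := by
      apply planeField_of_le
      have : (a * Real.exp t / √(1 + a ^ 2 * (Real.exp t ^ 2 - 1))) ^ 2 ≤ 1 := by
        rw [div_pow, hsq, div_le_one hd]
        nlinarith
      linarith
    rw [h1]
    have h2 : HasDerivAt (fun t => 1 + a ^ 2 * (Real.exp t ^ 2 - 1))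
        (2 * a ^ 2 * Real.exp t ^ 2) t := by
      refine (((((Real.hasDerivAt_exp t).pow 2).sub_const 1).const_mul (a ^ 2)).const_add
        1).congr_deriv ?_
      simp
      ring
    refine (((Real.hasDerivAt_exp t).const_mul a).div (h2.sqrt hd.ne') hs.ne').congr_deriv ?_
    set s := √(1 + a ^ 2 * (Real.exp t ^ 2 - 1))
    field_simp
  right t := by simpa using hasDerivAt_const t (0 : ℝ)

/-! ### Limits of flow lines -/

/-- The equator, the only closed orbit. -/
def equator : Set S2 := {p | (p : E3) 2 = 0}

lemma continuous_coord (k : Fin 3) : Continuous fun p : S2 => (p : E3) k := by fun_prop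

lemma isClosed_equator : IsClosed equator := isClosed_eq (continuous_coord 2) continuous_const

/-- The point of the equator with longitude `θ`. -/
def equatorPt (θ : ℝ) : S2 :=
  ⟨!₂[Real.cos θ, Real.sin θ, 0], by
    rw [mem_sphere_zero_iff_norm, ← sq_eq_sq₀ (norm_nonneg _) zero_le_one,
      EuclideanSpace.norm_sq_eq]
    simp [Fin.sum_univ_three]⟩

lemma coe_equatorPt (θ : ℝ) : (equatorPt θ : E3) = !₂[Real.cos θ, Real.sin θ, 0] := rfl

lemma equatorPt_mem (θ : ℝ) : equatorPt θ ∈ equator := rfl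

lemma exists_equatorPt {p : S2} (hp : p ∈ equator) : ∃ θ, equatorPt θ = p := by
  have h := sum_sq_S2 p
  have h2 : (p : E3) 2 = 0 := hp
  rw [h2] at h
  let z : ℂ := ⟨(p : E3) 0, (p : E3) 1⟩
  have hz : ‖z‖ = 1 := by
    rw [← sq_eq_sq₀ (norm_nonneg _) zero_le_one, Complex.sq_norm, Complex.normSq_apply]
    change (p : E3) 0 * (p : E3) 0 + (p : E3) 1 * (p : E3) 1 = 1 ^ 2
    linarith
  have hz0 : z ≠ 0 := fun h0 => by simp [h0] at hz
  refine ⟨z.arg, Subtype.ext ?_⟩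
  ext k
  fin_cases k
  · change Real.cos z.arg = z.re
    rw [Complex.cos_arg hz0, hz, div_one]
  · change Real.sin z.arg = z.im
    rw [Complex.sin_arg, hz, div_one]
  · exact h2.symm

lemma spaceField_of_eq_zero {p : E3} (hp : p 2 = 0) : spaceField p = !₂[-p 1, p 0, 0] := by
  ext k
  fin_cases k <;> simp [spaceField, bump_of_eq_zero hp, hp]

lemma hasDerivAt_equatorPt (θ : ℝ) : HasDerivAt (fun s => (equatorPt s : E3))
    !₂[-Real.sin θ, Real.cos θ, 0] θ := by
  refine hasDerivAt_E3 fun k => ?_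
  fin_cases k
  · simpa [coe_equatorPt] using Real.hasDerivAt_cos θ
  · simpa [coe_equatorPt] using Real.hasDerivAt_sin θ
  · simpa [coe_equatorPt] using hasDerivAt_const θ (0 : ℝ)

/-- The equator rotates with unit speed. -/
lemma flow_equatorPt (θ t : ℝ) : flow X t (equatorPt θ) = equatorPt (θ + t) := by
  have h := flow_X_eq (c := fun t => equatorPt (θ + t)) (fun t => by
    rw [spaceField_of_eq_zero (equatorPt_mem _)]
    exact (hasDerivAt_equatorPt (θ + t)).comp_const_add θ t) t
  simpa using h

lemma flow_mem_equator {p : S2} (hp : p ∈ equator) (t : ℝ) : flow X t p ∈ equator := by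
  obtain ⟨θ, rfl⟩ := exists_equatorPt hp
  rw [flow_equatorPt]
  exact equatorPt_mem _

/-- The neighbourhoods of the equator are given by the height. -/
lemma tendsto_nhdsSet_equator {ι : Type*} {l : Filter ι} {f : ι → S2}
    (h : Tendsto (fun i => (f i : E3) 2) l (𝓝 0)) : Tendsto f l (𝓝ˢ equator) := by
  rw [(hasBasis_nhdsSet equator).tendsto_right_iff]
  rintro U ⟨hU, hsub⟩
  rcases Uᶜ.eq_empty_or_nonempty with hemp | hne
  · rw [Set.compl_empty_iff] at hemp
    exact Eventually.of_forall fun i => by simp [hemp]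
  obtain ⟨p, hp, hmin⟩ := hU.isClosed_compl.isCompact.exists_isMinOn hne
    (f := fun p : S2 => |(p : E3) 2|) (continuous_coord 2).abs.continuousOn
  have hpos : 0 < |(p : E3) 2| := abs_pos.2 fun h0 => hp (hsub h0)
  have h2 := h.abs
  rw [abs_zero] at h2
  filter_upwards [h2.eventually (gt_mem_nhds hpos)] with i hi
  by_contra hcon
  exact absurd (isMinOn_iff.1 hmin _ hcon) (not_le.2 hi)

/-- The solution of the plane ODE with initial point `(a, b)`. -/
def sol (a b : ℝ) : ℝ → ℝ := (exists_isPlaneSol a b).choose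

/-- The second component of the solution of the plane ODE. -/
def sol' (a b : ℝ) : ℝ → ℝ := (exists_isPlaneSol a b).choose_spec.choose

lemma isPlaneSol_sol (a b : ℝ) : IsPlaneSol (sol a b) (sol' a b) :=
  (exists_isPlaneSol a b).choose_spec.choose_spec.1

lemma sol_zero (a b : ℝ) : sol a b 0 = a :=
  (exists_isPlaneSol a b).choose_spec.choose_spec.2.1

lemma sol'_zero (a b : ℝ) : sol' a b 0 = b :=
  (exists_isPlaneSol a b).choose_spec.choose_spec.2.2

lemma sol'_eq (a b t : ℝ) : sol' a b t = b * Real.exp (-t) := by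
  rw [(isPlaneSol_sol a b).snd_eq t, sol'_zero]

lemma flow_spiral_sol (i : Fin 2) (a b t : ℝ) :
    flow X t (spiral i a b) = spiral i (sol a b t) (sol' a b t) := by
  have h := flow_spiral i (isPlaneSol_sol a b).left (isPlaneSol_sol a b).right t
  rwa [sol_zero, sol'_zero] at h

lemma continuous_height : Continuous fun p : ℝ × ℝ => height p.1 p.2 := by
  unfold height
  refine Continuous.inv₀ (by fun_prop) fun p => ?_
  positivity

lemma continuous_spiral (i : Fin 2) : Continuous fun p : ℝ × ℝ => spiral i p.1 p.2 := by
  have h1 : Continuous fun p : ℝ × ℝ => Real.log (height p.1 p.2) :=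
    continuous_height.log fun p => (height_pos _ _).ne'
  have h2 := continuous_height
  refine Continuous.subtype_mk ?_ _
  refine (PiLp.continuous_toLp 2 _).comp (continuous_pi fun k => ?_)
  fin_cases k
  · exact h2.mul ((continuous_fst.mul (Real.continuous_cos.comp h1.neg)).add
      (continuous_snd.mul (Real.continuous_sin.comp h1.neg)))
  · exact h2.mul ((continuous_snd.mul (Real.continuous_cos.comp h1.neg)).sub
      (continuous_fst.mul (Real.continuous_sin.comp h1.neg)))
  · exact continuous_const.mul h2

lemma tendsto_spiral {ι : Type*} {l : Filter ι} (i : Fin 2) {f g : ι → ℝ} {a b : ℝ}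
    (hf : Tendsto f l (𝓝 a)) (hg : Tendsto g l (𝓝 b)) :
    Tendsto (fun q => spiral i (f q) (g q)) l (𝓝 (spiral i a b)) := by
  have h1 : Tendsto (fun p : ℝ × ℝ => spiral i p.1 p.2) (𝓝 (a, b)) (𝓝 (spiral i a b)) :=
    (continuous_spiral i).tendsto (a, b)
  have h2 : Tendsto (fun q => (f q, g q)) l (𝓝 (a, b)) := hf.prodMk_nhds hg
  have h3 := h1.comp h2
  exact h3

/-- Near a point on an open hemisphere the spiral coordinates are a continuous chart. -/
lemma eventually_spiral_coord (i : Fin 2) (a b : ℝ) :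
    (∀ᶠ y : S2 in 𝓝 (spiral i a b), spiral i (uCoord (y : E3)) (vCoord (y : E3)) = y) ∧
      Tendsto (fun y : S2 => (uCoord (y : E3), vCoord (y : E3))) (𝓝 (spiral i a b)) (𝓝 (a, b)) := by
  constructor
  · have h1 : 0 < sgn i * (spiral i a b : E3) 2 := by
      rw [coe_spiral, spiralVec_two, ← mul_assoc, ← sq, sgn_sq, one_mul]
      exact height_pos a b
    have h2 : Continuous fun y : S2 => sgn i * (y : E3) 2 :=
      continuous_const.mul (continuous_coord 2)
    filter_upwards [h2.continuousAt.eventually (lt_mem_nhds h1)] with y hy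
    exact spiral_coord i y hy
  · obtain ⟨-, -, h3, h4⟩ := contDiffAt_spiral (spiralVec_two_ne_zero i a b)
    have h5 : Tendsto (fun y : S2 => (y : E3)) (𝓝 (spiral i a b)) (𝓝 (spiralVec i a b)) :=
      continuous_subtype_val.continuousAt
    have h6 := h3.continuousAt.tendsto.comp h5
    have h7 := h4.continuousAt.tendsto.comp h5
    rw [uCoord_spiralVec] at h6
    rw [vCoord_spiralVec] at h7
    exact h6.prodMk_nhds h7

/-- Statements near a point of an open hemisphere can be checked in spiral coordinates. -/
lemma eventually_of_spiral {i : Fin 2} {a b : ℝ} {P : S2 → Prop}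
    (h : ∀ᶠ q : ℝ × ℝ in 𝓝 (a, b), P (spiral i q.1 q.2)) : ∀ᶠ y : S2 in 𝓝 (spiral i a b), P y := by
  obtain ⟨h1, h2⟩ := eventually_spiral_coord i a b
  filter_upwards [h1, h2.eventually h] with y hy hP
  rwa [hy] at hP

lemma tendsto_of_spiral {i : Fin 2} {a b : ℝ} {l : Filter ℝ} {L : Filter S2}
    {F : ℝ → S2 → S2}
    (h : Tendsto (fun q : ℝ × (ℝ × ℝ) => F q.1 (spiral i q.2.1 q.2.2)) (l ×ˢ 𝓝 (a, b)) L) :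
    Tendsto (fun q : ℝ × S2 => F q.1 q.2) (l ×ˢ 𝓝 (spiral i a b)) L := by
  obtain ⟨h1, h2⟩ := eventually_spiral_coord i a b
  refine (h.comp (tendsto_id.prodMap h2)).congr' ?_
  have h3 : ∀ᶠ q : ℝ × S2 in l ×ˢ 𝓝 (spiral i a b),
      spiral i (uCoord (q.2 : E3)) (vCoord (q.2 : E3)) = q.2 :=
    tendsto_snd.eventually h1
  filter_upwards [h3] with q hq
  change F q.1 (spiral i (uCoord (q.2 : E3)) (vCoord (q.2 : E3))) = F q.1 q.2
  rw [hq]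

lemma tendsto_exp_mul_atTop {k : ℝ} (hk : k < 0) :
    Tendsto (fun t => Real.exp (k * t)) atTop (𝓝 0) :=
  Real.tendsto_exp_atBot.comp (tendsto_id.const_mul_atTop_of_neg hk)

lemma tendsto_exp_neg_atTop : Tendsto (fun t : ℝ => Real.exp (-t)) atTop (𝓝 0) :=
  Real.tendsto_exp_neg_atTop_nhds_zero

/-- Points with nonzero first coordinate converge to a sink, locally uniformly. -/
lemma tendsto_flow_atTop (i : Fin 2) {a b e : ℝ} (he : e ^ 2 = 1) (hea : 0 < e * a) :
    Tendsto (fun q : ℝ × S2 => flow X q.1 q.2) (atTop ×ˢ 𝓝 (spiral i a b))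
      (𝓝 (spiral i e 0)) := by
  apply tendsto_of_spiral
  simp only [flow_spiral_sol]
  have hfst : Tendsto (fun q : ℝ × (ℝ × ℝ) => q.1) (atTop ×ˢ 𝓝 (a, b)) atTop := tendsto_fst
  have ha : Tendsto (fun q : ℝ × (ℝ × ℝ) => q.2.1) (atTop ×ˢ 𝓝 (a, b)) (𝓝 a) :=
    (continuous_fst.tendsto (a, b)).comp tendsto_snd
  have hb : Tendsto (fun q : ℝ × (ℝ × ℝ) => q.2.2) (atTop ×ˢ 𝓝 (a, b)) (𝓝 b) :=
    (continuous_snd.tendsto (a, b)).comp tendsto_snd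
  have ha0 : a ≠ 0 := fun h => by simp [h] at hea
  have hpos : ∀ᶠ q : ℝ × (ℝ × ℝ) in atTop ×ˢ 𝓝 (a, b), 0 < e * q.2.1 :=
    (ha.const_mul e).eventually (lt_mem_nhds hea)
  refine tendsto_spiral i ?_ ?_
  · let R : ℝ × (ℝ × ℝ) → ℝ := fun q => 1 + q.2.1 ^ 2 + q.2.2 ^ 2
    have hR : Tendsto R (atTop ×ˢ 𝓝 (a, b)) (𝓝 (1 + a ^ 2 + b ^ 2)) :=
      ((ha.pow 2).const_add 1).add (hb.pow 2)
    have hbound : Tendsto (fun q : ℝ × (ℝ × ℝ) =>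
        ((q.2.1 ^ 2)⁻¹ + 1) * R q ^ 2 * Real.exp (-2 * q.1)) (atTop ×ˢ 𝓝 (a, b)) (𝓝 0) := by
      have h1 := (((ha.pow 2).inv₀ (pow_ne_zero 2 ha0)).add_const 1).mul (hR.pow 2)
      have h2 := h1.mul ((tendsto_exp_mul_atTop (k := -2) (by norm_num)).comp hfst)
      rwa [mul_zero] at h2
    have hlarge : ∀ᶠ q : ℝ × (ℝ × ℝ) in atTop ×ˢ 𝓝 (a, b), R q ≤ Real.exp (2 * q.1) := by
      have h1 : Tendsto (fun q : ℝ × (ℝ × ℝ) => Real.exp (2 * q.1)) (atTop ×ˢ 𝓝 (a, b)) atTop :=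
        Real.tendsto_exp_atTop.comp (hfst.const_mul_atTop two_pos)
      filter_upwards [hR.eventually (gt_mem_nhds (lt_add_one _)), h1.eventually_ge_atTop _]
        with q h2 h3
      exact h2.le.trans h3
    have hinv : Tendsto (fun q : ℝ × (ℝ × ℝ) => (sol q.2.1 q.2.2 q.1 ^ 2)⁻¹)
        (atTop ×ˢ 𝓝 (a, b)) (𝓝 1) := by
      rw [tendsto_iff_norm_sub_tendsto_zero]
      refine squeeze_zero' (Eventually.of_forall fun _ => norm_nonneg _) ?_ hbound
      filter_upwards [hpos, hlarge] with q hq hq2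
      have hq0 : q.2.1 ≠ 0 := fun h => by simp [h] at hq
      have h1 := (isPlaneSol_sol q.2.1 q.2.2).abs_inv_sq_sub_one_le (t := q.1)
        (by rwa [sol_zero]) (by rwa [sol_zero, sol'_zero])
      rwa [sol_zero, sol'_zero] at h1
    have hsq := (hinv.inv₀ one_ne_zero).sqrt.const_mul e
    simp only [inv_inv, inv_one, Real.sqrt_one, mul_one, Real.sqrt_sq_eq_abs] at hsq
    refine hsq.congr' ?_
    filter_upwards [hpos] with q hq
    obtain ⟨r, hr, h1⟩ := (isPlaneSol_sol q.2.1 q.2.2).exists_pos_mul q.1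
    rw [sol_zero] at h1
    have h2 : 0 < e * sol q.2.1 q.2.2 q.1 := by
      rw [h1, ← mul_assoc]
      exact mul_pos hq hr
    have h3 : |e| = 1 := by rw [← sq_eq_sq₀ (abs_nonneg _) zero_le_one, sq_abs, he, one_pow]
    have h4 : |sol q.2.1 q.2.2 q.1| = e * sol q.2.1 q.2.2 q.1 := by
      rw [← abs_of_pos h2, abs_mul, h3, one_mul]
    rw [h4, ← mul_assoc, ← sq, he, one_mul]
  · simp only [sol'_eq]
    have h2 := hb.mul (tendsto_exp_neg_atTop.comp hfst)
    rwa [mul_zero] at h2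

/-- The squared height decays backwards in time, outside the disc of radius `1` in spiral
coordinates. -/
lemma flow_two_sq_le {y : S2} (hy : (y : E3) 2 ^ 2 < 1 / 2) {t : ℝ} (ht : t ≤ 0) :
    ((flow X t y : S2) : E3) 2 ^ 2 ≤ (y : E3) 2 ^ 2 := by
  by_cases h0 : (y : E3) 2 = 0
  · have h1 : ((flow X t y : S2) : E3) 2 = 0 := flow_mem_equator h0 t
    rw [h1, h0]
  · obtain ⟨i, u, v, rfl⟩ := exists_spiral_of_ne_zero y h0
    rw [flow_spiral_sol]
    simp only [coe_spiral, spiralVec_two, mul_pow, sgn_sq, one_mul, height_sq] at hy ⊢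
    apply inv_anti₀ (by positivity)
    have h1 := (isPlaneSol_sol u v).le_sq_add_sq ht
    rw [sol_zero, sol'_zero] at h1
    have h2 : 1 ≤ u ^ 2 + v ^ 2 := by
      rw [one_div, inv_lt_inv₀ (by positivity) two_pos] at hy
      linarith
    have h3 : Real.exp (2 * t) ≤ 1 := Real.exp_le_one_iff.2 (by linarith)
    by_contra hcon
    have h4 := Real.exp_pos (2 * t)
    nlinarith

/-- Points off the segment `v = 0`, `|u| ≤ 1` come from the equator, locally uniformly. -/
lemma tendsto_flow_atBot (i : Fin 2) {a b : ℝ} (hab : b ≠ 0 ∨ 1 < a ^ 2) :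
    Tendsto (fun q : ℝ × S2 => flow X q.1 q.2) (atBot ×ˢ 𝓝 (spiral i a b)) (𝓝ˢ equator) := by
  apply tendsto_of_spiral
  apply tendsto_nhdsSet_equator
  have hfst : Tendsto (fun q : ℝ × (ℝ × ℝ) => q.1) (atBot ×ˢ 𝓝 (a, b)) atBot := tendsto_fst
  have ha : Tendsto (fun q : ℝ × (ℝ × ℝ) => q.2.1) (atBot ×ˢ 𝓝 (a, b)) (𝓝 a) :=
    (continuous_fst.tendsto (a, b)).comp tendsto_snd
  have hb : Tendsto (fun q : ℝ × (ℝ × ℝ) => q.2.2) (atBot ×ˢ 𝓝 (a, b)) (𝓝 b) :=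
    (continuous_snd.tendsto (a, b)).comp tendsto_snd
  have hexp : Tendsto (fun q : ℝ × (ℝ × ℝ) => Real.exp (2 * q.1)) (atBot ×ˢ 𝓝 (a, b)) (𝓝 0) :=
    Real.tendsto_exp_atBot.comp (hfst.const_mul_atBot two_pos)
  have hneg : ∀ᶠ q : ℝ × (ℝ × ℝ) in atBot ×ˢ 𝓝 (a, b), q.1 ≤ 0 := hfst.eventually_le_atBot 0
  -- It suffices to bound the squared height by a multiple of `exp (2 t)`.
  have key : ∀ f : ℝ × (ℝ × ℝ) → ℝ, ∀ c, c ≠ 0 → Tendsto f (atBot ×ˢ 𝓝 (a, b)) (𝓝 c) →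
      (∀ᶠ q : ℝ × (ℝ × ℝ) in atBot ×ˢ 𝓝 (a, b), 0 < f q ∧ f q ≤
        (1 + sol q.2.1 q.2.2 q.1 ^ 2 + sol' q.2.1 q.2.2 q.1 ^ 2) * Real.exp (2 * q.1)) →
      Tendsto (fun q : ℝ × (ℝ × ℝ) => ((flow X q.1 (spiral i q.2.1 q.2.2) : S2) : E3) 2)
        (atBot ×ˢ 𝓝 (a, b)) (𝓝 0) := by
    intro f c hc hf hle
    have h1 := (hf.inv₀ hc).mul hexp
    rw [mul_zero] at h1
    have h2 : Tendsto (fun q : ℝ × (ℝ × ℝ) => ((flow X q.1 (spiral i q.2.1 q.2.2) : S2) : E3) 2 ^ 2)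
        (atBot ×ˢ 𝓝 (a, b)) (𝓝 0) := by
      refine squeeze_zero' (Eventually.of_forall fun _ => sq_nonneg _) ?_ h1
      filter_upwards [hle] with q hq
      obtain ⟨hq0, hq⟩ := hq
      rw [flow_spiral_sol]
      simp only [coe_spiral, spiralVec_two, mul_pow, sgn_sq, one_mul, height_sq]
      have h3 : 0 < 1 + sol q.2.1 q.2.2 q.1 ^ 2 + sol' q.2.1 q.2.2 q.1 ^ 2 := by positivity
      rw [inv_le_iff_one_le_mul₀ h3, mul_comm, ← mul_assoc, mul_comm _ (f q)⁻¹, mul_assoc,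
        ← div_eq_inv_mul, one_le_div hq0]
      exact hq
    have h3 := h2.sqrt
    simp only [Real.sqrt_sq_eq_abs, Real.sqrt_zero] at h3
    exact (tendsto_zero_iff_abs_tendsto_zero _).2 h3
  rcases hab with hb0 | ha1
  · refine key (fun q => q.2.2 ^ 2) _ (pow_ne_zero 2 hb0) (hb.pow 2) ?_
    filter_upwards [(hb.pow 2).eventually (lt_mem_nhds (by positivity : 0 < b ^ 2))] with q hq
    refine ⟨hq, ?_⟩
    have h1 : q.2.2 ^ 2 = sol' q.2.1 q.2.2 q.1 ^ 2 * Real.exp (2 * q.1) := by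
      rw [sol'_eq, mul_pow, mul_assoc, ← Real.exp_nat_mul, ← Real.exp_add]
      simp
    rw [h1]
    gcongr
    nlinarith [sq_nonneg (sol q.2.1 q.2.2 q.1)]
  · have hf : Tendsto (fun q : ℝ × (ℝ × ℝ) => q.2.1 ^ 2 + q.2.2 ^ 2 - 1) (atBot ×ˢ 𝓝 (a, b))
        (𝓝 (a ^ 2 + b ^ 2 - 1)) := ((ha.pow 2).add (hb.pow 2)).sub_const 1
    have hpos : 0 < a ^ 2 + b ^ 2 - 1 := by nlinarith [sq_nonneg b]
    refine key _ _ hpos.ne' hf ?_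
    filter_upwards [hneg, hf.eventually (lt_mem_nhds hpos)] with q hq hq2
    refine ⟨hq2, ?_⟩
    have h1 := (isPlaneSol_sol q.2.1 q.2.2).le_sq_add_sq hq
    rw [sol_zero, sol'_zero] at h1
    refine h1.trans ?_
    gcongr
    linarith

/-- Near the equator, the convergence to the equator backwards in time is locally uniform. -/
lemma tendsto_flow_atBot_equator {p : S2} (hp : p ∈ equator) :
    Tendsto (fun q : ℝ × S2 => flow X q.1 q.2) (atBot ×ˢ 𝓝 p) (𝓝ˢ equator) := by
  apply tendsto_nhdsSet_equator
  have h0 : Tendsto (fun y : S2 => (y : E3) 2 ^ 2) (𝓝 p) (𝓝 0) := by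
    have h1 : (p : E3) 2 = 0 := hp
    have h3 : Continuous fun y : S2 => (y : E3) 2 ^ 2 := (continuous_coord 2).pow 2
    have h2 := h3.tendsto p
    rwa [h1, zero_pow two_ne_zero] at h2
  have h1 : Tendsto (fun q : ℝ × S2 => (q.2 : E3) 2 ^ 2) (atBot ×ˢ 𝓝 p) (𝓝 0) :=
    h0.comp tendsto_snd
  have h2 : Tendsto (fun q : ℝ × S2 => ((flow X q.1 q.2 : S2) : E3) 2 ^ 2)
      (atBot ×ˢ 𝓝 p) (𝓝 0) := by
    refine squeeze_zero' (Eventually.of_forall fun _ => sq_nonneg _) ?_ h1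
    have h3 : ∀ᶠ q : ℝ × S2 in atBot ×ˢ 𝓝 p, q.1 ≤ 0 :=
      tendsto_fst.eventually (eventually_le_atBot 0)
    filter_upwards [h3, h1.eventually (gt_mem_nhds one_half_pos)] with q hq hq2
    exact flow_two_sq_le hq2 hq
  have h3 := h2.sqrt
  simp only [Real.sqrt_sq_eq_abs, Real.sqrt_zero] at h3
  exact (tendsto_zero_iff_abs_tendsto_zero _).2 h3

/-! ### Stable and unstable manifolds -/

/-- The rest points: the saddle (`e = 0`) and the two sinks (`e = 1` and `e = -1`) on each open
hemisphere. -/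
def node (i : Fin 2) (e : SignType) : S2 := spiral i e 0

lemma node_inj {i j : Fin 2} {e e' : SignType} : node i e = node j e' ↔ i = j ∧ e = e' := by
  rw [node, node, spiral_inj]
  constructor
  · rintro ⟨rfl, h, -⟩
    refine ⟨rfl, ?_⟩
    revert h
    cases e <;> cases e' <;> simp <;> norm_num
  · rintro ⟨rfl, rfl⟩
    simp

lemma spiral_notMem_equator (i : Fin 2) (u v : ℝ) : spiral i u v ∉ equator :=
  spiralVec_two_ne_zero i u v

lemma disjoint_node_equator (i : Fin 2) (e : SignType) : Disjoint {node i e} equator :=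
  Set.disjoint_singleton_left.2 (spiral_notMem_equator i e 0)

lemma mem_limitManifold_equator {p : S2} (hp : p ∈ equator) (l : Filter ℝ) :
    p ∈ limitManifold X l equator :=
  (tendsto_principal.2 (Eventually.of_forall fun t => flow_mem_equator hp t)).mono_right
    principal_le_nhdsSet

/-- The flow line of a point on the line `u = 0`. -/
lemma flow_vertical (i : Fin 2) (b t : ℝ) :
    flow X t (spiral i 0 b) = spiral i 0 (b * Real.exp (-t)) := by
  have h := flow_spiral i (isPlaneSol_vertical b).left (isPlaneSol_vertical b).right t
  simpa using h

/-- The flow line of a point on the segment `v = 0`, `|u| ≤ 1`. -/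
lemma flow_horizontal (i : Fin 2) {a : ℝ} (ha : a ^ 2 ≤ 1) (t : ℝ) :
    flow X t (spiral i a 0) =
      spiral i (a * Real.exp t / √(1 + a ^ 2 * (Real.exp t ^ 2 - 1))) 0 := by
  have h := flow_spiral i (isPlaneSol_horizontal ha).left (isPlaneSol_horizontal ha).right t
  simpa using h

lemma flow_node (i : Fin 2) (e : SignType) (t : ℝ) : flow X t (node i e) = node i e := by
  have he : (e : ℝ) ^ 2 ≤ 1 := by cases e <;> simp
  rw [node, flow_horizontal i he, spiral_inj]
  refine ⟨rfl, ?_, rfl⟩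
  cases e <;> simp [Real.sqrt_sq (Real.exp_pos t).le]

lemma spiral_mem_Ws (i : Fin 2) (u v : ℝ) :
    spiral i u v ∈ Ws X {node i (SignType.sign u)} := by
  change Tendsto (fun t => flow X t (spiral i u v)) atTop (𝓝ˢ {node i (SignType.sign u)})
  rw [nhdsSet_singleton, node]
  rcases lt_trichotomy u 0 with h | h | h
  · have h1 := tendsto_flow_atTop i (b := v) (e := -1) (by norm_num) (by linarith : 0 < -1 * u)
    rw [sign_neg h]
    simpa [Function.comp_def] using
      h1.comp (tendsto_id.prodMk (tendsto_const_nhds (x := spiral i u v)))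
  · subst h
    simp only [flow_vertical, sign_zero, SignType.coe_zero]
    refine tendsto_spiral i tendsto_const_nhds ?_
    simpa using tendsto_exp_neg_atTop.const_mul v
  · have h1 := tendsto_flow_atTop i (b := v) (e := 1) (by norm_num) (by linarith : 0 < 1 * u)
    rw [sign_pos h]
    simpa [Function.comp_def] using
      h1.comp (tendsto_id.prodMk (tendsto_const_nhds (x := spiral i u v)))

lemma spiral_mem_Wu_equator {i : Fin 2} {u v : ℝ} (h : v ≠ 0 ∨ 1 < u ^ 2) :
    spiral i u v ∈ Wu X equator :=
  (tendsto_flow_atBot i h).comp (tendsto_id.prodMk (tendsto_const_nhds (x := spiral i u v)))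

lemma spiral_mem_Wu_saddle {i : Fin 2} {u : ℝ} (h : u ^ 2 < 1) :
    spiral i u 0 ∈ Wu X {node i 0} := by
  change Tendsto (fun t => flow X t (spiral i u 0)) atBot (𝓝ˢ {node i 0})
  rw [nhdsSet_singleton, node]
  simp only [flow_horizontal i h.le, SignType.coe_zero]
  refine tendsto_spiral i ?_ tendsto_const_nhds
  have h1 : ContinuousAt (fun s : ℝ => u * s / √(1 + u ^ 2 * (s ^ 2 - 1))) 0 := by
    refine ContinuousAt.div (by fun_prop) (by fun_prop) ?_
    rw [Real.sqrt_ne_zero']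
    nlinarith
  have h2 := h1.tendsto.comp Real.tendsto_exp_atBot
  simpa [Function.comp_def] using h2

lemma node_mem_Wu (i : Fin 2) (e : SignType) : node i e ∈ Wu X {node i e} := by
  change Tendsto (fun t => flow X t (node i e)) atBot (𝓝ˢ {node i e})
  rw [nhdsSet_singleton]
  simp only [flow_node]
  exact tendsto_const_nhds

lemma disjoint_limitManifold_node {l : Filter ℝ} [l.NeBot] {i j : Fin 2} {e e' : SignType}
    (h : node i e ≠ node j e') :
    Disjoint (limitManifold X l {node i e}) (limitManifold X l {node j e'}) :=
  disjoint_limitManifold isClosed_singleton isClosed_singleton (Set.disjoint_singleton.2 h)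

lemma disjoint_limitManifold_node_equator {l : Filter ℝ} [l.NeBot] (i : Fin 2) (e : SignType) :
    Disjoint (limitManifold X l {node i e}) (limitManifold X l equator) :=
  disjoint_limitManifold isClosed_singleton isClosed_equator (disjoint_node_equator i e)

lemma mem_Ws_node {p : S2} {i : Fin 2} {e : SignType} :
    p ∈ Ws X {node i e} ↔ ∃ u v, p = spiral i u v ∧ SignType.sign u = e := by
  constructor
  · intro h
    by_cases hp : p ∈ equator
    · exact absurd (mem_limitManifold_equator hp atTop)
        (Set.disjoint_left.1 (disjoint_limitManifold_node_equator i e) h)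
    · obtain ⟨j, u, v, rfl⟩ := exists_spiral_of_ne_zero p hp
      by_contra hcon
      refine Set.disjoint_left.1 (disjoint_limitManifold_node ?_) h (spiral_mem_Ws j u v)
      rw [Ne, node_inj]
      rintro ⟨rfl, rfl⟩
      exact hcon ⟨u, v, rfl, rfl⟩
  · rintro ⟨u, v, rfl, rfl⟩
    exact spiral_mem_Ws i u v

lemma Ws_equator : Ws X equator = equator := by
  ext p
  refine ⟨fun h => ?_, fun h => mem_limitManifold_equator h _⟩
  by_contra hp
  obtain ⟨j, u, v, rfl⟩ := exists_spiral_of_ne_zero p hp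
  exact Set.disjoint_left.1 (disjoint_limitManifold_node_equator _ _) (spiral_mem_Ws j u v) h

/-- The three cases for the backward limit of a point on an open hemisphere. -/
lemma backward_cases (u v : ℝ) :
    (v ≠ 0 ∨ 1 < u ^ 2) ∨ (v = 0 ∧ u ^ 2 < 1) ∨ ∃ e : SignType, e ≠ 0 ∧ v = 0 ∧ u = e := by
  by_cases hv : v = 0
  · rcases lt_trichotomy (u ^ 2) 1 with h | h | h
    · exact Or.inr (Or.inl ⟨hv, h⟩)
    · rcases sq_eq_sq_iff_eq_or_eq_neg.1 (h.trans (one_pow 2).symm) with h | h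
      · exact Or.inr (Or.inr ⟨1, by decide, hv, by simp [h]⟩)
      · exact Or.inr (Or.inr ⟨-1, by decide, hv, by simp [h]⟩)
    · exact Or.inl (Or.inr h)
  · exact Or.inl (Or.inl hv)

lemma mem_Wu_equator {p : S2} :
    p ∈ Wu X equator ↔ p ∈ equator ∨ ∃ i u v, p = spiral i u v ∧ (v ≠ 0 ∨ 1 < u ^ 2) := by
  constructor
  · intro h
    by_cases hp : p ∈ equator
    · exact Or.inl hp
    · obtain ⟨j, u, v, rfl⟩ := exists_spiral_of_ne_zero p hp
      rcases backward_cases u v with h1 | ⟨rfl, h1⟩ | ⟨e, -, rfl, rfl⟩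
      · exact Or.inr ⟨j, u, v, rfl, h1⟩
      · exact absurd h (Set.disjoint_left.1 (disjoint_limitManifold_node_equator _ _)
          (spiral_mem_Wu_saddle h1))
      · exact absurd h (Set.disjoint_left.1 (disjoint_limitManifold_node_equator _ _)
          (node_mem_Wu j e))
  · rintro (h | ⟨i, u, v, rfl, h⟩)
    · exact mem_limitManifold_equator h _
    · exact spiral_mem_Wu_equator h

lemma mem_Wu_saddle {p : S2} {i : Fin 2} :
    p ∈ Wu X {node i 0} ↔ ∃ u, p = spiral i u 0 ∧ u ^ 2 < 1 := by
  constructor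
  · intro h
    by_cases hp : p ∈ equator
    · exact absurd (mem_limitManifold_equator hp atBot)
        (Set.disjoint_left.1 (disjoint_limitManifold_node_equator i 0) h)
    · obtain ⟨j, u, v, rfl⟩ := exists_spiral_of_ne_zero p hp
      rcases backward_cases u v with h1 | ⟨rfl, h1⟩ | ⟨e, he, rfl, rfl⟩
      · exact absurd (spiral_mem_Wu_equator h1)
          (Set.disjoint_left.1 (disjoint_limitManifold_node_equator i 0) h)
      · by_cases hij : i = j
        · subst hij
          exact ⟨u, rfl, h1⟩
        · refine absurd (spiral_mem_Wu_saddle h1)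
            (Set.disjoint_left.1 (disjoint_limitManifold_node ?_) h)
          exact fun h => hij (node_inj.1 h).1
      · refine absurd (node_mem_Wu j e)
          (Set.disjoint_left.1 (disjoint_limitManifold_node ?_) h)
        exact fun h => he (node_inj.1 h).2.symm
  · rintro ⟨u, rfl, h⟩
    exact spiral_mem_Wu_saddle h

lemma Wu_sink (i : Fin 2) {e : SignType} (he : e ≠ 0) : Wu X {node i e} = {node i e} := by
  ext p
  constructor
  · intro h
    by_cases hp : p ∈ equator
    · exact absurd (mem_limitManifold_equator hp atBot)
        (Set.disjoint_left.1 (disjoint_limitManifold_node_equator i e) h)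
    · obtain ⟨j, u, v, rfl⟩ := exists_spiral_of_ne_zero p hp
      rcases backward_cases u v with h1 | ⟨rfl, h1⟩ | ⟨e', he', rfl, rfl⟩
      · exact absurd (spiral_mem_Wu_equator h1)
          (Set.disjoint_left.1 (disjoint_limitManifold_node_equator i e) h)
      · refine absurd (spiral_mem_Wu_saddle h1)
          (Set.disjoint_left.1 (disjoint_limitManifold_node ?_) h)
        exact fun h => he (node_inj.1 h).2
      · by_contra hcon
        exact absurd (node_mem_Wu j e')
          (Set.disjoint_left.1 (disjoint_limitManifold_node fun h => hcon h.symm) h)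
  · rintro rfl
    exact node_mem_Wu i e

/-! ### Rest points -/

lemma planeField_eq_zero {u : ℝ} (h : planeField u 0 = 0) : ∃ e : SignType, u = e := by
  rcases le_or_gt (u ^ 2) 4 with h4 | h4
  · rw [planeField_of_le (by linarith)] at h
    have h1 : u * ((1 - u) * (1 + u)) = 0 := by linear_combination h
    rcases mul_eq_zero.1 h1 with h1 | h1
    · exact ⟨0, by simpa using h1⟩
    · rcases mul_eq_zero.1 h1 with h1 | h1
      · exact ⟨1, by simp; linarith⟩
      · exact ⟨-1, by simp; linarith⟩
  · have hc := cutoff_nonneg (height u 0 ^ 2)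
    have h1 : u * (1 + cutoff (height u 0 ^ 2) * (u ^ 2 - 2)) = 0 := by
      rw [planeField] at h
      linear_combination -h
    have h2 : 0 < 1 + cutoff (height u 0 ^ 2) * (u ^ 2 - 2) := by
      have := mul_nonneg hc (by linarith : 0 ≤ u ^ 2 - 2)
      linarith
    have h3 : u = 0 := (mul_eq_zero.1 h1).resolve_right h2.ne'
    exact ⟨0, by simpa using h3⟩

lemma coe_sub_coe_pow_three (e : SignType) : (e : ℝ) - (e : ℝ) ^ 3 = 0 := by
  cases e
  · simp
  · norm_num
  · simp

lemma coe_sq_le_one (e : SignType) : (e : ℝ) ^ 2 ≤ 1 := by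
  cases e <;> simp

lemma isRestPoint_iff {p : S2} : IsRestPoint X p ↔ ∃ i e, p = node i e := by
  rw [IsRestPoint, X_eq_zero_iff]
  constructor
  · intro h
    by_cases hp : (p : E3) 2 = 0
    · rw [spaceField_of_eq_zero hp] at h
      have h0 : -(p : E3) 1 = 0 := congrFun (congrArg WithLp.ofLp h) 0
      have h1 : (p : E3) 0 = 0 := congrFun (congrArg WithLp.ofLp h) 1
      have h2 := sum_sq_S2 p
      rw [hp, h1, neg_eq_zero.1 h0] at h2
      norm_num at h2
    · obtain ⟨i, u, v, rfl⟩ := exists_spiral_of_ne_zero p hp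
      rw [spaceField_spiral] at h
      obtain ⟨h1, h2⟩ := spiralDeriv_eq_zero h
      obtain rfl : v = 0 := neg_eq_zero.1 h2
      obtain ⟨e, rfl⟩ := planeField_eq_zero h1
      exact ⟨i, e, rfl⟩
  · rintro ⟨i, e, rfl⟩
    rw [node, spaceField_spiral, planeField_of_le (by nlinarith [coe_sq_le_one e]),
      coe_sub_coe_pow_three, neg_zero]
    simpa using spiralDeriv_smul i e 0 0 0 0

lemma contDiff_spiral {m : ℕ∞ω} (i : Fin 2) {u v : ℝ → ℝ} (hu : ContDiff ℝ m u)
    (hv : ContDiff ℝ m v) : ContDiff ℝ m (fun s => (spiral i (u s) (v s) : E3)) := by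
  have h0 : ContDiff ℝ m (fun s => 1 + u s ^ 2 + v s ^ 2) := by fun_prop
  have hz : ContDiff ℝ m (fun s => height (u s) (v s)) := by
    unfold height
    refine (h0.sqrt fun s => ?_).inv fun s => ?_ <;> positivity
  have hl : ContDiff ℝ m (fun s => -Real.log (height (u s) (v s))) :=
    (hz.log fun s => (height_pos _ _).ne').neg
  rw [contDiff_euclidean]
  intro k
  fin_cases k
  · exact hz.mul ((hu.mul hl.cos).add (hv.mul hl.sin))
  · exact hz.mul ((hv.mul hl.cos).sub (hu.mul hl.sin))
  · exact contDiff_const.mul hz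

/-- The lines `v = 0` and `u = e` through a rest point are invariant nearby, which gives the
eigenvectors of the linearization. -/
lemma eigenvalues_linearization_node (i : Fin 2) (e : SignType) :
    eigenvalues (linearization X (node i e)) =
      {((1 - 3 * (e : ℝ) ^ 2 : ℝ) : ℂ), ((-1 : ℝ) : ℂ)} := by
  have he := coe_sub_coe_pow_three e
  have he2 := coe_sq_le_one e
  have h1 := linearization_of_invariant_curve (X := X) contMDiff_X
    (c := fun s => spiral i (e + s) 0) (c' := fun s => spiralDeriv i (e + s) 0 1 0)
    (a := fun s => (e + s) - (e + s) ^ 3) (l := 1 - 3 * (e : ℝ) ^ 2)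
    (contDiff_spiral i (by fun_prop) contDiff_const)
    (fun s => hasDerivAt_spiral i ((hasDerivAt_id s).const_add _) (hasDerivAt_const s 0))
    (by
      have h2 : HasDerivAt (fun s : ℝ => (e : ℝ) + s) 1 0 := (hasDerivAt_id (0 : ℝ)).const_add _
      refine (h2.sub (h2.pow 3)).congr_deriv ?_
      simp)
    (by simpa using he)
    (by
      have h2 : Tendsto (fun s : ℝ => ((e : ℝ) + s) ^ 2) (𝓝 0) (𝓝 ((e : ℝ) ^ 2)) := by
        have : Continuous fun s : ℝ => ((e : ℝ) + s) ^ 2 := by fun_prop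
        simpa using this.tendsto 0
      filter_upwards [h2.eventually (gt_mem_nhds (by linarith : (e : ℝ) ^ 2 < 4))] with s hs
      rw [inclDeriv_X, spaceField_spiral, planeField_of_le (by linarith), ← spiralDeriv_smul]
      simp)
  have h2 := linearization_of_invariant_curve (X := X) contMDiff_X
    (c := fun s => spiral i e s) (c' := fun s => spiralDeriv i e s 0 1)
    (a := fun s => -s) (l := -1)
    (contDiff_spiral i contDiff_const contDiff_id)
    (fun s => hasDerivAt_spiral i (hasDerivAt_const s _) (hasDerivAt_id s))
    (hasDerivAt_neg 0) neg_zero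
    (by
      have h2 : Tendsto (fun s : ℝ => s ^ 2) (𝓝 0) (𝓝 0) := by
        have : Continuous fun s : ℝ => s ^ 2 := by fun_prop
        simpa using this.tendsto 0
      filter_upwards [h2.eventually (gt_mem_nhds (by linarith : (0 : ℝ) < 3))] with s hs
      rw [inclDeriv_X, spaceField_spiral, planeField_of_le (by linarith), ← spiralDeriv_smul, he]
      simp)
  rw [add_zero] at h1
  obtain ⟨w₁, hw₁, h1⟩ := h1
  obtain ⟨w₂, hw₂, h2⟩ := h2
  refine eigenvalues_eq_pair _ (v₁ := w₁) (v₂ := w₂) ?_ h1 h2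
  apply linearIndependent_of_inclDeriv (x := spiral i e 0)
  rw [hw₁, hw₂]
  exact linearIndependent_spiralDeriv i e 0

lemma isHyperbolicRestPoint_node (i : Fin 2) (e : SignType) :
    IsHyperbolicRestPoint X (node i e) := by
  refine ⟨isRestPoint_iff.2 ⟨i, e, rfl⟩, fun z hz => ?_⟩
  rw [eigenvalues_linearization_node] at hz
  simp only [Multiset.insert_eq_cons, Multiset.mem_cons, Multiset.mem_singleton] at hz
  rcases hz with rfl | rfl
  · rw [Complex.ofReal_re]
    cases e <;> simp <;> norm_num
  · simp

lemma restIndex_node (i : Fin 2) (e : SignType) :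
    restIndex X (node i e) = if e = 0 then 1 else 0 := by
  rw [restIndex, eigenvalues_linearization_node, Multiset.insert_eq_cons]
  cases e
  · rw [Multiset.filter_cons_of_pos, Multiset.filter_singleton]
    · simp
    · simp
  · rw [Multiset.filter_cons_of_neg, Multiset.filter_singleton]
    · simp
    · norm_num
  · rw [Multiset.filter_cons_of_neg, Multiset.filter_singleton]
    · simp
    · norm_num

/-! ### Closed orbits -/

lemma range_equatorPt : Set.range equatorPt = equator := by
  ext p
  constructor
  · rintro ⟨θ, rfl⟩
    exact equatorPt_mem θ
  · exact exists_equatorPt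

lemma range_flow_equatorPt (θ : ℝ) : Set.range (fun t => flow X t (equatorPt θ)) = equator := by
  simp only [flow_equatorPt]
  rw [← range_equatorPt]
  exact (Equiv.addLeft θ).surjective.range_comp equatorPt

lemma equatorPt_add_two_pi (θ : ℝ) : equatorPt (θ + 2 * Real.pi) = equatorPt θ := by
  apply Subtype.ext
  simp [coe_equatorPt]

lemma isClosedOrbit_equator : IsClosedOrbit X equator := by
  refine ⟨equatorPt 0, fun h => ?_, ⟨2 * Real.pi, Real.two_pi_pos, ?_⟩,
    (range_flow_equatorPt 0).symm⟩
  · obtain ⟨i, e, h⟩ := isRestPoint_iff.1 h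
    have h1 := equatorPt_mem 0
    rw [h] at h1
    exact spiral_notMem_equator i e 0 h1
  · rw [flow_equatorPt, equatorPt_add_two_pi]

lemma isClosedOrbit_iff {γ : Set S2} : IsClosedOrbit X γ ↔ γ = equator := by
  refine ⟨?_, fun h => h ▸ isClosedOrbit_equator⟩
  rintro ⟨x, hx, ⟨T, hT, hTx⟩, rfl⟩
  by_cases hp : x ∈ equator
  · obtain ⟨θ, rfl⟩ := exists_equatorPt hp
    exact range_flow_equatorPt θ
  -- A periodic point off the equator has `v = 0`, as `v` decays, and then `u` is `0`, `1` or `-1`.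
  exfalso
  apply hx
  obtain ⟨i, u, v, rfl⟩ := exists_spiral_of_ne_zero x hp
  have hT1 : 1 < Real.exp T := Real.one_lt_exp_iff.2 hT
  rw [flow_spiral_sol, spiral_inj, sol'_eq, Real.exp_neg] at hTx
  obtain ⟨-, h1, h2⟩ := hTx
  obtain rfl : v = 0 := by
    by_contra hv
    rw [mul_eq_left₀ hv, inv_eq_one] at h2
    linarith
  refine isRestPoint_iff.2 ?_
  rcases lt_or_ge 1 (u ^ 2) with hu | hu
  · have h3 := (isPlaneSol_sol u 0).sq_add_sq_le hT.le
    rw [sol_zero, sol'_zero, h1, sol'_eq, zero_mul] at h3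
    have h4 : 1 < Real.exp (2 * T) := Real.one_lt_exp_iff.2 (by linarith)
    nlinarith
  · have h3 : spiral i (sol u 0 T) (sol' u 0 T) = _ :=
      (flow_spiral_sol i u 0 T).symm.trans (flow_horizontal i hu T)
    rw [spiral_inj, h1] at h3
    have h4 := h3.2.1
    have h5 := one_add_sq_mul_pos hu T
    have h6 := Real.sq_sqrt h5.le
    have h7 := Real.sqrt_pos.2 h5
    rw [eq_div_iff h7.ne'] at h4
    have h8 : u ^ 2 * (1 + u ^ 2 * (Real.exp T ^ 2 - 1)) = u ^ 2 * Real.exp T ^ 2 := by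
      rw [← h6, ← mul_pow, ← mul_pow, h4]
    have h9 : u ^ 2 * (1 - u ^ 2) * (Real.exp T ^ 2 - 1) = 0 := by linear_combination -h8
    have h10 : Real.exp T ^ 2 - 1 ≠ 0 := by nlinarith
    have h11 := (mul_eq_zero.1 h9).resolve_right h10
    obtain ⟨e, rfl⟩ : ∃ e : SignType, u = e := by
      apply planeField_eq_zero
      rw [planeField_of_le (by linarith)]
      rcases mul_eq_zero.1 h11 with h | h
      · rw [pow_eq_zero_iff two_ne_zero] at h
        simp [h]
      · linear_combination u * h
    exact ⟨i, e, rfl⟩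

lemma isCriticalElement_iff {β : Set S2} :
    IsCriticalElement X β ↔ (∃ i e, β = {node i e}) ∨ β = equator := by
  rw [IsCriticalElement, isClosedOrbit_iff]
  refine or_congr ?_ Iff.rfl
  constructor
  · rintro ⟨p, hp, rfl⟩
    obtain ⟨i, e, rfl⟩ := isRestPoint_iff.1 hp
    exact ⟨i, e, rfl⟩
  · rintro ⟨i, e, rfl⟩
    exact ⟨_, isRestPoint_iff.2 ⟨i, e, rfl⟩, rfl⟩

/-! ### Nonwandering points -/

lemma exists_critical_of_nonwandering {x : S2} (hx : IsNonwandering X x) :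
    ∃ β, IsCriticalElement X β ∧ x ∈ β := by
  by_cases hp : x ∈ equator
  · exact ⟨equator, isCriticalElement_iff.2 (Or.inr rfl), hp⟩
  obtain ⟨i, u, v, rfl⟩ := exists_spiral_of_ne_zero x hp
  suffices h : ∃ e, spiral i u v = node i e by
    obtain ⟨e, he⟩ := h
    exact ⟨{node i e}, isCriticalElement_iff.2 (Or.inl ⟨i, e, rfl⟩), he⟩
  by_cases hu : u = 0
  · subst hu
    by_cases hv : v = 0
    · subst hv
      exact ⟨0, by simp [node]⟩
    -- The points near `(0, v)` do not return since the second coordinate decays.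
    exfalso
    let U : Set S2 := {y | ∃ a b, y = spiral i a b ∧ 2 * |v| < 3 * |b| ∧ 3 * |b| < 4 * |v|}
    have hv0 : 0 < |v| := abs_pos.2 hv
    have hU : U ∈ 𝓝 (spiral i 0 v) := by
      apply eventually_of_spiral
      have h1 : Continuous fun q : ℝ × ℝ => 3 * |q.2| := by fun_prop
      have h2 := h1.tendsto (0, v)
      filter_upwards [h2.eventually (lt_mem_nhds (by linarith : 2 * |v| < 3 * |v|)),
        h2.eventually (gt_mem_nhds (by linarith : 3 * |v| < 4 * |v|))] with q h3 h4
      exact ⟨_, _, rfl, h3, h4⟩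
    obtain ⟨t, ht, y, ⟨a, b, rfl, h1, h2⟩, ⟨a', b', h3, h4, h5⟩⟩ := hx U hU (Real.log 2)
    rw [flow_spiral_sol, spiral_inj, sol'_eq] at h3
    have h6 : Real.exp (-t) ≤ 2⁻¹ := by
      rw [Real.exp_neg]
      apply inv_anti₀ two_pos
      exact (Real.log_le_iff_le_exp two_pos).1 ht.le
    have h7 : |b'| ≤ |b| * 2⁻¹ := by
      rw [← h3.2.2, abs_mul, Real.abs_exp]
      exact mul_le_mul_of_nonneg_left h6 (abs_nonneg b)
    linarith
  -- The points near `(u, v)` converge to a sink, uniformly.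
  obtain ⟨e, he, hea⟩ : ∃ e : SignType, (e : ℝ) ^ 2 = 1 ∧ 0 < (e : ℝ) * u := by
    rcases lt_or_gt_of_ne hu with h | h
    · exact ⟨-1, by simp, by simpa using h⟩
    · exact ⟨1, by simp, by simpa using h⟩
  refine ⟨e, ?_⟩
  by_contra hne
  obtain ⟨V, W, hV, hW, hVx, hWx, hd⟩ := t2_separation hne
  have h1 := (tendsto_flow_atTop i (b := v) he hea).eventually (hW.mem_nhds hWx)
  rw [eventually_prod_iff] at h1
  obtain ⟨pa, hpa, pb, hpb, h1⟩ := h1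
  obtain ⟨T, hT⟩ := eventually_atTop.1 hpa
  obtain ⟨t, ht, y, hy, hy'⟩ := hx _ (inter_mem (hV.mem_nhds hVx) hpb) T
  exact Set.disjoint_left.1 hd hy'.1 (h1 (hT t ht.le) hy.2)

/-! ### Transversality -/

lemma mem_Wu_equator_of_lt {y : S2} (hy : (y : E3) 2 ^ 2 < 1 / 2) : y ∈ Wu X equator := by
  by_cases hp : y ∈ equator
  · exact mem_limitManifold_equator hp _
  obtain ⟨i, u, v, rfl⟩ := exists_spiral_of_ne_zero y hp
  apply spiral_mem_Wu_equator
  rw [coe_spiral, spiralVec_two, mul_pow, sgn_sq, one_mul, height_sq, one_div,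
    inv_lt_inv₀ (by positivity) two_pos] at hy
  by_cases hv : v = 0
  · right
    rw [hv] at hy
    linarith
  · exact Or.inl hv

/-- The unstable manifold of the equator is open. -/
lemma limitTangent_equator {x : S2} (hx : x ∈ Wu X equator) :
    limitTangent X atBot equator x = ⊤ := by
  rcases mem_Wu_equator.1 hx with h | ⟨i, u, v, rfl, h⟩
  · refine limitTangent_eq_top ?_ (tendsto_flow_atBot_equator h)
    have h1 : Continuous fun y : S2 => (y : E3) 2 ^ 2 := (continuous_coord 2).pow 2
    have h2 : (x : E3) 2 ^ 2 < 1 / 2 := by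
      have h3 : (x : E3) 2 = 0 := h
      rw [h3]
      norm_num
    filter_upwards [(h1.tendsto x).eventually (gt_mem_nhds h2)] with y hy
    exact mem_Wu_equator_of_lt hy
  · refine limitTangent_eq_top ?_ (tendsto_flow_atBot i h)
    apply eventually_of_spiral
    have h1 : ∀ᶠ q : ℝ × ℝ in 𝓝 (u, v), q.2 ≠ 0 ∨ 1 < q.1 ^ 2 := by
      have h2 : IsOpen {q : ℝ × ℝ | q.2 ≠ 0 ∨ 1 < q.1 ^ 2} :=
        (isOpen_ne_fun continuous_snd continuous_const).union
          (isOpen_lt continuous_const (continuous_fst.pow 2))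
      exact h2.mem_nhds h
    filter_upwards [h1] with q hq
    exact spiral_mem_Wu_equator hq

/-- The stable manifold of a sink is open. -/
lemma limitTangent_sink {i : Fin 2} {e : SignType} (he : e ≠ 0) {x : S2}
    (hx : x ∈ Ws X {node i e}) : limitTangent X atTop {node i e} x = ⊤ := by
  obtain ⟨u, v, rfl, rfl⟩ := mem_Ws_node.1 hx
  have hu : u ≠ 0 := fun h => he (by simp [h])
  have hs : ((SignType.sign u : SignType) : ℝ) ^ 2 = 1 ∧
      0 < ((SignType.sign u : SignType) : ℝ) * u := by
    rcases lt_or_gt_of_ne hu with h | h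
    · rw [sign_neg h]; simpa using h
    · rw [sign_pos h]; simpa using h
  refine limitTangent_eq_top ?_ ?_
  · apply eventually_of_spiral
    have h1 : Continuous fun q : ℝ × ℝ => ((SignType.sign u : SignType) : ℝ) * q.1 := by fun_prop
    filter_upwards [(h1.tendsto (u, v)).eventually (lt_mem_nhds hs.2)] with q hq
    have h2 : SignType.sign q.1 = SignType.sign u := by
      rcases lt_or_gt_of_ne hu with h | h
      · rw [sign_neg h] at hq ⊢
        exact sign_neg (by simpa using hq)
      · rw [sign_pos h] at hq ⊢
        exact sign_pos (by simpa using hq)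
    rw [← h2]
    exact spiral_mem_Ws i q.1 q.2
  · rw [nhdsSet_singleton]
    exact tendsto_flow_atTop i hs.1 hs.2

/-- A curve in a limit manifold of a saddle, in spiral coordinates, gives a tangent vector. -/
lemma mem_limitTangent_saddle {i : Fin 2} {l : Filter ℝ} {u v : ℝ → ℝ} {u' v' : ℝ}
    (hu : ContDiff ℝ 1 u) (hv : ContDiff ℝ 1 v) (hu' : HasDerivAt u u' 0) (hv' : HasDerivAt v v' 0)
    (hu0 : u 0 = 0) (hv0 : v 0 = 0)
    (h₁ : ∀ᶠ s in 𝓝 0, spiral i (u s) (v s) ∈ limitManifold X l {node i 0})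
    (h₂ : Tendsto (fun p : ℝ × ℝ => flow X p.1 (spiral i (u p.2) (v p.2))) (l ×ˢ 𝓝 0)
      (𝓝 (node i 0))) :
    ∃ w : TangentSpace (𝓡 2) (node i 0), inclDeriv (node i 0) w = spiralDeriv i 0 0 u' v' ∧
      w ∈ limitTangent X l {node i 0} (node i 0) := by
  have h3 : ContMDiff 𝓘(ℝ, ℝ) (𝓡 2) 1 (fun s => spiral i (u s) (v s)) :=
    contMDiff_codRestrict (contDiff_spiral i hu hv).contMDiff
  have h4 := hasDerivAt_spiral i hu' hv'
  rw [hu0, hv0] at h4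
  have h5 : spiral i (u 0) (v 0) = node i 0 := by rw [hu0, hv0, node, SignType.coe_zero]
  obtain ⟨w, hw, hw'⟩ := hasVelocity_of_coe ((h3 0).mdifferentiableAt one_ne_zero) h4
  refine ⟨w, (inclDeriv_congr h5 w).symm.trans hw,
    Submodule.subset_span ⟨fun s => spiral i (u s) (v s), h5, hw', h₁, ?_⟩⟩
  rwa [nhdsSet_singleton]

/-- The axis `v = 0` is the unstable manifold of the saddle, near the saddle, and the axis `u = 0`
is its stable manifold. -/
lemma limitTangent_saddle_sup (i : Fin 2) : limitTangent X atBot {node i 0} (node i 0) ⊔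
    limitTangent X atTop {node i 0} (node i 0) = ⊤ := by
  have hn : node i 0 = spiral i 0 0 := by rw [node, SignType.coe_zero]
  have hsq : ∀ᶠ s : ℝ in 𝓝 0, s ^ 2 < 1 := by
    have h2 : Tendsto (fun s : ℝ => s ^ 2) (𝓝 0) (𝓝 0) := by
      have : Continuous fun s : ℝ => s ^ 2 := by fun_prop
      simpa using this.tendsto 0
    exact h2.eventually (gt_mem_nhds one_pos)
  obtain ⟨w₁, hw₁, h1⟩ := mem_limitTangent_saddle (i := i) (l := atBot) (u := fun s => s)
    (v := fun _ => 0) contDiff_id contDiff_const (hasDerivAt_id _) (hasDerivAt_const _ _) rfl rfl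
    (by
      filter_upwards [hsq] with s hs
      exact spiral_mem_Wu_saddle hs)
    (by
      have h3 : Tendsto (fun p : ℝ × ℝ =>
          p.2 * Real.exp p.1 / √(1 + p.2 ^ 2 * (Real.exp p.1 ^ 2 - 1))) (atBot ×ˢ 𝓝 0) (𝓝 0) := by
        have h4 : ContinuousAt (fun q : ℝ × ℝ => q.2 * q.1 / √(1 + q.2 ^ 2 * (q.1 ^ 2 - 1)))
            (0, 0) := by
          refine ContinuousAt.div (by fun_prop) (by fun_prop) ?_
          simp
        have h5 := h4.tendsto.comp (Real.tendsto_exp_atBot.prodMap tendsto_id |>.mono_right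
          nhds_prod_eq.ge)
        simpa [Function.comp_def] using h5
      have h4 := tendsto_spiral i h3 (tendsto_const_nhds (x := (0 : ℝ)))
      rw [hn]
      refine h4.congr' ?_
      have h5 : ∀ᶠ p : ℝ × ℝ in atBot ×ˢ 𝓝 0, p.2 ^ 2 < 1 := tendsto_snd.eventually hsq
      filter_upwards [h5] with p hp
      rw [flow_horizontal i hp.le])
  obtain ⟨w₂, hw₂, h2⟩ := mem_limitTangent_saddle (i := i) (l := atTop) (u := fun _ => 0)
    (v := fun s => s) contDiff_const contDiff_id (hasDerivAt_const _ _) (hasDerivAt_id _) rfl rfl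
    (Eventually.of_forall fun s => by simpa using spiral_mem_Ws i 0 s)
    (by
      simp only [flow_vertical]
      rw [hn]
      refine tendsto_spiral i tendsto_const_nhds ?_
      have h3 := (tendsto_snd (f := (atTop : Filter ℝ)) (g := 𝓝 (0 : ℝ))).mul
        (tendsto_exp_neg_atTop.comp tendsto_fst)
      simpa [Function.comp_def] using h3)
  refine eq_top_of_linearIndependent (v₁ := w₁) (v₂ := w₂) ?_ (Submodule.mem_sup_left h1)
    (Submodule.mem_sup_right h2)
  apply linearIndependent_of_inclDeriv (x := node i 0)
  rw [hw₁, hw₂]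
  exact linearIndependent_spiralDeriv i 0 0

/-- At each point of the intersection, one of the two manifolds is open, or the point is a saddle
and both manifolds belong to it. -/
lemma transverseManifolds {β₁ β₂ : Set S2} (h₁ : IsCriticalElement X β₁)
    (h₂ : IsCriticalElement X β₂) : TransverseManifolds X β₁ β₂ := by
  rintro x ⟨hx₁, hx₂⟩
  rcases isCriticalElement_iff.1 h₁ with ⟨i, e, rfl⟩ | rfl
  swap
  · rw [limitTangent_equator hx₁, top_sup_eq]
  rcases isCriticalElement_iff.1 h₂ with ⟨j, e', rfl⟩ | rfl
  swap
  · rw [Ws_equator] at hx₂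
    exact absurd (mem_limitManifold_equator hx₂ atBot)
      (Set.disjoint_left.1 (disjoint_limitManifold_node_equator i e) hx₁)
  by_cases he' : e' = 0
  swap
  · rw [limitTangent_sink he' hx₂, sup_top_eq]
  subst he'
  obtain ⟨u, v, rfl, hu⟩ := mem_Ws_node.1 hx₂
  rw [sign_eq_zero_iff] at hu
  subst hu
  by_cases he : e = 0
  · subst he
    obtain ⟨u', h, -⟩ := mem_Wu_saddle.1 hx₁
    rw [spiral_inj] at h
    obtain ⟨rfl, -, rfl⟩ := h
    have h3 := limitTangent_saddle_sup j
    rw [node, SignType.coe_zero] at h3 ⊢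
    exact h3
  · rw [Wu_sink i he, Set.mem_singleton_iff, node, spiral_inj] at hx₁
    have h3 := hx₁.2.1
    cases e <;> simp at h3 he

/-! ### The monodromy of the equator -/

lemma planeField_of_ge {u v : ℝ} (h : 10 ≤ u ^ 2 + v ^ 2) : planeField u v = -u := by
  rw [planeField, cutoff_eq_zero, zero_mul, add_zero]
  rw [height_sq, one_div]
  exact inv_anti₀ (by norm_num) (by linarith)

lemma IsPlaneSol.fst_eq_of_ge {u v : ℝ → ℝ} (h : IsPlaneSol u v) (h0 : 10 ≤ u 0 ^ 2 + v 0 ^ 2)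
    {t : ℝ} (ht : t ≤ 0) : u t = u 0 * Real.exp (-t) := by
  have h1 : ∀ s, HasDerivAt (fun s => u s * Real.exp s)
      ((planeField (u s) (v s) + u s) * Real.exp s) s := fun s => by
    refine ((h.left s).mul (Real.hasDerivAt_exp s)).congr_deriv ?_
    ring
  have h2 := constant_of_has_deriv_right_zero (f := fun s => u s * Real.exp s) (a := t) (b := 0)
    (fun s _ => (h1 s).continuousAt.continuousWithinAt) (fun s hs => by
      have h3 := h.le_sq_add_sq hs.2.le
      have h4 : Real.exp (2 * s) ≤ 1 := Real.exp_le_one_iff.2 (by linarith [hs.2])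
      have h5 : 10 ≤ u s ^ 2 + v s ^ 2 := by
        have h6 := Real.exp_pos (2 * s)
        by_contra hcon
        nlinarith
      have h6 := h1 s
      rw [planeField_of_ge h5, neg_add_cancel, zero_mul] at h6
      exact h6.hasDerivWithinAt) 0 ⟨ht, le_rfl⟩
  simp only [Real.exp_zero, mul_one] at h2
  rw [h2, mul_assoc, ← Real.exp_add]
  simp

/-- Near the equator the flow is linear in spiral coordinates. -/
lemma flow_spiral_of_le {T : ℝ} (hT : 0 ≤ T) (i : Fin 2) {u v : ℝ}
    (h : 10 * Real.exp (2 * T) ≤ u ^ 2 + v ^ 2) :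
    flow X T (spiral i u v) = spiral i (u * Real.exp (-T)) (v * Real.exp (-T)) := by
  -- Running backwards from the endpoint, the solution stays where the field is linear.
  set a := u * Real.exp (-T) with ha
  set b := v * Real.exp (-T) with hb
  have hab : 10 ≤ a ^ 2 + b ^ 2 := by
    have h1 : Real.exp (-T) ^ 2 * Real.exp (2 * T) = 1 := by
      rw [← Real.exp_nat_mul, ← Real.exp_add]
      simp
    have h2 : 0 < Real.exp (-T) ^ 2 := by positivity
    have h3 := mul_le_mul_of_nonneg_left h h2.le
    rw [ha, hb]
    linear_combination h3 - 10 * h1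
  have hs := isPlaneSol_sol a b
  have hT1 : Real.exp (-T) * Real.exp T = 1 := by rw [← Real.exp_add]; simp
  have h1 : sol a b (0 - T) = u := by
    rw [zero_sub, hs.fst_eq_of_ge (by rwa [sol_zero, sol'_zero]) (by linarith), sol_zero, neg_neg,
      ha, mul_assoc, hT1, mul_one]
  have h2 : sol' a b (0 - T) = v := by
    rw [zero_sub, sol'_eq, neg_neg, hb, mul_assoc, hT1, mul_one]
  have h3 := flow_spiral i (u := fun t => sol a b (t - T)) (v := fun t => sol' a b (t - T))
    (fun t => (hs.left (t - T)).comp_sub_const t T) (fun t => (hs.right (t - T)).comp_sub_const t T)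
    T
  simp only [h1, h2, sub_self, sol_zero, sol'_zero] at h3
  exact h3

/-- The normalizing factor of `nearFlow`. -/
def nearNorm (T : ℝ) (p : E3) : ℝ := √(Real.exp (-T) ^ 2 + (1 - Real.exp (-T) ^ 2) * p 2 ^ 2)

lemma nearNorm_radicand_pos {T : ℝ} (hT : 0 ≤ T) (p : E3) :
    0 < Real.exp (-T) ^ 2 + (1 - Real.exp (-T) ^ 2) * p 2 ^ 2 := by
  have h1 := Real.exp_pos (-T)
  have h2 : Real.exp (-T) ≤ 1 := Real.exp_le_one_iff.2 (by linarith)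
  have h3 : 0 ≤ (1 - Real.exp (-T) ^ 2) * p 2 ^ 2 :=
    mul_nonneg (by nlinarith) (sq_nonneg _)
  have h4 : 0 < Real.exp (-T) ^ 2 := by positivity
  linarith

lemma nearNorm_pos {T : ℝ} (hT : 0 ≤ T) (p : E3) : 0 < nearNorm T p :=
  Real.sqrt_pos.2 (nearNorm_radicand_pos hT p)

lemma nearNorm_sq {T : ℝ} (hT : 0 ≤ T) (p : E3) :
    nearNorm T p ^ 2 = Real.exp (-T) ^ 2 + (1 - Real.exp (-T) ^ 2) * p 2 ^ 2 :=
  Real.sq_sqrt (nearNorm_radicand_pos hT p).le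

lemma nearNorm_of_eq_zero (T : ℝ) {p : E3} (hp : p 2 = 0) : nearNorm T p = Real.exp (-T) := by
  rw [nearNorm, hp]
  simp [Real.sqrt_sq (Real.exp_pos _).le]

lemma contDiff_nearNorm {T : ℝ} (hT : 0 ≤ T) : ContDiff ℝ ∞ (nearNorm T) := by
  have h1 : ContDiff ℝ ∞ (fun p : E3 =>
      Real.exp (-T) ^ 2 + (1 - Real.exp (-T) ^ 2) * p 2 ^ 2) := by fun_prop
  exact h1.sqrt fun p => (nearNorm_radicand_pos hT p).ne'

/-- The time `T` flow map near the equator, see `flow_eventuallyEq_nearFlow`. -/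
def nearVec (T : ℝ) (p : E3) : E3 :=
  !₂[(nearNorm T p)⁻¹ * (Real.exp (-T) * (p 0 * Real.cos (Real.log (nearNorm T p)) +
      p 1 * Real.sin (Real.log (nearNorm T p)))),
    (nearNorm T p)⁻¹ * (Real.exp (-T) * (p 1 * Real.cos (Real.log (nearNorm T p)) -
      p 0 * Real.sin (Real.log (nearNorm T p)))),
    (nearNorm T p)⁻¹ * p 2]

lemma contDiff_nearVec {T : ℝ} (hT : 0 ≤ T) : ContDiff ℝ ∞ (nearVec T) := by
  have hc : ∀ i : Fin 3, ContDiff ℝ ∞ (fun p : E3 => p i) := fun i => by fun_prop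
  have hN := contDiff_nearNorm hT
  have hN0 : ∀ p, nearNorm T p ≠ 0 := fun p => (nearNorm_pos hT p).ne'
  have hl := hN.log hN0
  rw [contDiff_euclidean]
  intro k
  fin_cases k
  · exact (hN.inv hN0).mul (contDiff_const.mul (((hc 0).mul hl.cos).add ((hc 1).mul hl.sin)))
  · exact (hN.inv hN0).mul (contDiff_const.mul (((hc 1).mul hl.cos).sub ((hc 0).mul hl.sin)))
  · exact (hN.inv hN0).mul (hc 2)

/-- The map `nearVec` on the sphere. -/
def nearFlow (T : ℝ) (hT : 0 ≤ T) (p : S2) : S2 :=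
  ⟨nearVec T p, by
    rw [mem_sphere_zero_iff_norm, ← sq_eq_sq₀ (norm_nonneg _) zero_le_one,
      EuclideanSpace.norm_sq_eq]
    simp only [Fin.sum_univ_three, Real.norm_eq_abs, sq_abs, nearVec, Matrix.cons_val_zero,
      Matrix.cons_val_one, Matrix.cons_val]
    have h1 := nearNorm_sq hT p
    have h2 := Real.sin_sq_add_cos_sq (Real.log (nearNorm T p))
    have h3 := sum_sq_S2 p
    have h4 := mul_inv_cancel₀ (nearNorm_pos hT p).ne'
    generalize Real.cos (Real.log (nearNorm T p)) = c at *
    generalize Real.sin (Real.log (nearNorm T p)) = s at *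
    generalize (nearNorm T p)⁻¹ = m at *
    generalize Real.exp (-T) = x at *
    linear_combination m ^ 2 * x ^ 2 * ((p : E3) 0 ^ 2 + (p : E3) 1 ^ 2) * h2 +
      m ^ 2 * x ^ 2 * h3 - m ^ 2 * h1 + (nearNorm T p * m + 1) * h4⟩

lemma contMDiff_nearFlow {T : ℝ} (hT : 0 ≤ T) : ContMDiff (𝓡 2) (𝓡 2) ∞ (nearFlow T hT) :=
  contMDiff_codRestrict ((contDiff_nearVec hT).contMDiff.comp contMDiff_coe_S2)

lemma nearFlow_equatorPt {T : ℝ} (hT : 0 ≤ T) (θ : ℝ) :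
    nearFlow T hT (equatorPt θ) = equatorPt (θ + T) := by
  have h := mul_inv_cancel₀ (Real.exp_pos (-T)).ne'
  apply Subtype.ext
  change nearVec T (equatorPt θ) = _
  rw [nearVec, nearNorm_of_eq_zero T (equatorPt_mem θ), Real.log_exp, Real.cos_neg, Real.sin_neg,
    ← mul_assoc, ← mul_assoc, mul_comm _ (Real.exp (-T)), h]
  ext k
  fin_cases k
  · simp [coe_equatorPt, Real.cos_add]; ring
  · simp [coe_equatorPt, Real.sin_add]
  · simp [coe_equatorPt]

lemma nearFlow_spiral {T : ℝ} (hT : 0 ≤ T) (i : Fin 2) (u v : ℝ) :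
    nearFlow T hT (spiral i u v) = spiral i (u * Real.exp (-T)) (v * Real.exp (-T)) := by
  have hN := nearNorm_pos hT (spiralVec i u v)
  have hz := height_pos u v
  have h1 : height (u * Real.exp (-T)) (v * Real.exp (-T)) =
      height u v * (nearNorm T (spiralVec i u v))⁻¹ := by
    have h2 := nearNorm_sq hT (spiralVec i u v)
    rw [spiralVec_two, mul_pow, sgn_sq, one_mul] at h2
    rw [← sq_eq_sq₀ (height_pos _ _).le (mul_pos hz (inv_pos.2 hN)).le, mul_pow, inv_pow, h2,
      height_sq, height_sq, ← mul_inv]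
    congr 1
    have h3 : 1 + u ^ 2 + v ^ 2 ≠ 0 := by positivity
    field_simp
    ring
  have h2 : -Real.log (height u v * (nearNorm T (spiralVec i u v))⁻¹) =
      -Real.log (height u v) + Real.log (nearNorm T (spiralVec i u v)) := by
    rw [Real.log_mul hz.ne' (inv_pos.2 hN).ne', Real.log_inv]
    ring
  apply Subtype.ext
  change nearVec T (spiralVec i u v) = spiralVec i _ _
  ext k
  fin_cases k
  · simp [nearVec, spiralVec_zero, spiralVec_one, h1, h2, Real.cos_add, Real.sin_add]; ring
  · simp [nearVec, spiralVec_zero, spiralVec_one, h1, h2, Real.cos_add, Real.sin_add]; ring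
  · simp [nearVec, spiralVec_two, h1]; ring

/-- The linear flow in spiral coordinates near infinity, written as a map of the sphere, extends
smoothly over the equator. -/
lemma flow_eventuallyEq_nearFlow {T : ℝ} (hT : 0 ≤ T) {x : S2} (hx : x ∈ equator) :
    flow X T =ᶠ[𝓝 x] nearFlow T hT := by
  have h1 : Continuous fun y : S2 => (y : E3) 2 ^ 2 := (continuous_coord 2).pow 2
  have h2 : (x : E3) 2 ^ 2 < (1 + 10 * Real.exp (2 * T))⁻¹ := by
    have h3 : (x : E3) 2 = 0 := hx
    rw [h3, zero_pow two_ne_zero]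
    positivity
  filter_upwards [(h1.tendsto x).eventually (gt_mem_nhds h2)] with y hy
  by_cases hp : y ∈ equator
  · obtain ⟨θ, rfl⟩ := exists_equatorPt hp
    rw [flow_equatorPt, nearFlow_equatorPt]
  · obtain ⟨i, u, v, rfl⟩ := exists_spiral_of_ne_zero y hp
    rw [coe_spiral, spiralVec_two, mul_pow, sgn_sq, one_mul, height_sq,
      inv_lt_inv₀ (by positivity) (by positivity)] at hy
    rw [flow_spiral_of_le hT i (by linarith), nearFlow_spiral]

lemma equatorPt_eq_iff {θ t : ℝ} : equatorPt (θ + t) = equatorPt θ ↔ Real.cos t = 1 := by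
  constructor
  · intro h
    have h0 : Real.cos (θ + t) = Real.cos θ :=
      congrArg (fun p : S2 => (p : E3) 0) h
    have h1 : Real.sin (θ + t) = Real.sin θ :=
      congrArg (fun p : S2 => (p : E3) 1) h
    have h2 : Real.cos (θ + t - θ) = 1 := by
      rw [Real.cos_sub, h0, h1, ← sq, ← sq, Real.cos_sq_add_sin_sq]
    rwa [add_sub_cancel_left] at h2
  · intro h
    obtain ⟨n, rfl⟩ := (Real.cos_eq_one_iff t).1 h
    apply Subtype.ext
    rw [coe_equatorPt, coe_equatorPt, Real.cos_add_int_mul_two_pi, Real.sin_add_int_mul_two_pi]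

lemma period_equatorPt (θ : ℝ) : period X (equatorPt θ) = 2 * Real.pi := by
  refine IsLeast.csInf_eq ⟨⟨Real.two_pi_pos, ?_⟩, ?_⟩
  · rw [flow_equatorPt, equatorPt_add_two_pi]
  · rintro T ⟨hT, h⟩
    rw [flow_equatorPt, equatorPt_eq_iff, Real.cos_eq_one_iff] at h
    obtain ⟨n, rfl⟩ := h
    have hn : (0 : ℝ) < n := pos_of_mul_pos_left hT Real.two_pi_pos.le
    have hn1 : (1 : ℝ) ≤ n := by exact_mod_cast Int.cast_pos.1 hn
    nlinarith [Real.two_pi_pos]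

/-- The meridian through the point of the equator with longitude `θ`. -/
def meridian (θ s : ℝ) : S2 :=
  ⟨!₂[Real.cos s * Real.cos θ, Real.cos s * Real.sin θ, Real.sin s], by
    rw [mem_sphere_zero_iff_norm, ← sq_eq_sq₀ (norm_nonneg _) zero_le_one,
      EuclideanSpace.norm_sq_eq]
    simp only [Fin.sum_univ_three, Real.norm_eq_abs, sq_abs, Matrix.cons_val_zero,
      Matrix.cons_val_one, Matrix.cons_val]
    linear_combination Real.cos s ^ 2 * Real.sin_sq_add_cos_sq θ + Real.sin_sq_add_cos_sq s⟩

lemma coe_meridian (θ s : ℝ) : (meridian θ s : E3) =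
    !₂[Real.cos s * Real.cos θ, Real.cos s * Real.sin θ, Real.sin s] := rfl

lemma meridian_zero (θ : ℝ) : meridian θ 0 = equatorPt θ := by
  apply Subtype.ext
  simp [coe_meridian, coe_equatorPt]

lemma hasDerivAt_meridian (θ : ℝ) : HasDerivAt (fun s => (meridian θ s : E3)) !₂[0, 0, 1] 0 := by
  have hc := Real.hasDerivAt_cos 0
  rw [Real.sin_zero, neg_zero] at hc
  have hs := Real.hasDerivAt_sin 0
  rw [Real.cos_zero] at hs
  refine hasDerivAt_E3 fun k => ?_
  fin_cases k
  · simpa [coe_meridian] using hc.mul_const (Real.cos θ)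
  · simpa [coe_meridian] using hc.mul_const (Real.sin θ)
  · simpa [coe_meridian] using hs

lemma contMDiff_meridian (θ : ℝ) : ContMDiff 𝓘(ℝ, ℝ) (𝓡 2) 1 (meridian θ) := by
  refine contMDiff_codRestrict (ContDiff.contMDiff ?_)
  rw [contDiff_euclidean]
  intro k
  fin_cases k
  · exact Real.contDiff_cos.mul contDiff_const
  · exact Real.contDiff_cos.mul contDiff_const
  · exact Real.contDiff_sin

lemma contMDiff_equatorPt : ContMDiff 𝓘(ℝ, ℝ) (𝓡 2) 1 equatorPt := by
  refine contMDiff_codRestrict (ContDiff.contMDiff ?_)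
  rw [contDiff_euclidean]
  intro k
  fin_cases k
  · exact Real.contDiff_cos
  · exact Real.contDiff_sin
  · exact contDiff_const

/-- The normalizing factor is even along the meridian, so it does not contribute to the
derivative. -/
lemma hasDerivAt_nearFlow_meridian {T : ℝ} (hT : 0 ≤ T) (θ : ℝ) :
    HasDerivAt (fun s => (nearFlow T hT (meridian θ s) : E3))
      (Real.exp T • (!₂[0, 0, 1] : E3)) 0 := by
  have hc := Real.hasDerivAt_cos 0
  rw [Real.sin_zero, neg_zero] at hc
  have hs := Real.hasDerivAt_sin 0
  rw [Real.cos_zero] at hs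
  let N : ℝ → ℝ := fun s => nearNorm T (meridian θ s)
  have hN0 : N 0 = Real.exp (-T) := by
    change nearNorm T (meridian θ 0) = _
    rw [meridian_zero, nearNorm_of_eq_zero T (equatorPt_mem θ)]
  have hN : HasDerivAt N 0 0 := by
    have h1 : HasDerivAt (fun s => Real.exp (-T) ^ 2 + (1 - Real.exp (-T) ^ 2) * Real.sin s ^ 2)
        0 0 := by
      refine (((hs.pow 2).const_mul (1 - Real.exp (-T) ^ 2)).const_add
        (Real.exp (-T) ^ 2)).congr_deriv ?_
      simp
    refine (h1.sqrt (by simp)).congr_deriv ?_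
    simp
  have hNne : N 0 ≠ 0 := by rw [hN0]; exact (Real.exp_pos _).ne'
  have hl : HasDerivAt (fun s => Real.log (N s)) 0 0 := (hN.log hNne).congr_deriv (by simp)
  have hi : HasDerivAt (fun s => (N s)⁻¹) 0 0 := (hN.inv hNne).congr_deriv (by simp)
  refine hasDerivAt_E3 fun k => ?_
  fin_cases k
  · refine (hi.mul ((((hc.mul_const (Real.cos θ)).mul hl.cos).add
      ((hc.mul_const (Real.sin θ)).mul hl.sin)).const_mul (Real.exp (-T)))).congr_deriv ?_
    simp
  · refine (hi.mul ((((hc.mul_const (Real.sin θ)).mul hl.cos).sub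
      ((hc.mul_const (Real.cos θ)).mul hl.sin)).const_mul (Real.exp (-T)))).congr_deriv ?_
    simp
  · refine (hi.mul hs).congr_deriv ?_
    rw [hN0, Real.exp_neg]
    simp

/-- The eigenvectors of the monodromy are the directions of the equator and of the meridian. -/
lemma eigenvalues_monodromy {x : S2} (hx : x ∈ equator) :
    eigenvalues (monodromy X x) = {((1 : ℝ) : ℂ), ((Real.exp (2 * Real.pi) : ℝ) : ℂ)} := by
  obtain ⟨θ, rfl⟩ := exists_equatorPt hx
  set T := 2 * Real.pi with hTdef
  have hT : 0 ≤ T := Real.two_pi_pos.le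
  have hG := flow_eventuallyEq_nearFlow hT hx
  have hf : MDifferentiableAt (𝓡 2) (𝓡 2) (flow X T) (equatorPt θ) :=
    ((contMDiff_nearFlow hT _).mdifferentiableAt (by simp)).congr_of_eventuallyEq hG
  have hfx : flow X T (equatorPt θ) = equatorPt θ := by
    rw [flow_equatorPt, equatorPt_add_two_pi]
  have he : HasDerivAt (fun s => (equatorPt (θ + s) : E3)) !₂[-Real.sin θ, Real.cos θ, 0] 0 := by
    have h1 := hasDerivAt_equatorPt (θ + 0)
    rw [add_zero] at h1
    exact HasDerivAt.comp_const_add θ 0 (by rwa [add_zero])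
  have hadd : ContMDiff 𝓘(ℝ, ℝ) 𝓘(ℝ, ℝ) 1 (fun s : ℝ => θ + s) :=
    (contDiff_const.add contDiff_id).contMDiff
  obtain ⟨v₁, hv₁, h1⟩ := mfderiv_of_curve (c := fun s => equatorPt (θ + s)) (l := 1) hf hfx
    (by simp) ((contMDiff_equatorPt.comp hadd 0).mdifferentiableAt one_ne_zero) he (by
      simp only [flow_equatorPt, hTdef, equatorPt_add_two_pi, one_smul]
      exact he)
  have hm : Tendsto (meridian θ) (𝓝 0) (𝓝 (equatorPt θ)) := by
    have h2 := (contMDiff_meridian θ).continuous.tendsto 0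
    rwa [meridian_zero] at h2
  obtain ⟨v₂, hv₂, h2⟩ := mfderiv_of_curve (c := meridian θ) (l := Real.exp T) hf hfx
    (meridian_zero θ) ((contMDiff_meridian θ 0).mdifferentiableAt one_ne_zero)
    (hasDerivAt_meridian θ) (by
      refine (hasDerivAt_nearFlow_meridian hT θ).congr_of_eventuallyEq ?_
      filter_upwards [hm.eventually hG] with s hs
      rw [hs])
  have hM : monodromy X (equatorPt θ) =
      (mfderiv (𝓡 2) (𝓡 2) (flow X T) (equatorPt θ) : E2 →L[ℝ] E2).toLinearMap := by
    rw [hTdef, ← period_equatorPt θ]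
    rfl
  rw [hM]
  refine eigenvalues_eq_pair _ (v₁ := v₁) (v₂ := v₂) ?_ h1 h2
  apply linearIndependent_of_inclDeriv (x := equatorPt θ)
  rw [hv₁, hv₂, LinearIndependent.pair_iff]
  intro a b hab
  have h0 := congrFun (congrArg WithLp.ofLp hab) 0
  have h1 := congrFun (congrArg WithLp.ofLp hab) 1
  have h2 := congrFun (congrArg WithLp.ofLp hab) 2
  simp at h0 h1 h2
  refine ⟨?_, h2⟩
  have h3 := Real.sin_sq_add_cos_sq θ
  rcases h0 with h0 | h0
  · exact h0
  · rcases h1 with h1 | h1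
    · exact h1
    · rw [h0, h1] at h3
      norm_num at h3

lemma one_lt_exp_two_pi : 1 < Real.exp (2 * Real.pi) := Real.one_lt_exp_iff.2 Real.two_pi_pos

lemma isHyperbolicClosedOrbit_equator : IsHyperbolicClosedOrbit X equator := by
  refine ⟨isClosedOrbit_equator, fun x hx => ?_⟩
  rw [eigenvalues_monodromy hx, Multiset.insert_eq_cons, Multiset.filter_cons_of_pos,
    Multiset.filter_singleton, if_neg]
  · simp
  · rw [Complex.norm_real, Real.norm_eq_abs, Real.abs_exp]
    exact one_lt_exp_two_pi.ne'
  · simp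

lemma hasOrbitIndex_equator : HasOrbitIndex X equator 1 := by
  intro x hx
  rw [eigenvalues_monodromy hx, Multiset.insert_eq_cons, Multiset.filter_cons_of_neg,
    Multiset.filter_singleton, if_pos]
  · simp
  · rw [Complex.norm_real, Real.norm_eq_abs, Real.abs_exp]
    exact one_lt_exp_two_pi
  · simp

theorem isMorseSmale_X : IsMorseSmale X where
  smooth := contMDiff_X
  finite_rest := by
    have h : {p : S2 | IsRestPoint X p} = Set.range fun q : Fin 2 × SignType => node q.1 q.2 := by
      ext p
      rw [Set.mem_ofPred_eq, isRestPoint_iff]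
      constructor
      · rintro ⟨i, e, rfl⟩
        exact ⟨(i, e), rfl⟩
      · rintro ⟨⟨i, e⟩, rfl⟩
        exact ⟨i, e, rfl⟩
    rw [h]
    exact Set.finite_range _
  finite_orbits := by
    simp only [isClosedOrbit_iff, Set.ofPred_eq_eq_singleton]
    exact Set.finite_singleton _
  hyperbolic_rest p hp := by
    obtain ⟨i, e, rfl⟩ := isRestPoint_iff.1 hp
    exact isHyperbolicRestPoint_node i e
  hyperbolic_orbits γ hγ := by
    rw [isClosedOrbit_iff.1 hγ]
    exact isHyperbolicClosedOrbit_equator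
  nonwandering _ := exists_critical_of_nonwandering
  transverse _ _ := transverseManifolds

/-! ### Connected components of the sets of connecting orbits -/

lemma natCard_components_of_isConnected {α : Type*} [TopologicalSpace α] {S : Set α}
    (hS : IsConnected S) : Nat.card (ConnectedComponents S) = 1 := by
  have := isConnected_iff_connectedSpace.1 hS
  exact Nat.card_unique

/-- Two connected sets that are separated by open sets are the components of their union. -/
lemma natCard_components_union {α : Type*} [TopologicalSpace α] {A B U V : Set α}
    (hA : IsConnected A) (hB : IsConnected B) (hU : IsOpen U) (hV : IsOpen V) (hAU : A ⊆ U)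
    (hBV : B ⊆ V) (hd : Disjoint U V) :
    Nat.card (ConnectedComponents ↥(A ∪ B)) = 2 := by
  let W : Bool → Set ↥(A ∪ B) := fun b => Subtype.val ⁻¹' (bif b then U else V)
  have hW : ∀ b, IsOpen (W b) := by
    rintro (_ | _)
    · exact hV.preimage continuous_subtype_val
    · exact hU.preimage continuous_subtype_val
  have hcompl : ∀ b, (W b)ᶜ = W (!b) := by
    rintro (_ | _) <;> ext ⟨p, hp | hp⟩
    · simpa [W, hAU hp] using Set.disjoint_left.1 hd (hAU hp)
    · simpa [W, hBV hp] using Set.disjoint_right.1 hd (hBV hp)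
    · simpa [W, hAU hp] using Set.disjoint_left.1 hd (hAU hp)
    · simpa [W, hBV hp] using Set.disjoint_right.1 hd (hBV hp)
  have hconn : ∀ b, IsConnected (W b) := by
    have himage : ∀ b, Subtype.val '' W b = bif b then A else B := by
      rintro (_ | _)
      · rw [Subtype.image_preimage_coe]
        ext p
        constructor
        · rintro ⟨hp | hp, h⟩
          · exact absurd h (Set.disjoint_left.1 hd (hAU hp))
          · exact hp
        · exact fun hp => ⟨Or.inr hp, hBV hp⟩
      · rw [Subtype.image_preimage_coe]
        ext p
        constructor
        · rintro ⟨hp | hp, h⟩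
          · exact hp
          · exact absurd h (Set.disjoint_right.1 hd (hBV hp))
        · exact fun hp => ⟨Or.inl hp, hAU hp⟩
    intro b
    have h1 : IsConnected (Subtype.val '' W b) := by
      rw [himage]
      cases b
      · exact hB
      · exact hA
    exact ⟨h1.nonempty.of_image, Topology.IsInducing.subtypeVal.isPreconnected_image.1 h1.2⟩
  have e : ConnectedComponents ↥(A ∪ B) ≃ Bool :=
    ConnectedComponents.equivOfIsClopenOfIsConnected (U := W)
      (fun b => ⟨⟨by rw [hcompl]; exact hW _⟩, hW b⟩)
      (by
        rintro (_ | _) (_ | _) h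
        · exact absurd rfl h
        · exact (hd.preimage _).symm
        · exact hd.preimage _
        · exact absurd rfl h)
      (by
        ext p
        simp only [Set.mem_iUnion, Set.mem_univ, iff_true]
        rcases p.2 with hp | hp
        · exact ⟨true, hAU hp⟩
        · exact ⟨false, hBV hp⟩)
      hconn
  rw [Nat.card_congr e]
  simp

lemma isConnected_equator : IsConnected equator := by
  rw [← range_equatorPt]
  exact isConnected_range contMDiff_equatorPt.continuous

lemma equator_inter_equator : Wu X equator ∩ Ws X equator = equator := by
  rw [Ws_equator]
  exact Set.inter_eq_right.2 fun p hp => mem_limitManifold_equator hp _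

lemma node_inter_equator (i : Fin 2) (e : SignType) :
    Wu X {node i e} ∩ Ws X equator = ∅ := by
  rw [Ws_equator, ← Set.disjoint_iff_inter_eq_empty]
  exact (disjoint_limitManifold_node_equator i e).mono_right
    fun p hp => mem_limitManifold_equator hp _

lemma equator_inter_node (i : Fin 2) (e : SignType) : Wu X equator ∩ Ws X {node i e} =
    (fun q : ℝ × ℝ => spiral i q.1 q.2) ''
      {q | SignType.sign q.1 = e ∧ (q.2 ≠ 0 ∨ 1 < q.1 ^ 2)} := by
  ext p
  constructor
  · rintro ⟨h1, h2⟩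
    obtain ⟨u, v, rfl, hu⟩ := mem_Ws_node.1 h2
    rcases mem_Wu_equator.1 h1 with h | ⟨j, u', v', h, h'⟩
    · exact absurd h (spiral_notMem_equator i u v)
    · obtain ⟨rfl, rfl, rfl⟩ := spiral_inj.1 h
      exact ⟨(u, v), ⟨hu, h'⟩, rfl⟩
  · rintro ⟨⟨u, v⟩, ⟨h1, h2⟩, rfl⟩
    exact ⟨spiral_mem_Wu_equator h2, mem_Ws_node.2 ⟨u, v, rfl, h1⟩⟩

lemma saddle_inter_node (i : Fin 2) (e : SignType) : Wu X {node i 0} ∩ Ws X {node i e} =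
    (fun u : ℝ => spiral i u 0) '' {u | u ∈ Set.Ioo (-1) 1 ∧ SignType.sign u = e} := by
  have habs : ∀ u : ℝ, u ∈ Set.Ioo (-1 : ℝ) 1 ↔ u ^ 2 < 1 := fun u => by
    rw [sq_lt_one_iff_abs_lt_one, abs_lt, Set.mem_Ioo]
  ext p
  constructor
  · rintro ⟨h1, h2⟩
    obtain ⟨u, v, rfl, hu⟩ := mem_Ws_node.1 h2
    obtain ⟨u', h, h'⟩ := mem_Wu_saddle.1 h1
    obtain ⟨-, rfl, rfl⟩ := spiral_inj.1 h
    exact ⟨u, ⟨(habs u).2 h', hu⟩, rfl⟩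
  · rintro ⟨u, ⟨h1, h2⟩, rfl⟩
    exact ⟨spiral_mem_Wu_saddle ((habs u).1 h1), mem_Ws_node.2 ⟨u, 0, rfl, h2⟩⟩

lemma saddle_inter_node_of_ne {i j : Fin 2} (hij : i ≠ j) (e : SignType) :
    Wu X {node i 0} ∩ Ws X {node j e} = ∅ := by
  rw [Set.eq_empty_iff_forall_notMem]
  rintro p ⟨h1, h2⟩
  obtain ⟨u, v, rfl, -⟩ := mem_Ws_node.1 h2
  obtain ⟨u', h, -⟩ := mem_Wu_saddle.1 h1
  exact hij (spiral_inj.1 h).1.symm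

/-- The stable manifold of a sink, with the segment that comes from the saddle removed, consists of
two quadrants and a half plane which meets both. -/
lemma isConnected_equator_inter_sink (i : Fin 2) {e : SignType} (he : e ≠ 0) :
    IsConnected (Wu X equator ∩ Ws X {node i e}) := by
  rw [equator_inter_node]
  refine IsConnected.image ?_ _ (continuous_spiral i).continuousOn
  have he1 : (e : ℝ) * e = 1 := by cases e <;> simp at he ⊢
  have hsign : ∀ u : ℝ, SignType.sign u = e ↔ 0 < (e : ℝ) * u := by
    intro u
    cases e
    · exact absurd rfl he
    · simpa using sign_eq_neg_one_iff
    · simpa using sign_eq_one_iff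
  have h1 : IsLinearMap ℝ fun q : ℝ × ℝ => (e : ℝ) * q.1 :=
    ⟨fun x y => by simp [mul_add], fun c x => by simp; ring⟩
  have h2 : IsLinearMap ℝ fun q : ℝ × ℝ => q.2 := ⟨fun x y => rfl, fun c x => rfl⟩
  let A : Set (ℝ × ℝ) := {q | 0 < (e : ℝ) * q.1 ∧ 0 < q.2}
  let B : Set (ℝ × ℝ) := {q | 0 < (e : ℝ) * q.1 ∧ q.2 < 0}
  let C : Set (ℝ × ℝ) := {q | 1 < (e : ℝ) * q.1}
  have hA : IsPreconnected A :=
    ((convex_halfSpace_gt h1 0).inter (convex_halfSpace_gt h2 0)).isPreconnected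
  have hB : IsPreconnected B :=
    ((convex_halfSpace_gt h1 0).inter (convex_halfSpace_lt h2 0)).isPreconnected
  have hC : IsPreconnected C := (convex_halfSpace_gt h1 1).isPreconnected
  have h2e : (e : ℝ) * (e * 2) = 2 := by rw [← mul_assoc, he1, one_mul]
  have hpos : 0 < (e : ℝ) * (e * 2) := by rw [h2e]; exact two_pos
  have hone : 1 < (e : ℝ) * (e * 2) := by rw [h2e]; exact one_lt_two
  have hxA : ((e : ℝ) * 2, (1 : ℝ)) ∈ A := ⟨hpos, one_pos⟩
  have hyB : ((e : ℝ) * 2, (-1 : ℝ)) ∈ B := ⟨hpos, neg_one_lt_zero⟩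
  have hxC : ((e : ℝ) * 2, (1 : ℝ)) ∈ C := hone
  have hyC : ((e : ℝ) * 2, (-1 : ℝ)) ∈ C := hone
  have hAC : IsPreconnected (A ∪ C) := IsPreconnected.union ((e : ℝ) * 2, (1 : ℝ)) hxA hxC hA hC
  have hACB : IsPreconnected (A ∪ C ∪ B) :=
    IsPreconnected.union ((e : ℝ) * 2, (-1 : ℝ)) (Or.inr hyC) hyB hAC hB
  refine ⟨⟨((e : ℝ) * 2, 1), (hsign _).2 hpos, Or.inl one_ne_zero⟩, ?_⟩
  convert hACB using 1
  ext ⟨u, v⟩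
  have hu : u ^ 2 = (e * u) ^ 2 := by rw [mul_pow, sq (e : ℝ), he1, one_mul]
  simp only [A, B, C, Set.mem_ofPred_eq, Set.mem_union, hsign, hu]
  constructor
  · rintro ⟨h3, h4 | h4⟩
    · rcases lt_or_gt_of_ne h4 with h4 | h4
      · exact Or.inr ⟨h3, h4⟩
      · exact Or.inl (Or.inl ⟨h3, h4⟩)
    · exact Or.inl (Or.inr (by nlinarith))
  · rintro ((⟨h3, h4⟩ | h3) | ⟨h3, h4⟩)
    · exact ⟨h3, Or.inl h4.ne'⟩
    · exact ⟨by linarith, Or.inr (by nlinarith)⟩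
    · exact ⟨h3, Or.inl h4.ne⟩

/-- The stable manifold of a saddle, without the saddle, is two flow lines from the equator. -/
lemma natCard_equator_inter_saddle (i : Fin 2) :
    Nat.card (ConnectedComponents ↥(Wu X equator ∩ Ws X {node i 0})) = 2 := by
  have hc : Continuous fun v : ℝ => spiral i 0 v :=
    (continuous_spiral i).comp (continuous_const.prodMk continuous_id)
  have h : Wu X equator ∩ Ws X {node i 0} =
      (fun v : ℝ => spiral i 0 v) '' Set.Ioi 0 ∪ (fun v : ℝ => spiral i 0 v) '' Set.Iio 0 := by
    rw [equator_inter_node, ← Set.image_union]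
    ext p
    constructor
    · rintro ⟨⟨u, v⟩, ⟨h1, h2⟩, rfl⟩
      obtain rfl : u = 0 := sign_eq_zero_iff.1 h1
      refine ⟨v, ?_, rfl⟩
      rcases h2 with h2 | h2
      · exact (lt_or_gt_of_ne h2).symm
      · norm_num at h2
    · rintro ⟨v, hv, rfl⟩
      exact ⟨(0, v), ⟨sign_zero, Or.inl (hv.elim (fun h => ne_of_gt h) (fun h => ne_of_lt h))⟩,
        rfl⟩
  have hopen : ∀ s : Set ℝ, IsOpen s → IsOpen {p | ∃ a b, spiral i a b = p ∧ b ∈ s} := by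
    intro s hs
    rw [isOpen_iff_mem_nhds]
    rintro _ ⟨a, b, rfl, hb⟩
    apply eventually_of_spiral
    filter_upwards [(continuous_snd.tendsto (a, b)).eventually (hs.mem_nhds hb)] with q hq
    exact ⟨_, _, rfl, hq⟩
  rw [h]
  refine natCard_components_union (isConnected_Ioi.image _ hc.continuousOn)
    (isConnected_Iio.image _ hc.continuousOn) (hopen (Set.Ioi 0) isOpen_Ioi)
    (hopen (Set.Iio 0) isOpen_Iio) ?_ ?_ ?_
  · rintro _ ⟨v, hv, rfl⟩
    exact ⟨0, v, rfl, hv⟩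
  · rintro _ ⟨v, hv, rfl⟩
    exact ⟨0, v, rfl, hv⟩
  · rw [Set.disjoint_left]
    rintro _ ⟨a, b, rfl, hb⟩ ⟨a', b', h', hb'⟩
    rw [(spiral_inj.1 h').2.2] at hb'
    exact lt_asymm (Set.mem_Ioi.1 hb) hb'

lemma isConnected_saddle_inter_node (i : Fin 2) (e : SignType) :
    IsConnected (Wu X {node i 0} ∩ Ws X {node i e}) := by
  rw [saddle_inter_node]
  have hc : Continuous fun u : ℝ => spiral i u 0 :=
    (continuous_spiral i).comp (continuous_id.prodMk continuous_const)
  refine IsConnected.image ⟨?_, ?_⟩ _ hc.continuousOn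
  · refine ⟨(e : ℝ) / 2, ⟨?_, ?_⟩, ?_⟩
    · cases e <;> norm_num
    · cases e <;> norm_num
    · cases e
      · simp
      · exact sign_neg (by norm_num)
      · exact sign_pos (by norm_num)
  · refine Set.OrdConnected.isPreconnected ?_
    have h : {u : ℝ | SignType.sign u = e}.OrdConnected := by
      exact (Set.ordConnected_singleton (a := e)).preimage_mono
        (f := (SignType.sign : ℝ → SignType)) SignType.sign.monotone
    exact Set.ordConnected_Ioo.inter h

lemma finite_components {β₁ β₂ : Set S2} (h₁ : IsCriticalElement X β₁)
    (h₂ : IsCriticalElement X β₂) : Finite (ConnectedComponents ↥(Wu X β₁ ∩ Ws X β₂)) := by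
  have hfin : ∀ S : Set S2, S.Finite → Finite (ConnectedComponents S) := fun S hS => by
    have := hS.to_subtype
    exact Finite.of_surjective _ ConnectedComponents.surjective_coe
  have hconn : ∀ S : Set S2, IsConnected S → Finite (ConnectedComponents S) := fun S hS => by
    have := isConnected_iff_connectedSpace.1 hS
    infer_instance
  rcases isCriticalElement_iff.1 h₁ with ⟨i, e, rfl⟩ | rfl <;>
    rcases isCriticalElement_iff.1 h₂ with ⟨j, e', rfl⟩ | rfl
  · by_cases he : e = 0
    · subst he
      by_cases hij : i = j
      · subst hij
        exact hconn _ (isConnected_saddle_inter_node i e')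
      · rw [saddle_inter_node_of_ne hij]
        exact hfin _ Set.finite_empty
    · rw [Wu_sink i he]
      exact hfin _ ((Set.finite_singleton _).inter_of_left _)
  · rw [node_inter_equator]
    exact hfin _ Set.finite_empty
  · by_cases he : e' = 0
    · subst he
      exact Nat.finite_of_card_ne_zero (by rw [natCard_equator_inter_saddle]; exact two_ne_zero)
    · exact hconn _ (isConnected_equator_inter_sink j he)
  · rw [equator_inter_equator]
    exact hconn _ isConnected_equator

lemma alpha_equator_sink (i : Fin 2) {e : SignType} (he : e ≠ 0) :
    alpha X equator {node i e} = 1 := by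
  rw [alpha, natCard_components_of_isConnected (isConnected_equator_inter_sink i he), Nat.cast_one]

lemma alpha_equator_saddle (i : Fin 2) : alpha X equator {node i 0} = 0 := by
  rw [alpha, natCard_equator_inter_saddle]
  rfl

lemma alpha_saddle_node (i j : Fin 2) (e : SignType) :
    alpha X {node i 0} {node j e} = if i = j then 1 else 0 := by
  split_ifs with h
  · subst h
    rw [alpha, natCard_components_of_isConnected (isConnected_saddle_inter_node i e), Nat.cast_one]
  · rw [alpha, saddle_inter_node_of_ne h]
    have : IsEmpty (ConnectedComponents ↥(∅ : Set S2)) :=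
      ConnectedComponents.isEmpty_iff_isEmpty.2 inferInstance
    rw [Nat.card_of_isEmpty, Nat.cast_zero]

/-! ### The Eidi–Jost complex -/

/-- The entries of the matrix of the differential are the incidence numbers. -/
lemma toMatrix_boundary {X : (x : S2) → TangentSpace (𝓡 2) x} {k m m' : ℕ}
    (e : Fin m ≃ Generator X (k + 1)) (e' : Fin m' ≃ Generator X k) (i : Fin m') (j : Fin m) :
    LinearMap.toMatrix (chainBasis e) (chainBasis e') (boundary X (k + 1) k) i j =
      incidence X (e j) (e' i) := by
  have : Fintype (Generator X k) := Fintype.ofEquiv _ e'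
  classical
  rw [LinearMap.toMatrix_apply, boundary, if_pos rfl]
  simp [Finsupp.linearCombination_single, finsum_eq_sum_of_fintype, Finsupp.single_apply,
    Equiv.symm_apply_eq]

/-- The sinks. -/
def sink (j : Fin 4) : S2 := node (![0, 0, 1, 1] j) (![1, -1, 1, -1] j)

lemma sink_injective : Function.Injective sink := by
  intro j k h
  rw [sink, sink, node_inj] at h
  revert h
  revert j k
  decide

lemma sink_sign_ne_zero (j : Fin 4) : (![1, -1, 1, -1] j : SignType) ≠ 0 := by
  revert j
  decide

lemma exists_sink (i : Fin 2) {e : SignType} (he : e ≠ 0) : ∃ j, node i e = sink j := by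
  simp only [sink, node_inj]
  revert i e
  decide

lemma isRestPoint_node (i : Fin 2) (e : SignType) : IsRestPoint X (node i e) :=
  isRestPoint_iff.2 ⟨i, e, rfl⟩

lemma restIndex_saddle (i : Fin 2) : restIndex X (node i 0) = 1 := by
  rw [restIndex_node, if_pos rfl]

lemma restIndex_sink (j : Fin 4) : restIndex X (sink j) = 0 := by
  rw [sink, restIndex_node, if_neg (sink_sign_ne_zero j)]

lemma hasOrbitIndex_equator_iff {k : ℕ} : HasOrbitIndex X equator k ↔ k = 1 := by
  constructor
  · intro h
    exact (h _ (equatorPt_mem 0)).symm.trans (hasOrbitIndex_equator _ (equatorPt_mem 0))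
  · rintro rfl
    exact hasOrbitIndex_equator

/-- The generators in degree `2`. -/
def generators₂ : Fin 1 → Generator X 2 := fun _ =>
  .plus equator isClosedOrbit_equator 1 hasOrbitIndex_equator rfl

/-- The generators in degree `1`. -/
def generators₁ : Fin 3 → Generator X 1 :=
  ![.rest (node 0 0) (isRestPoint_node 0 0) (restIndex_saddle 0),
    .rest (node 1 0) (isRestPoint_node 1 0) (restIndex_saddle 1),
    .minus equator isClosedOrbit_equator hasOrbitIndex_equator]

/-- The generators in degree `0`. -/
def generators₀ : Fin 4 → Generator X 0 := fun j =>
  .rest (sink j) (isRestPoint_node _ _) (restIndex_sink j)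

lemma bijective_generators₂ : Function.Bijective generators₂ := by
  refine ⟨fun i j _ => Subsingleton.elim i j, ?_⟩
  rintro (⟨p, hp, hk⟩ | ⟨γ, hγ, hk⟩ | ⟨γ, hγ, j, hj, hk⟩)
  · obtain ⟨i, e, rfl⟩ := isRestPoint_iff.1 hp
    rw [restIndex_node] at hk
    split_ifs at hk
    omega
  · obtain rfl := isClosedOrbit_iff.1 hγ
    exact absurd (hasOrbitIndex_equator_iff.1 hk) (by norm_num)
  · obtain rfl := isClosedOrbit_iff.1 hγ
    obtain rfl := hasOrbitIndex_equator_iff.1 hj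
    exact ⟨0, rfl⟩

lemma node_ne_equator (i : Fin 2) (e : SignType) : ({node i e} : Set S2) ≠ equator := fun h =>
  spiral_notMem_equator i e 0 (h ▸ Set.mem_singleton _)

lemma bijective_generators₁ : Function.Bijective generators₁ := by
  constructor
  · apply Function.Injective.of_comp (f := Generator.carrier)
    have h1 : ({node 0 0} : Set S2) ≠ {node 1 0} := by
      rw [Ne, Set.singleton_eq_singleton_iff, node_inj]
      simp
    intro i j h
    fin_cases i <;> fin_cases j
    · rfl
    · exact absurd h h1
    · exact absurd h (node_ne_equator _ _)
    · exact absurd h.symm h1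
    · rfl
    · exact absurd h (node_ne_equator _ _)
    · exact absurd h.symm (node_ne_equator _ _)
    · exact absurd h.symm (node_ne_equator _ _)
    · rfl
  rintro (⟨p, hp, hk⟩ | ⟨γ, hγ, hk⟩ | ⟨γ, hγ, j, hj, hk⟩)
  · obtain ⟨i, e, rfl⟩ := isRestPoint_iff.1 hp
    rw [restIndex_node] at hk
    split_ifs at hk with he
    subst he
    fin_cases i
    · exact ⟨0, rfl⟩
    · exact ⟨1, rfl⟩
  · obtain rfl := isClosedOrbit_iff.1 hγ
    exact ⟨2, rfl⟩
  · obtain rfl := isClosedOrbit_iff.1 hγ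
    obtain rfl := hasOrbitIndex_equator_iff.1 hj
    exact absurd hk (by norm_num)

lemma bijective_generators₀ : Function.Bijective generators₀ := by
  constructor
  · intro i j h
    exact sink_injective (Set.singleton_injective (congrArg Generator.carrier h))
  rintro (⟨p, hp, hk⟩ | ⟨γ, hγ, hk⟩ | ⟨γ, hγ, j, hj, hk⟩)
  · obtain ⟨i, e, rfl⟩ := isRestPoint_iff.1 hp
    rw [restIndex_node] at hk
    split_ifs at hk with he
    obtain ⟨j, hj⟩ := exists_sink i he
    refine ⟨j, ?_⟩
    simp [generators₀, hj]
  · obtain rfl := isClosedOrbit_iff.1 hγ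
    exact absurd (hasOrbitIndex_equator_iff.1 hk) (by norm_num)
  · exact absurd hk (by norm_num)

lemma isEmpty_generator (k : ℕ) : IsEmpty (Generator X (k + 3)) := by
  refine ⟨?_⟩
  rintro (⟨p, hp, hk⟩ | ⟨γ, hγ, hk⟩ | ⟨γ, hγ, j, hj, hk⟩)
  · obtain ⟨i, e, rfl⟩ := isRestPoint_iff.1 hp
    rw [restIndex_node] at hk
    split_ifs at hk
    omega
  · obtain rfl := isClosedOrbit_iff.1 hγ
    have := hasOrbitIndex_equator_iff.1 hk
    omega
  · obtain rfl := isClosedOrbit_iff.1 hγ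
    have := hasOrbitIndex_equator_iff.1 hj
    omega

/-- The enumeration of the generators in degree `2`. -/
def enum₂ : Fin 1 ≃ Generator X 2 := Equiv.ofBijective _ bijective_generators₂

/-- The enumeration of the generators in degree `1`. -/
def enum₁ : Fin 3 ≃ Generator X 1 := Equiv.ofBijective _ bijective_generators₁

/-- The enumeration of the generators in degree `0`. -/
def enum₀ : Fin 4 ≃ Generator X 0 := Equiv.ofBijective _ bijective_generators₀

lemma incidence_of_carrier_eq {k l : ℕ} {β : Generator X k} {β' : Generator X l}
    (h : β.carrier = β'.carrier) : incidence X β β' = 0 := by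
  rw [incidence, if_pos h]

lemma incidence_equator_saddle {k l : ℕ} {β : Generator X k} {β' : Generator X l} {i : Fin 2}
    (h : β.carrier = equator) (h' : β'.carrier = {node i 0}) : incidence X β β' = 0 := by
  rw [incidence, h, h', alpha_equator_saddle, ite_self]

lemma incidence_equator_sink {k l : ℕ} {β : Generator X k} {β' : Generator X l} {j : Fin 4}
    (h : β.carrier = equator) (h' : β'.carrier = {sink j}) : incidence X β β' = 1 := by
  rw [incidence, h, h', sink, if_neg (node_ne_equator _ _).symm, alpha_equator_sink]
  exact sink_sign_ne_zero j

lemma incidence_saddle_sink {k l : ℕ} {β : Generator X k} {β' : Generator X l} {i : Fin 2}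
    {j : Fin 4} (h : β.carrier = {node i 0}) (h' : β'.carrier = {sink j}) :
    incidence X β β' = if i = ![0, 0, 1, 1] j then 1 else 0 := by
  rw [incidence, h, h', sink, if_neg, alpha_saddle_node]
  rw [Set.singleton_eq_singleton_iff, node_inj, not_and_or]
  exact Or.inr (sink_sign_ne_zero j).symm

/-- The matrix of the differential in degree `1`. -/
def boundaryMatrix : Matrix (Fin 4) (Fin 3) (ZMod 2) := !![1, 0, 1; 1, 0, 1; 0, 1, 1; 0, 1, 1]

lemma toMatrix_boundary_two :
    LinearMap.toMatrix (chainBasis enum₂) (chainBasis enum₁) (boundary X 2 1) = !![0; 0; 0] := by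
  ext i j
  rw [toMatrix_boundary]
  fin_cases j
  fin_cases i
  · exact incidence_equator_saddle rfl (i := 0) rfl
  · exact incidence_equator_saddle rfl (i := 1) rfl
  · exact incidence_of_carrier_eq rfl

lemma toMatrix_boundary_one :
    LinearMap.toMatrix (chainBasis enum₁) (chainBasis enum₀) (boundary X 1 0) =
      boundaryMatrix := by
  ext i j
  rw [toMatrix_boundary]
  fin_cases j
  · refine (incidence_saddle_sink (i := 0) (j := i) rfl rfl).trans ?_
    revert i
    decide
  · refine (incidence_saddle_sink (i := 1) (j := i) rfl rfl).trans ?_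
    revert i
    decide
  · refine (incidence_equator_sink (j := i) rfl rfl).trans ?_
    revert i
    decide

lemma boundary_two : boundary X 2 1 = 0 := by
  apply (LinearMap.toMatrix (chainBasis enum₂) (chainBasis enum₁)).injective
  rw [toMatrix_boundary_two, map_zero]
  decide

lemma boundary_comp_boundary (k : ℕ) :
    boundary X (k + 1) k ∘ₗ boundary X (k + 2) (k + 1) = 0 := by
  cases k with
  | zero => rw [boundary_two, LinearMap.comp_zero]
  | succ k =>
    have := isEmpty_generator k
    exact LinearMap.ext fun x => by rw [Subsingleton.elim x 0, map_zero, map_zero]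

/-- The kernel of the matrix is spanned by the sum of the three generators. -/
lemma ker_boundaryMatrix : LinearMap.ker boundaryMatrix.mulVecLin =
    Submodule.span (ZMod 2) {![1, 1, 1]} := by
  ext v
  rw [Submodule.mem_span_singleton, LinearMap.mem_ker, Matrix.mulVecLin_apply]
  constructor
  · intro h
    have h0 := congrFun h 0
    have h2 := congrFun h 2
    simp [boundaryMatrix, Matrix.mulVec, dotProduct, Fin.sum_univ_three] at h0 h2
    refine ⟨v 2, ?_⟩
    ext i
    fin_cases i
    · simpa using (CharTwo.add_eq_zero.1 h0).symm
    · simpa using (CharTwo.add_eq_zero.1 h2).symm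
    · simp
  · rintro ⟨a, rfl⟩
    rw [Matrix.mulVec_smul]
    have : boundaryMatrix.mulVec ![1, 1, 1] = 0 := by decide
    rw [this, smul_zero]

lemma finrank_range_boundary_one :
    Module.finrank (ZMod 2) (LinearMap.range (boundary X 1 0)) = 2 := by
  have h1 := Matrix.rank_eq_finrank_range_toLin boundaryMatrix (chainBasis enum₀)
    (chainBasis enum₁)
  rw [← toMatrix_boundary_one, Matrix.toLin_toMatrix, toMatrix_boundary_one] at h1
  have h2 := LinearMap.finrank_range_add_finrank_ker boundaryMatrix.mulVecLin
  have h3 : (![1, 1, 1] : Fin 3 → ZMod 2) ≠ 0 := by decide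
  rw [ker_boundaryMatrix, finrank_span_singleton h3, Module.finrank_fin_fun] at h2
  rw [← h1, Matrix.rank]
  omega

lemma finrank_homology_one : Module.finrank (ZMod 2) (Homology X 1) = 1 := by
  have : Module.Finite (ZMod 2) (Chain X 1) := Module.Finite.of_basis (chainBasis enum₁)
  have h1 := LinearMap.finrank_range_add_finrank_ker (boundary X 1 0)
  rw [finrank_range_boundary_one, Module.finrank_eq_card_basis (chainBasis enum₁),
    Fintype.card_fin] at h1
  have h2 : boundaries X 1 = ⊥ := by
    rw [boundaries, boundary_two, LinearMap.range_zero, Submodule.submoduleOf, Submodule.comap_bot,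
      Submodule.ker_subtype]
  have h3 : Module.finrank (ZMod 2) (Homology X 1) + Module.finrank (ZMod 2) (boundaries X 1) =
      Module.finrank (ZMod 2) (LinearMap.ker (boundary X 1 0)) :=
    Submodule.finrank_quotient_add_finrank (boundaries X 1)
  have h4 : Module.finrank (ZMod 2) (boundaries X 1) = 0 := by rw [h2, finrank_bot]
  rw [h4, add_zero] at h3
  rw [h3]
  exact Nat.add_left_cancel h1

lemma finrank_homology_zero : Module.finrank (ZMod 2) (Homology X 0) = 2 := by
  have : Module.Finite (ZMod 2) (Chain X 0) := Module.Finite.of_basis (chainBasis enum₀)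
  have h1 : cycles X 0 = ⊤ := by
    rw [cycles, boundary, if_neg (by norm_num), LinearMap.ker_zero]
  have h2 : Module.finrank (ZMod 2) (cycles X 0) = 4 := by
    rw [h1, finrank_top, Module.finrank_eq_card_basis (chainBasis enum₀), Fintype.card_fin]
  have h3 : Module.finrank (ZMod 2) (boundaries X 0) = 2 := by
    refine Eq.trans ?_ finrank_range_boundary_one
    exact (Submodule.submoduleOfEquivOfLe (by rw [h1]; exact le_top)).finrank_eq
  have h4 : Module.finrank (ZMod 2) (Homology X 0) + Module.finrank (ZMod 2) (boundaries X 0) =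
      Module.finrank (ZMod 2) (cycles X 0) :=
    Submodule.finrank_quotient_add_finrank (boundaries X 0)
  rw [h2, h3] at h4
  exact Nat.add_right_cancel h4

/-- Singular homology in degree `0` of the sphere, which is path-connected. -/
lemma finrank_singularHomologyS2_zero : Module.finrank (ZMod 2) (singularHomologyS2 0) = 1 := by
  have : PathConnectedSpace (TopCat.of S2) :=
    isPathConnected_iff_pathConnectedSpace.1 (isPathConnected_sphere
      (by rw [← Module.finrank_eq_rank, finrank_euclideanSpace_fin]; norm_num) 0 zero_le_one)
  let f := CategoryTheory.asIso
    ((TopCat.of S2).singularHomology₀ε (ModuleCat.of.{0} (ZMod 2) (ZMod 2)))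
  rw [f.toLinearEquiv.finrank_eq]
  exact Module.finrank_self _

end EidiJost

end

theorem mainTheorem4 :
    ∃ X : (x : EidiJost.S2) → TangentSpace (𝓡 2) x,
      EidiJost.IsMorseSmale X ∧
      ∃ (s : Fin 2 → EidiJost.S2) (q : Fin 4 → EidiJost.S2) (γ : Set EidiJost.S2),
        -- the critical elements: saddles `s i`, sinks `q j`, one repelling closed orbit `γ`
        Function.Injective s ∧ Function.Injective q ∧
        {p | EidiJost.IsRestPoint X p} = Set.range s ∪ Set.range q ∧
        {δ | EidiJost.IsClosedOrbit X δ} = {γ} ∧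
        (∀ i, EidiJost.restIndex X (s i) = 1) ∧
        (∀ j, EidiJost.restIndex X (q j) = 0) ∧
        EidiJost.HasOrbitIndex X γ 1 ∧
        -- the numbers of connected components counted by the differential are finite
        (∀ β₁ β₂, EidiJost.IsCriticalElement X β₁ → EidiJost.IsCriticalElement X β₂ →
          Finite (ConnectedComponents ↥(EidiJost.Wu X β₁ ∩ EidiJost.Ws X β₂))) ∧
        -- the Eidi–Jost complex in the bases `γ⁺`; `s 0, s 1, γ⁻`; `q 0, …, q 3`
        (∃ (e₂ : Fin 1 ≃ EidiJost.Generator X 2) (e₁ : Fin 3 ≃ EidiJost.Generator X 1)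
            (e₀ : Fin 4 ≃ EidiJost.Generator X 0),
          (∃ hγ hj hk, e₂ 0 = .plus γ hγ 1 hj hk) ∧
          (∃ hp hk, e₁ 0 = .rest (s 0) hp hk) ∧
          (∃ hp hk, e₁ 1 = .rest (s 1) hp hk) ∧
          (∃ hγ hk, e₁ 2 = .minus γ hγ hk) ∧
          (∀ j, ∃ hp hk, e₀ j = .rest (q j) hp hk) ∧
          LinearMap.toMatrix (EidiJost.chainBasis e₂) (EidiJost.chainBasis e₁)
            (EidiJost.boundary X 2 1) = !![0; 0; 0] ∧
          LinearMap.toMatrix (EidiJost.chainBasis e₁) (EidiJost.chainBasis e₀)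
            (EidiJost.boundary X 1 0) = !![1, 0, 1; 1, 0, 1; 0, 1, 1; 0, 1, 1]) ∧
        (∀ k, EidiJost.boundary X (k + 1) k ∘ₗ EidiJost.boundary X (k + 2) (k + 1) = 0) ∧
        EidiJost.boundary X 2 1 = 0 ∧
        Module.finrank (ZMod 2) (LinearMap.range (EidiJost.boundary X 1 0)) = 2 ∧
        -- the homology, and its disagreement with the homology of the sphere
        Module.finrank (ZMod 2) (EidiJost.Homology X 1) = 1 ∧
        Module.finrank (ZMod 2) (EidiJost.Homology X 0) = 2 ∧
        ¬ (∀ k : ℕ, Nonempty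
          (EidiJost.Homology X k ≃ₗ[ZMod 2] EidiJost.singularHomologyS2 k)) := by
  open EidiJost in
  refine ⟨X, isMorseSmale_X, fun i => node i 0, sink, equator,
    fun i j h => (node_inj.1 h).1, sink_injective, ?_, ?_, restIndex_saddle, restIndex_sink,
    hasOrbitIndex_equator, fun _ _ => finite_components, ⟨enum₂, enum₁, enum₀,
      ⟨_, _, _, rfl⟩, ⟨_, _, rfl⟩, ⟨_, _, rfl⟩, ⟨_, _, rfl⟩, fun j => ⟨_, _, rfl⟩,
      toMatrix_boundary_two, toMatrix_boundary_one⟩, boundary_comp_boundary, boundary_two,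
    finrank_range_boundary_one, finrank_homology_one, finrank_homology_zero, fun h => ?_⟩
  · ext p
    rw [Set.mem_ofPred_eq, isRestPoint_iff]
    constructor
    · rintro ⟨i, e, rfl⟩
      by_cases he : e = 0
      · exact Or.inl ⟨i, by rw [he]⟩
      · obtain ⟨j, hj⟩ := exists_sink i he
        exact Or.inr ⟨j, hj.symm⟩
    · rintro (⟨i, rfl⟩ | ⟨j, rfl⟩)
      · exact ⟨i, 0, rfl⟩
      · exact ⟨_, _, rfl⟩
  · ext γ
    exact isClosedOrbit_iff
  · obtain ⟨f⟩ := h 0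
    have h1 := f.finrank_eq
    rw [finrank_homology_zero, finrank_singularHomologyS2_zero] at h1
    exact absurd h1 (by norm_num)
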